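/- Let $N\ge 2$, let $q$ be a real number with $0<q<1$ and let $k\in\mathbb{C}^\times$. Put $T=(\mathbb{C}^\times)^N$ with coordinate functions $x_1,\dots,x_N$, let $\mathbb{C}[T]$ and $\mathbb{C}(T)$ be the rings of regular and of rational functions on $T$, and let $\mathbb{K}$ be the field of meromorphic functions on $T\times T$. **Weyl group.** $W=S_N\ltimes\mathbb{Z}^N$ acts on $T$ by $(wt)_i=t_{w^{-1}(i)}$ for $w\in S_N$ and $(\lambda t)_i=q^{\lambda_i}t_i$ for $\lambda\in\mathbb{Z}^N$, and on functions by $(wf)(t)=f(w^{-1}t)$. Let $s_i$ ($1\le i<N$) be the simple transpositions, $\epsilon_1,\dots,\epsilon_N$ the standard basis of $\mathbb{Z}^N$, $\pi=s_1\cdots s_{N-1}\epsilon_N$ and $s_0=\pi s_{N-1}\pi^{-1}$. A reduced expression of $w\in W$ is an expression $w=s_{j_1}\cdots s_{j_r}\pi^m$ ($0\le j_l<N$, $m\in\mathbb{Z}$) with $r$ minimal. Let $w\mapsto w^\diamondsuit$ be the automorphism of $W$ that is the identity on $S_N$ and $\lambda\mapsto-\lambda$ on $\mathbb{Z}^N$;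 for $p\in\mathbb{C}[T]$ put $p^\diamondsuit(t)=p(t^{-1})$. **Hecke algebras.** In the smash product $\mathbb{C}(T)\#W$ write $f(X)$ for the element given by $f\in\mathbb{C}(T)$, $X^\lambda=x^\lambda(X)$ for $\lambda\in\mathbb{Z}^N$, and put $$T_i=k+c_k(X_i/X_{i+1})(s_i-1)\quad(1\le i<N),\qquad c_k(z)=\frac{k^{-1}-kz}{1-z}.$$ Let $H_0$ be the subalgebra generated by $T_1,\dots,T_{N-1}$ (the finite Hecke algebra), and let $\mathbb{H}$ be the subalgebra generated by $H_0$, $\pi^{\pm1}$ and all $f(X)$ with $f\in\mathbb{C}[T]$ (the double affine Hecke algebra). Let $Y_i=T_{i-1}^{-1}\cdots T_1^{-1}\,\pi\, T_{N-1}\cdots T_i$, $Y^\lambda=Y_1^{\lambda_1}\cdots Y_N^{\lambda_N}$, and $g(Y)=\sum_\lambda c_\lambda Y^\lambda$ for $g=\sum_\lambda c_\lambda x^\lambda\in\mathbb{C}[T]$. Put $d_i=k-k^{-1}x_{i+1}/x_i$ ($1\le i<N$), $d_0=k-k^{-1}q^{-1}x_1/x_N$ and $\widetilde S_j=d_j(X)s_j$.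 For a reduced expression $w=s_{j_1}\cdots s_{j_r}\pi^m$ let $$\widetilde S_w=\widetilde S_{j_1}\cdots\widetilde S_{j_r}\pi^m\in\mathbb{H},\qquad d_w=d_{j_1}\,(s_{j_1}d_{j_2})\cdots(s_{j_1}\cdots s_{j_{r-1}}d_{j_r})\in\mathbb{C}[T],$$ so that $\widetilde S_w=d_w(X)w$. **The group $\mathbb{W}$.** Let $\mathbb{W}=\mathbb{Z}_2\ltimes(W\times W)$, where the generator $\iota$ of $\mathbb{Z}_2$ switches the two factors. It acts on $T\times T$ by $(w,w')(t,\gamma)=(wt,w'^\diamondsuit\gamma)$ and $\iota(t,\gamma)=(\gamma^{-1},t^{-1})$, hence on $\mathbb{K}$ by $(\mathrm{w}f)(t,\gamma)=f(\mathrm{w}^{-1}(t,\gamma))$. On $H_0^{\mathbb{K}}=\mathbb{K}\otimes_{\mathbb{C}}H_0$ (the $H_0$-valued meromorphic functions on $T\times T$) let $\mathrm{w}\in\mathbb{W}$ act through the $\mathbb{K}$-coefficients; this is also written $f\mapsto \mathrm{w}f$. For $f\in\mathbb{C}[T]$ let $f(x),f(y)\in\mathbb{K}$ be the functions $(t,\gamma)\mapsto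 f(t)$ and $(t,\gamma)\mapsto f(\gamma)$. **Theorem.** 1. There is a unique $\mathbb{C}$-linear anti-algebra involution $*$ of $\mathbb{H}$ with $T_i^*=T_i$ ($1\le i<N$), $(Y^\lambda)^*=X^{-\lambda}$ and $(X^\lambda)^*=Y^{-\lambda}$ ($\lambda\in\mathbb{Z}^N$), and there is a unique $\mathbb{C}$-linear map $j\colon\mathbb{H}\to H_0^{\mathbb{K}}$ with $j(f(X)\,h\,g(Y))=f(x)g(y)\otimes h$ for $f,g\in\mathbb{C}[T]$, $h\in H_0$. For all $w,w'\in W$ there is a unique $\mathbb{C}$-linear endomorphism $\widetilde\sigma_{(w,w')}$ of $H_0^{\mathbb{K}}$ with $\widetilde\sigma_{(w,w')}(j(h))=j(\widetilde S_w h\widetilde S_{w'}^*)$ for $h\in\mathbb{H}$ and $\widetilde\sigma_{(w,w')}(a f)=((w,w')a)\,\widetilde\sigma_{(w,w')}(f)$ for $a\in\mathbb{K}$, $f\in H_0^{\mathbb{K}}$. Likewise there is a unique $\mathbb{C}$-linear endomorphism $\widetilde\sigma_\iota$ with $\widetilde\sigma_\iota(j(h))=j(h^*)$ and $\widetilde\sigma_\iota(af)=(\iota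 a)\,\widetilde\sigma_\iota(f)$. 2. There is a unique group homomorphism $\tau\colon\mathbb{W}\to\mathrm{GL}_{\mathbb{C}}(H_0^{\mathbb{K}})$ such that $$\tau(w,w')f=d_w(x)^{-1}\,d_{w'}^\diamondsuit(y)^{-1}\,\widetilde\sigma_{(w,w')}(f),\qquad \tau(\iota)f=\widetilde\sigma_\iota(f)$$ for all $w,w'\in W$ and $f\in H_0^{\mathbb{K}}$. It satisfies $\tau(\mathrm{w})(af)=(\mathrm{w}a)\,\tau(\mathrm{w})f$ for $\mathrm{w}\in\mathbb{W}$, $a\in\mathbb{K}$, $f\in H_0^{\mathbb{K}}$. 3. $C_{\mathrm{w}}:=\tau(\mathrm{w})\mathrm{w}^{-1}$ lies in $\mathrm{GL}_{\mathbb{K}}(H_0^{\mathbb{K}})$ for every $\mathrm{w}\in\mathbb{W}$, and $C$ is a cocycle: $C_{\mathrm{w}\mathrm{w}'}=C_{\mathrm{w}}\,\mathrm{w}C_{\mathrm{w}'}\mathrm{w}^{-1}$ for all $\mathrm{w},\mathrm{w}'\in\mathbb{W}$. 4. The BqKZ equations $C_{(\lambda,\mu)}(t,\gamma)f(q^{-\lambda}t,q^{\mu}\gamma)=f(t,\gamma)$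 ($\lambda,\mu\in\mathbb{Z}^N$) form a holonomic system of $q$-difference equations: for all $\lambda,\mu,\nu,\xi\in\mathbb{Z}^N$, $$C_{(\lambda,\mu)}(t,\gamma)\,C_{(\nu,\xi)}(q^{-\lambda}t,q^{\mu}\gamma)=C_{(\nu,\xi)}(t,\gamma)\,C_{(\lambda,\mu)}(q^{-\nu}t,q^{\xi}\gamma)$$ as $\mathrm{End}(H_0)$-valued meromorphic functions on $T\times T$. 5. The set $\mathrm{SOL}$ of all $f\in H_0^{\mathbb{K}}$ satisfying the BqKZ equations is an $\mathbb{F}$-linear subspace of $H_0^{\mathbb{K}}$, where $\mathbb{F}\subset\mathbb{K}$ is the subfield of functions invariant under all $(\lambda,\mu)\in\mathbb{Z}^N\times\mathbb{Z}^N$, and $\mathrm{SOL}$ is stable under $\tau(\mathbb{S}_N)$, where $\mathbb{S}_N=\mathbb{Z}_2\ltimes(S_N\times S_N)\subset\mathbb{W}$. -/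

import Mathlib

open scoped TensorProduct

namespace BqKZ

noncomputable section

/-! ### The extended affine Weyl group of `GL_N` -/

/-- The symmetric group acting on `ℤ^N` (written multiplicatively) by permuting coordinates,
`(σ λ)_i = λ_{σ⁻¹ i}`. -/
def permLattice (N : ℕ) : Equiv.Perm (Fin N) →* MulAut (Multiplicative (Fin N → ℤ)) where
  toFun σ :=
    { toFun := fun v => Multiplicative.ofAdd fun i => v.toAdd (σ⁻¹ i)
      invFun := fun v => Multiplicative.ofAdd fun i => v.toAdd (σ i)
      left_inv := fun v => by ext i; simp
      right_inv := fun v => by ext i; simp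
      map_mul' := fun v w => rfl }
  map_one' := by ext v i; rfl
  map_mul' σ ρ := by ext v i; simp [mul_inv_rev]

/-- The extended affine Weyl group `W = S_N ⋉ ℤ^N`. The element `⟨λ, σ⟩` is the product `λ σ`. -/
abbrev W (N : ℕ) : Type := Multiplicative (Fin N → ℤ) ⋊[permLattice N] Equiv.Perm (Fin N)

/-- The translation by `v ∈ ℤ^N` as an element of `W`. -/
def transl {N : ℕ} (v : Fin N → ℤ) : W N := SemidirectProduct.inl (Multiplicative.ofAdd v)

/-- A permutation as an element of `W`. -/
def perm {N : ℕ} (σ : Equiv.Perm (Fin N)) : W N := SemidirectProduct.inr σ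

/-- The involution `◇` of `W`: the identity on `S_N` and `λ ↦ -λ` on `ℤ^N`. -/
def diamond (N : ℕ) : W N →* W N :=
  SemidirectProduct.map (MulEquiv.inv (Multiplicative (Fin N → ℤ))).toMonoidHom
    (MonoidHom.id (Equiv.Perm (Fin N))) (fun σ => by ext v i; rfl)

/-- The action of `W` on the torus `T = (ℂ^×)^N`: permutations act by
`(σ t)_i = t_{σ⁻¹ i}`, and `λ ∈ ℤ^N` acts by `(λ t)_i = q^{λ_i} t_i`. -/
def torusAct {N : ℕ} (q : ℂˣ) (w : W N) (t : Fin N → ℂˣ) : Fin N → ℂˣ :=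
  fun i => q ^ (w.left.toAdd i) * t (w.right⁻¹ i)

theorem torusAct_one {N : ℕ} (q : ℂˣ) (t : Fin N → ℂˣ) : torusAct q 1 t = t := by
  funext i; simp [torusAct]

theorem torusAct_mul {N : ℕ} (q : ℂˣ) (w w' : W N) (t : Fin N → ℂˣ) :
    torusAct q (w * w') t = torusAct q w (torusAct q w' t) := by
  funext i
  simp [torusAct, permLattice, zpow_add, mul_assoc]

theorem torusAct_diamond_inv {N : ℕ} (q : ℂˣ) (w : W N) (t : Fin N → ℂˣ) :
    (torusAct q (diamond N w) t)⁻¹ = torusAct q w t⁻¹ := by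
  funext i
  simp [torusAct, diamond, mul_comm]

/-! ### Regular and rational functions on `T` -/

/-- The algebra `ℂ[T] = ℂ[x_1^{±1}, …, x_N^{±1}]` of regular functions on `T`. It does not depend
on `q`; the parameter only records which action of `W` it carries. -/
def Laurent (N : ℕ) (_q : ℂˣ) : Type := AddMonoidAlgebra ℂ (Fin N → ℤ)

instance (N : ℕ) (q : ℂˣ) : CommRing (Laurent N q) :=
  inferInstanceAs (CommRing (AddMonoidAlgebra ℂ (Fin N → ℤ)))
instance (N : ℕ) (q : ℂˣ) : Algebra ℂ (Laurent N q) :=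
  inferInstanceAs (Algebra ℂ (AddMonoidAlgebra ℂ (Fin N → ℤ)))
instance (N : ℕ) (q : ℂˣ) : IsDomain (Laurent N q) := 
  inferInstanceAs (IsDomain (AddMonoidAlgebra ℂ (Fin N → ℤ)))

/-- The monomial `x^v`, as a homomorphism from `ℤ^N`. -/
def xpow {N : ℕ} {q : ℂˣ} : Multiplicative (Fin N → ℤ) →* Laurent N q :=
  AddMonoidAlgebra.of ℂ (Fin N → ℤ)

/-- The universal property of `ℂ[T]`: the algebra map with `x^v ↦ F v`. -/
def Laurent.lift {N : ℕ} {q : ℂˣ} {A : Type*} [Semiring A] [Algebra ℂ A]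
    (F : Multiplicative (Fin N → ℤ) →* A) : Laurent N q →ₐ[ℂ] A :=
  AddMonoidAlgebra.lift ℂ A (Fin N → ℤ) F

theorem Laurent.lift_xpow {N : ℕ} {q : ℂˣ} {A : Type*} [Semiring A] [Algebra ℂ A]
    (F : Multiplicative (Fin N → ℤ) →* A) (v : Multiplicative (Fin N → ℤ)) :
    Laurent.lift (q := q) F (xpow v) = F v := by
  exact (AddMonoidAlgebra.lift_single F v.toAdd (1 : ℂ)).trans (one_smul _ _)

theorem Laurent.algHom_ext {N : ℕ} {q : ℂˣ} {A : Type*} [Semiring A] [Algebra ℂ A]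
    {F G : Laurent N q →ₐ[ℂ] A} (h : ∀ v, F (xpow v) = G (xpow v)) : F = G := by
  refine AddMonoidAlgebra.algHom_ext (R := ℂ) (M := Fin N → ℤ) (A := ℂ) (fun m => h (Multiplicative.ofAdd m)) ?_
  ext

theorem Laurent.induction {N : ℕ} {q : ℂˣ} {P : Laurent N q → Prop}
    (hx : ∀ v, P (xpow v)) (hadd : ∀ f g, P f → P g → P (f + g))
    (hsmul : ∀ (c : ℂ) f, P f → P (c • f)) (f : Laurent N q) : P f :=
  AddMonoidAlgebra.induction_on (R := ℂ) (M := Fin N → ℤ) f hx hadd hsmul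

/-- The value `f(t)` of a regular function `f ∈ ℂ[T]` at `t ∈ T`. -/
def Laurent.eval {N : ℕ} {q : ℂˣ} (t : Fin N → ℂˣ) : Laurent N q →ₐ[ℂ] ℂ :=
  Laurent.lift
    { toFun := fun v => ((∏ i, t i ^ (v.toAdd i) : ℂˣ) : ℂ)
      map_one' := by simp
      map_mul' := fun v w => by simp [zpow_add₀, Finset.prod_mul_distrib] }

theorem Laurent.eval_xpow {N : ℕ} {q : ℂˣ} (t : Fin N → ℂˣ) (v : Multiplicative (Fin N → ℤ)) :
    Laurent.eval (q := q) t (xpow v) = ((∏ i, t i ^ (v.toAdd i) : ℂˣ) : ℂ) :=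
  Laurent.lift_xpow _ _

/-- The action of `w ∈ W` on `ℂ[T]` by `(w f)(t) = f(w⁻¹ t)`. On monomials, `λ σ` maps `x^v` to
`q^{-⟨λ, σ v⟩} x^{σ v}`. -/
def laurentAct {N : ℕ} (q : ℂˣ) (w : W N) : Laurent N q →ₐ[ℂ] Laurent N q :=
  Laurent.lift
    { toFun := fun v =>
        ((q ^ (-∑ i, w.left.toAdd i * (permLattice N w.right v).toAdd i) : ℂˣ) : ℂ) •
          xpow (permLattice N w.right v)
      map_one' := by simp
      map_mul' := fun v v' => by
        simp only [map_mul, toAdd_mul, Pi.add_apply, mul_add, Finset.sum_add_distrib, neg_add,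
          zpow_add, Units.val_mul]
        rw [smul_mul_smul_comm] }

theorem laurentAct_xpow {N : ℕ} (q : ℂˣ) (w : W N) (v : Multiplicative (Fin N → ℤ)) :
    laurentAct q w (xpow v) =
      ((q ^ (-∑ i, w.left.toAdd i * (permLattice N w.right v).toAdd i) : ℂˣ) : ℂ) •
          xpow (permLattice N w.right v) :=
  Laurent.lift_xpow _ _

theorem zpow_finset_sum {ι : Type*} (q : ℂˣ) (s : Finset ι) (a : ι → ℤ) :
    q ^ (∑ i ∈ s, a i) = ∏ i ∈ s, q ^ a i := by
  classical
  induction s using Finset.induction_on with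
  | empty => simp
  | insert i s hi ih => rw [Finset.sum_insert hi, Finset.prod_insert hi, zpow_add, ih]

theorem laurentAct_eval {N : ℕ} (q : ℂˣ) (w : W N) (f : Laurent N q) (t : Fin N → ℂˣ) :
    (laurentAct q w f).eval t = f.eval (torusAct q w⁻¹ t) := by
  change ((Laurent.eval t).comp (laurentAct q w)) f = _
  congr 1
  refine Laurent.algHom_ext fun v => ?_
  rw [AlgHom.comp_apply, laurentAct_xpow, map_smul, Laurent.eval_xpow, Laurent.eval_xpow,
    smul_eq_mul, ← Units.val_mul]
  congr 1
  rw [← Equiv.prod_comp w.right (fun i => t i ^ _), ← Equiv.sum_comp w.right, ← Finset.sum_neg_distrib,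
    zpow_finset_sum, ← Finset.prod_mul_distrib]
  refine Finset.prod_congr rfl fun i _ => ?_
  simp [torusAct, permLattice, mul_zpow, ← zpow_mul]
  rfl

instance (N : ℕ) (q : ℂˣ) : MulSemiringAction (W N) (Laurent N q) where
  smul w f := laurentAct q w f
  one_smul f := by
    change laurentAct q 1 f = AlgHom.id ℂ _ f
    congr 1
    refine Laurent.algHom_ext fun v => ?_
    simp [laurentAct_xpow]
  mul_smul w w' f := by
    change laurentAct q (w * w') f = ((laurentAct q w).comp (laurentAct q w')) f
    congr 1
    refine Laurent.algHom_ext fun v => ?_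
    simp only [laurentAct_xpow, AlgHom.comp_apply, map_smul, smul_smul, SemidirectProduct.mul_right,
      SemidirectProduct.mul_left, map_mul, MulAut.mul_apply, ← Units.val_mul, ← zpow_add, toAdd_mul, Pi.add_apply, add_mul, Finset.sum_add_distrib, neg_add]
    congr 3
    rw [add_comm]
    congr 2
    exact (Equiv.sum_comp w.right _).symm.trans (by simp [permLattice])
  smul_zero w := map_zero _
  smul_add w := map_add _
  smul_one w := map_one _
  smul_mul w := map_mul _

instance (N : ℕ) (q : ℂˣ) : SMulCommClass (W N) ℂ (Laurent N q) where
  smul_comm w c f := map_smul (laurentAct q w) c f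

/-- The field `ℂ(T)` of rational functions on `T`. -/
def RatFun (N : ℕ) (q : ℂˣ) : Type := FractionRing (Laurent N q)

instance (N : ℕ) (q : ℂˣ) : Field (RatFun N q) :=
  inferInstanceAs (Field (FractionRing (Laurent N q)))
instance (N : ℕ) (q : ℂˣ) : Algebra (Laurent N q) (RatFun N q) :=
  inferInstanceAs (Algebra (Laurent N q) (FractionRing (Laurent N q)))
instance (N : ℕ) (q : ℂˣ) : IsFractionRing (Laurent N q) (RatFun N q) :=
  inferInstanceAs (IsFractionRing (Laurent N q) (FractionRing (Laurent N q)))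
instance (N : ℕ) (q : ℂˣ) : Algebra ℂ (RatFun N q) :=
  inferInstanceAs (Algebra ℂ (FractionRing (Laurent N q)))
instance (N : ℕ) (q : ℂˣ) : IsScalarTower ℂ (Laurent N q) (RatFun N q) :=
  inferInstanceAs (IsScalarTower ℂ (Laurent N q) (FractionRing (Laurent N q)))

/-- `W` acts on `ℂ(T)` by field automorphisms extending the action on `ℂ[T]`. -/
instance (N : ℕ) (q : ℂˣ) : MulSemiringAction (W N) (RatFun N q) :=
  IsFractionRing.mulSemiringAction (W N) (Laurent N q) (RatFun N q)

instance (N : ℕ) (q : ℂˣ) : SMulDistribClass (W N) (Laurent N q) (RatFun N q) :=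
  IsFractionRing.smulDistribClass (W N) (Laurent N q) (RatFun N q)

theorem smul_algebraMap_ratFun {N : ℕ} {q : ℂˣ} (w : W N) (f : Laurent N q) :
    w • algebraMap (Laurent N q) (RatFun N q) f = algebraMap (Laurent N q) (RatFun N q) (w • f) :=
  (algebraMap.coe_smul' w f (RatFun N q)).symm

instance (N : ℕ) (q : ℂˣ) : SMulCommClass (W N) ℂ (RatFun N q) where
  smul_comm w c f := by
    rw [Algebra.smul_def, Algebra.smul_def, smul_mul',
      IsScalarTower.algebraMap_apply ℂ (Laurent N q) (RatFun N q), smul_algebraMap_ratFun,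
      smul_algebraMap]

/-- The smashed product algebra `ℂ(T) # W`. -/
abbrev Smash (N : ℕ) (q : ℂˣ) : Type := SkewMonoidAlgebra (RatFun N q) (W N)


/-! ### The group `𝕎` and meromorphic functions on `T × T` -/

/-- The nontrivial element of `ℤ_2` switches the two components of `W × W`. -/
def switchHom (N : ℕ) : Multiplicative (ZMod 2) →* MulAut (W N × W N) where
  toFun z := if z = 1 then 1 else MulEquiv.prodComm
  map_one' := by simp
  map_mul' := by
    have h : ∀ z : Multiplicative (ZMod 2), z = 1 ∨ z = Multiplicative.ofAdd 1 := by decide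
    have h1 : (Multiplicative.ofAdd 1 : Multiplicative (ZMod 2)) ≠ 1 := by decide
    have h2 : (Multiplicative.ofAdd 1 : Multiplicative (ZMod 2)) * Multiplicative.ofAdd 1 = 1 := by
      decide
    intro a b
    rcases h a with rfl | rfl <;> rcases h b with rfl | rfl
    · simp
    · simp [h1]
    · simp [h1]
    · rw [h2, if_pos rfl, if_neg h1]
      rfl

/-- The group `𝕎 = ℤ_2 ⋉ (W × W)`. -/
abbrev BW (N : ℕ) : Type := (W N × W N) ⋊[switchHom N] Multiplicative (ZMod 2)

/-- The element `(w, w')` of `𝕎`. -/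
def bw {N : ℕ} (w w' : W N) : BW N := SemidirectProduct.inl (w, w')

/-- The element `ι` of `𝕎`. -/
def bwIota {N : ℕ} : BW N := SemidirectProduct.inr (Multiplicative.ofAdd 1)

/-- The torus `T = (ℂ^×)^N`. -/
abbrev Torus (N : ℕ) : Type := Fin N → ℂˣ

/-- The action of `𝕎` on `T × T`: `(w, w')(t, γ) = (w t, w'^◇ γ)` and `ι(t, γ) = (γ⁻¹, t⁻¹)`. -/
def pairAct {N : ℕ} (q : ℂˣ) (g : BW N) (p : Torus N × Torus N) : Torus N × Torus N :=
  if g.right = 1 then (torusAct q g.left.1 p.1, torusAct q (diamond N g.left.2) p.2)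
  else (torusAct q g.left.1 p.2⁻¹, torusAct q (diamond N g.left.2) p.1⁻¹)

theorem pairAct_bw {N : ℕ} (q : ℂˣ) (w w' : W N) (t γ : Torus N) :
    pairAct q (bw w w') (t, γ) = (torusAct q w t, torusAct q (diamond N w') γ) := rfl

theorem pairAct_iota {N : ℕ} (q : ℂˣ) (t γ : Torus N) :
    pairAct q bwIota (t, γ) = (γ⁻¹, t⁻¹) := by
  have h1 : (Multiplicative.ofAdd 1 : Multiplicative (ZMod 2)) ≠ 1 := by decide
  simp [pairAct, bwIota, h1, torusAct_one]

theorem pairAct_one {N : ℕ} (q : ℂˣ) (p : Torus N × Torus N) : pairAct q 1 p = p := by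
  simp [pairAct, torusAct_one]

theorem torusAct_inv_diamond {N : ℕ} (q : ℂˣ) (w : W N) (t : Torus N) :
    (torusAct q w t)⁻¹ = torusAct q (diamond N w) t⁻¹ := by
  rw [← inv_inj, torusAct_diamond_inv, inv_inv, inv_inv]

theorem diamond_diamond {N : ℕ} (w : W N) : diamond N (diamond N w) = w := by
  ext <;> simp [diamond]

theorem pairAct_mul {N : ℕ} (q : ℂˣ) (g g' : BW N) (p : Torus N × Torus N) :
    pairAct q (g * g') p = pairAct q g (pairAct q g' p) := by
  have h : ∀ z : Multiplicative (ZMod 2), z = 1 ∨ z = Multiplicative.ofAdd 1 := by decide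
  have h1 : (Multiplicative.ofAdd 1 : Multiplicative (ZMod 2)) ≠ 1 := by decide
  have h2 : (Multiplicative.ofAdd 1 : Multiplicative (ZMod 2)) * Multiplicative.ofAdd 1 = 1 := by
    decide
  obtain ⟨⟨w, w'⟩, z⟩ := g
  obtain ⟨⟨v, v'⟩, z'⟩ := g'
  have key : (⟨(w, w'), z⟩ * ⟨(v, v'), z'⟩ : BW N) = ⟨(w, w') * switchHom N z (v, v'), z * z'⟩ := rfl
  rw [key]
  rcases h z with rfl | rfl <;> rcases h z' with rfl | rfl <;>
    simp [pairAct, switchHom, h1, h2, torusAct_mul, torusAct_inv_diamond, diamond_diamond,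
      -SemidirectProduct.mk_eq_inl_mul_inr]

/-- The open subset of `ℂ^N × ℂ^N` of points without vanishing coordinates, i.e. `T × T`. -/
def torusSet (N : ℕ) : Set ((Fin N → ℂ) × (Fin N → ℂ)) :=
  {z | (∀ i, z.1 i ≠ 0) ∧ ∀ i, z.2 i ≠ 0}

/-- A point of `T × T` as a point of `ℂ^N × ℂ^N`. -/
def torusVal {N : ℕ} (p : Torus N × Torus N) : (Fin N → ℂ) × (Fin N → ℂ) :=
  (fun i => p.1 i, fun i => p.2 i)

theorem torusVal_mem {N : ℕ} (p : Torus N × Torus N) : torusVal p ∈ torusSet N :=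
  ⟨fun i => (p.1 i).ne_zero, fun i => (p.2 i).ne_zero⟩

theorem exists_torusVal {N : ℕ} {z : (Fin N → ℂ) × (Fin N → ℂ)} (hz : z ∈ torusSet N) :
    ∃ p : Torus N × Torus N, torusVal p = z :=
  ⟨(fun i => Units.mk0 _ (hz.1 i), fun i => Units.mk0 _ (hz.2 i)), rfl⟩

theorem isPreconnected_torusSet (N : ℕ) : IsPreconnected (torusSet N) := by
  have h : torusSet N = Set.range fun z : (Fin N → ℂ) × (Fin N → ℂ) =>
      ((fun i => Complex.exp (z.1 i), fun i => Complex.exp (z.2 i)) :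
        (Fin N → ℂ) × (Fin N → ℂ)) := by
    ext z
    constructor
    · intro hz
      exact ⟨(fun i => Complex.log (z.1 i), fun i => Complex.log (z.2 i)), by
        ext i
        · exact Complex.exp_log (hz.1 i)
        · exact Complex.exp_log (hz.2 i)⟩
    · rintro ⟨y, rfl⟩
      exact ⟨fun i => Complex.exp_ne_zero _, fun i => Complex.exp_ne_zero _⟩
  rw [h]
  exact isPreconnected_range (by fun_prop)

/-- The algebra `𝓞(T × T)` of analytic functions on `T × T`. -/
def holSubalgebra (N : ℕ) : Subalgebra ℂ (Torus N × Torus N → ℂ) where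
  carrier := {f | ∃ g : (Fin N → ℂ) × (Fin N → ℂ) → ℂ,
    AnalyticOnNhd ℂ g (torusSet N) ∧ ∀ p, f p = g (torusVal p)}
  mul_mem' := by
    rintro f f' ⟨g, hg, h⟩ ⟨g', hg', h'⟩
    exact ⟨g * g', hg.mul hg', fun p => by simp [h, h']⟩
  add_mem' := by
    rintro f f' ⟨g, hg, h⟩ ⟨g', hg', h'⟩
    exact ⟨g + g', hg.add hg', fun p => by simp [h, h']⟩
  algebraMap_mem' := fun c => ⟨fun _ => c, analyticOnNhd_const, fun p => rfl⟩

/-- The ring `𝓞(T × T)`; as before, the parameter `q` only records which action it carries. -/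
def Hol (N : ℕ) (_q : ℂˣ) : Type := holSubalgebra N

instance (N : ℕ) (q : ℂˣ) : CommRing (Hol N q) := inferInstanceAs (CommRing (holSubalgebra N))
instance (N : ℕ) (q : ℂˣ) : Algebra ℂ (Hol N q) := inferInstanceAs (Algebra ℂ (holSubalgebra N))

/-- The function underlying an element of `𝓞(T × T)`. -/
def Hol.toFun {N : ℕ} {q : ℂˣ} : Hol N q →ₐ[ℂ] (Torus N × Torus N → ℂ) := (holSubalgebra N).val

theorem Hol.toFun_injective {N : ℕ} {q : ℂˣ} : Function.Injective (Hol.toFun (N := N) (q := q)) :=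
  Subtype.val_injective

instance (N : ℕ) (q : ℂˣ) : IsDomain (Hol N q) := by
  have : Nontrivial (Hol N q) := by
    refine ⟨0, 1, fun h => ?_⟩
    have := congrFun (congrArg Hol.toFun h) (1, 1)
    simp at this
  have : NoZeroDivisors (Hol N q) := by
    refine ⟨fun {a b} hab => ?_⟩
    by_contra! hne
    obtain ⟨ha, hb⟩ := hne
    obtain ⟨g, hg, hga⟩ := a.2
    obtain ⟨g', hg', hgb⟩ := b.2
    have hex : ∃ p, Hol.toFun a p ≠ 0 := by
      by_contra! h
      exact ha (Hol.toFun_injective (by rw [map_zero]; exact funext h))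
    obtain ⟨p, hp⟩ := hex
    have hp' : g (torusVal p) ≠ 0 := by rw [← hga p]; exact hp
    have hev : g' =ᶠ[nhds (torusVal p)] 0 := by
      have hopen : torusSet N ∈ nhds (torusVal p) := by
        have : IsOpen (torusSet N) := by
          have : torusSet N = (⋂ i, {z | z.1 i ≠ 0}) ∩ ⋂ i, {z | z.2 i ≠ 0} := by
            ext z; simp [torusSet]
          rw [this]
          refine (isOpen_iInter_of_finite fun i => ?_).inter (isOpen_iInter_of_finite fun i => ?_)
          · exact isOpen_ne_fun (by fun_prop) (by fun_prop)
          · exact isOpen_ne_fun (by fun_prop) (by fun_prop)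
        exact this.mem_nhds (torusVal_mem p)
      filter_upwards [hopen, (hg _ (torusVal_mem p)).continuousAt.eventually_ne hp'] with z hz hgz
      obtain ⟨r, rfl⟩ := exists_torusVal hz
      have h0 := congrFun (congrArg Hol.toFun hab) r
      rw [map_mul, map_zero, Pi.mul_apply] at h0
      rcases mul_eq_zero.mp h0 with h | h
      · exact absurd ((hga r).symm.trans h) hgz
      · exact (hgb r).symm.trans h
    have hz := hg'.eqOn_zero_of_preconnected_of_eventuallyEq_zero (isPreconnected_torusSet N)
      (torusVal_mem p) hev
    exact hb (Hol.toFun_injective (by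
      rw [map_zero]
      funext r
      exact (hgb r).trans (hz (torusVal_mem r))))
  exact NoZeroDivisors.to_isDomain _

/-- Coordinate form of the map `pairAct q g` on `ℂ^N × ℂ^N`. -/
def pairActVal {N : ℕ} (q : ℂˣ) (g : BW N) (z : (Fin N → ℂ) × (Fin N → ℂ)) :
    (Fin N → ℂ) × (Fin N → ℂ) :=
  if g.right = 1 then
    (fun i => ((q ^ (g.left.1.left.toAdd i) : ℂˣ) : ℂ) * z.1 (g.left.1.right⁻¹ i),
      fun i => ((q ^ ((diamond N g.left.2).left.toAdd i) : ℂˣ) : ℂ) *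
        z.2 ((diamond N g.left.2).right⁻¹ i))
  else
    (fun i => ((q ^ (g.left.1.left.toAdd i) : ℂˣ) : ℂ) * (z.2 (g.left.1.right⁻¹ i))⁻¹,
      fun i => ((q ^ ((diamond N g.left.2).left.toAdd i) : ℂˣ) : ℂ) *
        (z.1 ((diamond N g.left.2).right⁻¹ i))⁻¹)

theorem pairActVal_torusVal {N : ℕ} (q : ℂˣ) (g : BW N) (p : Torus N × Torus N) :
    pairActVal q g (torusVal p) = torusVal (pairAct q g p) := by
  unfold pairActVal pairAct
  split_ifs <;> simp [torusVal, torusAct]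

theorem analyticOnNhd_fst_coord {N : ℕ} (i : Fin N) (s : Set ((Fin N → ℂ) × (Fin N → ℂ))) :
    AnalyticOnNhd ℂ (fun z : (Fin N → ℂ) × (Fin N → ℂ) => z.1 i) s :=
  ((ContinuousLinearMap.proj (R := ℂ) (φ := fun _ : Fin N => ℂ) i).comp
    (ContinuousLinearMap.fst ℂ (Fin N → ℂ) (Fin N → ℂ))).analyticOnNhd s

theorem analyticOnNhd_snd_coord {N : ℕ} (i : Fin N) (s : Set ((Fin N → ℂ) × (Fin N → ℂ))) :
    AnalyticOnNhd ℂ (fun z : (Fin N → ℂ) × (Fin N → ℂ) => z.2 i) s :=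
  ((ContinuousLinearMap.proj (R := ℂ) (φ := fun _ : Fin N => ℂ) i).comp
    (ContinuousLinearMap.snd ℂ (Fin N → ℂ) (Fin N → ℂ))).analyticOnNhd s

theorem analyticOnNhd_pairActVal {N : ℕ} (q : ℂˣ) (g : BW N) :
    AnalyticOnNhd ℂ (pairActVal q g) (torusSet N) := by
  unfold pairActVal
  split_ifs
  · refine AnalyticOnNhd.prod ?_ ?_ <;> refine AnalyticOnNhd.pi fun i => ?_
    · exact analyticOnNhd_const.mul (analyticOnNhd_fst_coord _ _)
    · exact analyticOnNhd_const.mul (analyticOnNhd_snd_coord _ _)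
  · refine AnalyticOnNhd.prod ?_ ?_ <;> refine AnalyticOnNhd.pi fun i => ?_
    · exact analyticOnNhd_const.mul ((analyticOnNhd_snd_coord _ _).inv fun z hz => hz.2 _)
    · exact analyticOnNhd_const.mul ((analyticOnNhd_fst_coord _ _).inv fun z hz => hz.1 _)

theorem comp_pairAct_mem {N : ℕ} (q : ℂˣ) (g : BW N) {f : Torus N × Torus N → ℂ}
    (hf : f ∈ holSubalgebra N) : (fun p => f (pairAct q g p)) ∈ holSubalgebra N := by
  obtain ⟨F, hF, h⟩ := hf
  refine ⟨fun z => F (pairActVal q g z), hF.comp (analyticOnNhd_pairActVal q g) ?_, fun p => ?_⟩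
  · intro z hz
    obtain ⟨p, rfl⟩ := exists_torusVal hz
    rw [pairActVal_torusVal]
    exact torusVal_mem _
  · simp only [pairActVal_torusVal]
    exact h _

/-- The action `(g f)(t, γ) = f(g⁻¹(t, γ))` of `𝕎` on `𝓞(T × T)`. -/
instance (N : ℕ) (q : ℂˣ) : MulSemiringAction (BW N) (Hol N q) where
  smul g f := ⟨fun p => f.1 (pairAct q g⁻¹ p), comp_pairAct_mem q g⁻¹ f.2⟩
  one_smul f := Subtype.ext (funext fun p => congrArg f.1 (by rw [inv_one, pairAct_one]))
  mul_smul g g' f := Subtype.ext (funext fun p => congrArg f.1 (by rw [mul_inv_rev, pairAct_mul]))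
  smul_zero g := rfl
  smul_add g _ _ := rfl
  smul_one g := rfl
  smul_mul g _ _ := rfl

theorem Hol.smul_toFun {N : ℕ} {q : ℂˣ} (g : BW N) (f : Hol N q) (p : Torus N × Torus N) :
    (g • f).toFun p = f.toFun (pairAct q g⁻¹ p) := rfl

instance (N : ℕ) (q : ℂˣ) : SMulCommClass (BW N) ℂ (Hol N q) where
  smul_comm _ _ _ := rfl

/-- The field `𝕂 = 𝓜(T × T)` of meromorphic functions on `T × T`, as the quotient field of the
ring of analytic functions on the (connected Stein) manifold `T × T`. -/
def Mer (N : ℕ) (q : ℂˣ) : Type := FractionRing (Hol N q)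

instance (N : ℕ) (q : ℂˣ) : Field (Mer N q) :=
  inferInstanceAs (Field (FractionRing (Hol N q)))
instance (N : ℕ) (q : ℂˣ) : Algebra (Hol N q) (Mer N q) :=
  inferInstanceAs (Algebra (Hol N q) (FractionRing (Hol N q)))
instance (N : ℕ) (q : ℂˣ) : IsFractionRing (Hol N q) (Mer N q) :=
  inferInstanceAs (IsFractionRing (Hol N q) (FractionRing (Hol N q)))
instance (N : ℕ) (q : ℂˣ) : Algebra ℂ (Mer N q) :=
  inferInstanceAs (Algebra ℂ (FractionRing (Hol N q)))
instance (N : ℕ) (q : ℂˣ) : IsScalarTower ℂ (Hol N q) (Mer N q) :=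
  inferInstanceAs (IsScalarTower ℂ (Hol N q) (FractionRing (Hol N q)))

/-- The action `(g f)(t, γ) = f(g⁻¹(t, γ))` of `𝕎` on `𝕂` by field automorphisms. -/
instance (N : ℕ) (q : ℂˣ) : MulSemiringAction (BW N) (Mer N q) :=
  IsFractionRing.mulSemiringAction (BW N) (Hol N q) (Mer N q)

instance (N : ℕ) (q : ℂˣ) : SMulDistribClass (BW N) (Hol N q) (Mer N q) :=
  IsFractionRing.smulDistribClass (BW N) (Hol N q) (Mer N q)

theorem smul_algebraMap_mer {N : ℕ} {q : ℂˣ} (g : BW N) (f : Hol N q) :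
    g • algebraMap (Hol N q) (Mer N q) f = algebraMap (Hol N q) (Mer N q) (g • f) :=
  (algebraMap.coe_smul' g f (Mer N q)).symm

instance (N : ℕ) (q : ℂˣ) : SMulCommClass (BW N) ℂ (Mer N q) where
  smul_comm g c f := by
    rw [Algebra.smul_def, Algebra.smul_def, smul_mul',
      IsScalarTower.algebraMap_apply ℂ (Hol N q) (Mer N q), smul_algebraMap_mer,
      smul_algebraMap]

theorem evalFst_mem {N : ℕ} {q : ℂˣ} (f : Laurent N q) :
    (fun p : Torus N × Torus N => f.eval p.1) ∈ holSubalgebra N := by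
  induction f using Laurent.induction with
  | hx v =>
    refine ⟨fun z => ∏ i, z.1 i ^ (v.toAdd i), Finset.analyticOnNhd_fun_prod _ fun i _ => ?_,
      fun p => by simp [Laurent.eval_xpow, torusVal]⟩
    exact fun z hz => (analyticOnNhd_fst_coord i _ z hz).fun_zpow (hz.1 i)
  | hadd f g hf hg =>
    convert (holSubalgebra N).add_mem hf hg using 1
    funext p
    exact map_add _ f g
  | hsmul c f hf =>
    convert (holSubalgebra N).smul_mem hf c using 1
    funext p
    exact map_smul _ c f

theorem evalSnd_mem {N : ℕ} {q : ℂˣ} (f : Laurent N q) :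
    (fun p : Torus N × Torus N => f.eval p.2) ∈ holSubalgebra N := by
  induction f using Laurent.induction with
  | hx v =>
    refine ⟨fun z => ∏ i, z.2 i ^ (v.toAdd i), Finset.analyticOnNhd_fun_prod _ fun i _ => ?_,
      fun p => by simp [Laurent.eval_xpow, torusVal]⟩
    exact fun z hz => (analyticOnNhd_snd_coord i _ z hz).fun_zpow (hz.2 i)
  | hadd f g hf hg =>
    convert (holSubalgebra N).add_mem hf hg using 1
    funext p
    exact map_add _ f g
  | hsmul c f hf =>
    convert (holSubalgebra N).smul_mem hf c using 1
    funext p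
    exact map_smul _ c f

/-- `f(x) ∈ 𝕂`: the function `(t, γ) ↦ f(t)` for `f ∈ ℂ[T]`. -/
def inX {N : ℕ} {q : ℂˣ} (f : Laurent N q) : Mer N q :=
  algebraMap (Hol N q) (Mer N q) ⟨fun p => f.eval p.1, evalFst_mem f⟩

/-- `f(y) ∈ 𝕂`: the function `(t, γ) ↦ f(γ)` for `f ∈ ℂ[T]`. -/
def inY {N : ℕ} {q : ℂˣ} (f : Laurent N q) : Mer N q :=
  algebraMap (Hol N q) (Mer N q) ⟨fun p => f.eval p.2, evalSnd_mem f⟩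

/-- `f^◇(t) = f(t⁻¹)` for `f ∈ ℂ[T]`. -/
def diamondFun {N : ℕ} {q : ℂˣ} : Laurent N q →ₐ[ℂ] Laurent N q :=
  Laurent.lift (xpow.comp (MulEquiv.inv (Multiplicative (Fin N → ℤ))).toMonoidHom)

theorem diamondFun_eval {N : ℕ} {q : ℂˣ} (f : Laurent N q) (t : Torus N) :
    (diamondFun f).eval t = f.eval t⁻¹ := by
  change ((Laurent.eval t).comp diamondFun) f = _
  congr 1
  refine Laurent.algHom_ext fun v => ?_
  rw [AlgHom.comp_apply, diamondFun, Laurent.lift_xpow, MonoidHom.comp_apply, Laurent.eval_xpow,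
    Laurent.eval_xpow]
  simp

/-! ### Simple reflections and reduced expressions

From now on `N = n + 2`. The labels `1, …, N - 1` are represented by `i : Fin (n + 1)` (standing for
the label `i + 1`, related to the coordinates `i.castSucc` and `i.succ`), and the labels
`0, …, N - 1` in `ℤ_N` by `Fin (n + 2)`. -/

/-- The simple transposition of the coordinates `i` and `i + 1`. -/
def simpleRefl {n : ℕ} (i : Fin (n + 1)) : W (n + 2) := perm (Equiv.swap i.castSucc i.succ)

/-- The element `π = σ ε_N` of `W`, with `σ` the rotation `i ↦ i + 1` (and `N ↦ 1`). -/
def piElt (n : ℕ) : W (n + 2) :=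
  perm (finRotate (n + 2)) * transl (Pi.single (Fin.last (n + 1)) 1)

/-- The simple reflections `s_j`, `j ∈ ℤ_N`, where `s_0 = π s_{N-1} π⁻¹`. -/
def affRefl {n : ℕ} (j : Fin (n + 2)) : W (n + 2) :=
  Fin.cases (piElt n * simpleRefl (Fin.last n) * (piElt n)⁻¹) simpleRefl j

/-- The element `s_{j_1} ⋯ s_{j_r} π^m` of `W`. -/
def wordProd {n : ℕ} (p : List (Fin (n + 2)) × ℤ) : W (n + 2) :=
  (p.1.map affRefl).prod * piElt n ^ p.2

/-- `w = s_{j_1} ⋯ s_{j_r} π^m` is a reduced expression. -/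
def IsReduced {n : ℕ} (w : W (n + 2)) (p : List (Fin (n + 2)) × ℤ) : Prop :=
  wordProd p = w ∧ ∀ p', wordProd p' = w → p.1.length ≤ p'.1.length

theorem perm_mul {N : ℕ} (σ ρ : Equiv.Perm (Fin N)) : perm (σ * ρ) = perm σ * perm ρ :=
  map_mul _ _ _

theorem perm_inv {N : ℕ} (σ : Equiv.Perm (Fin N)) : perm σ⁻¹ = (perm σ)⁻¹ := map_inv _ _

theorem transl_add {N : ℕ} (u v : Fin N → ℤ) : transl (u + v) = transl u * transl v :=
  map_mul _ _ _

theorem transl_neg {N : ℕ} (v : Fin N → ℤ) : transl (-v) = (transl v)⁻¹ := map_inv _ _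

theorem perm_conj_transl {N : ℕ} (σ : Equiv.Perm (Fin N)) (v : Fin N → ℤ) :
    perm σ * transl v * (perm σ)⁻¹ = transl (fun i => v (σ⁻¹ i)) :=
  (SemidirectProduct.inl_aut σ (Multiplicative.ofAdd v)).symm

theorem torusAct_perm {N : ℕ} (q : ℂˣ) (σ : Equiv.Perm (Fin N)) (t : Torus N) (i : Fin N) :
    torusAct q (perm σ) t i = t (σ⁻¹ i) := by
  simp [torusAct, perm]

theorem torusAct_transl {N : ℕ} (q : ℂˣ) (v : Fin N → ℤ) (t : Torus N) (i : Fin N) :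
    torusAct q (transl v) t i = q ^ v i * t i := by
  simp [torusAct, transl]

theorem torusAct_piElt_zero {n : ℕ} (q : ℂˣ) (t : Torus (n + 2)) :
    torusAct q (piElt n) t 0 = q * t (Fin.last (n + 1)) := by
  have h : (finRotate (n + 2))⁻¹ 0 = Fin.last (n + 1) := by
    rw [Equiv.Perm.inv_eq_iff_eq, finRotate_last]
  rw [piElt, torusAct_mul, torusAct_perm, torusAct_transl, h]
  simp

theorem torusAct_piElt_succ {n : ℕ} (q : ℂˣ) (t : Torus (n + 2)) (i : Fin (n + 1)) :
    torusAct q (piElt n) t i.succ = t i.castSucc := by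
  have h : (finRotate (n + 2))⁻¹ i.succ = i.castSucc := by
    rw [Equiv.Perm.inv_eq_iff_eq, finRotate_apply, Fin.coeSucc_eq_succ]
  rw [piElt, torusAct_mul, torusAct_perm, torusAct_transl, h]
  simp [Fin.castSucc_ne_last]

/-- The affine reflection `λ (a b)` with `λ = m (ε_a - ε_b)`. -/
def reflElt {N : ℕ} (a b : Fin N) (m : ℤ) : W N :=
  transl (fun i => m * ((if i = a then 1 else 0) - if i = b then 1 else 0)) * perm (Equiv.swap a b)

theorem reflElt_zero {N : ℕ} (a b : Fin N) : reflElt a b 0 = perm (Equiv.swap a b) := by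
  have : (fun i : Fin N => (0 : ℤ) * ((if i = a then 1 else 0) - if i = b then 1 else 0)) = 0 := by
    funext i; simp
  rw [reflElt, this]
  exact one_mul _

theorem pi_conj_reflElt {n : ℕ} {a b : Fin (n + 2)} (hab : a ≠ b) (m : ℤ) :
    piElt n * reflElt a b m * (piElt n)⁻¹ = reflElt (a + 1) (b + 1)
      (m + (if a = Fin.last (n + 1) then 1 else 0) - if b = Fin.last (n + 1) then 1 else 0) := by
  have h1 : perm (Equiv.swap a b) * (transl (Pi.single (Fin.last (n + 1)) 1))⁻¹ =
      transl (-fun i => (Pi.single (Fin.last (n + 1)) 1 : Fin (n + 2) → ℤ) (Equiv.swap a b i)) *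
        perm (Equiv.swap a b) := by
    rw [← mul_inv_eq_iff_eq_mul, ← transl_neg, perm_conj_transl]
    congr 1
  have h2 : perm (finRotate (n + 2)) * perm (Equiv.swap a b) =
      perm (Equiv.swap (a + 1) (b + 1)) * perm (finRotate (n + 2)) := by
    rw [← perm_mul, ← perm_mul]
    congr 1
    rw [← mul_inv_eq_iff_eq_mul, ← finRotate_apply a, ← finRotate_apply b,
      ← Equiv.swap_apply_apply]
  rw [piElt, reflElt, mul_inv_rev]
  calc _ = perm (finRotate (n + 2)) * (transl (Pi.single (Fin.last (n + 1)) 1) *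
        transl (fun i => m * ((if i = a then 1 else 0) - if i = b then 1 else 0)) *
        (perm (Equiv.swap a b) * (transl (Pi.single (Fin.last (n + 1)) 1))⁻¹)) *
        (perm (finRotate (n + 2)))⁻¹ := by simp only [mul_assoc]
    _ = (perm (finRotate (n + 2)) * (transl (Pi.single (Fin.last (n + 1)) 1) *
        transl (fun i => m * ((if i = a then 1 else 0) - if i = b then 1 else 0)) *
        transl (-fun i => (Pi.single (Fin.last (n + 1)) 1 : Fin (n + 2) → ℤ)
          (Equiv.swap a b i))) * (perm (finRotate (n + 2)))⁻¹) *
        (perm (finRotate (n + 2)) * perm (Equiv.swap a b) * (perm (finRotate (n + 2)))⁻¹) := by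
          rw [h1]; group
    _ = _ := by
      rw [h2, mul_inv_cancel_right, ← transl_add, ← transl_add, perm_conj_transl, reflElt]
      congr 2
      funext i
      obtain ⟨j, rfl⟩ := (finRotate (n + 2)).surjective i
      simp only [Pi.add_apply, Pi.neg_apply, finRotate_apply,
        add_left_inj, Pi.single_apply]
      by_cases hja : j = a
      · subst hja
        simp [hab]
        ring
      · by_cases hjb : j = b
        · subst hjb
          simp [hab.symm]
          ring
        · simp [hja, hjb, Equiv.swap_apply_of_ne_of_ne]

theorem affRefl_zero {n : ℕ} :
    affRefl (0 : Fin (n + 2)) = reflElt (Fin.last (n + 1)) 0 (-1) := by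
  change piElt n * simpleRefl (Fin.last n) * (piElt n)⁻¹ = _
  rw [simpleRefl, ← reflElt_zero, pi_conj_reflElt (Fin.castSucc_lt_succ).ne, Fin.coeSucc_eq_succ,
    Fin.succ_last, Fin.last_add_one]
  simp [Fin.castSucc_ne_last]

theorem affRefl_succ {n : ℕ} (i : Fin (n + 1)) :
    affRefl i.succ = reflElt i.castSucc i.succ 0 := (reflElt_zero _ _).symm

/-- `π s_j π⁻¹ = s_{j+1}` for `j ∈ ℤ_N`. -/
theorem pi_conj_affRefl {n : ℕ} (j : Fin (n + 2)) :
    piElt n * affRefl j * (piElt n)⁻¹ = affRefl (j + 1) := by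
  refine Fin.cases ?_ (fun i => ?_) j
  · rw [affRefl_zero, pi_conj_reflElt (Fin.last_pos).ne', Fin.last_add_one, zero_add]
    have : (1 : Fin (n + 2)) = (0 : Fin (n + 1)).succ := rfl
    rw [this, affRefl_succ]
    simp [(Fin.last_pos (n := n)).ne]
  · refine Fin.lastCases ?_ (fun i => ?_) i
    · rw [Fin.succ_last, Fin.last_add_one]
      rfl
    · rw [affRefl_succ, pi_conj_reflElt (Fin.castSucc_lt_succ).ne, Fin.coeSucc_eq_succ,
        ← Fin.castSucc_succ, Fin.coeSucc_eq_succ, affRefl_succ]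
      simp [Fin.castSucc_ne_last]

theorem exists_word_affRefl_mul {n : ℕ} (j : Fin (n + 2)) {w : W (n + 2)}
    (h : ∃ p, wordProd p = w) : ∃ p, wordProd p = affRefl j * w := by
  obtain ⟨⟨l, m⟩, rfl⟩ := h
  exact ⟨(j :: l, m), by simp [wordProd, mul_assoc]⟩

theorem exists_word_pi_mul {n : ℕ} {w : W (n + 2)}
    (h : ∃ p, wordProd p = w) : ∃ p, wordProd p = piElt n * w := by
  obtain ⟨⟨l, m⟩, rfl⟩ := h
  refine ⟨(l.map (· + 1), m + 1), ?_⟩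
  simp only [wordProd]
  rw [add_comm m 1, zpow_add, zpow_one, ← mul_assoc, ← mul_assoc]
  congr 1
  induction l with
  | nil => simp
  | cons j l ih =>
    simp only [List.map_cons, List.prod_cons, mul_assoc]
    rw [ih, ← pi_conj_affRefl]
    group

theorem exists_word_pi_inv_mul {n : ℕ} {w : W (n + 2)}
    (h : ∃ p, wordProd p = w) : ∃ p, wordProd p = (piElt n)⁻¹ * w := by
  obtain ⟨⟨l, m⟩, rfl⟩ := h
  refine ⟨(l.map (· - 1), m - 1), ?_⟩
  simp only [wordProd]
  rw [sub_eq_neg_add, zpow_add, zpow_neg_one, ← mul_assoc, ← mul_assoc]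
  congr 1
  induction l with
  | nil => simp
  | cons j l ih =>
    simp only [List.map_cons, List.prod_cons, mul_assoc]
    have := pi_conj_affRefl (j - 1)
    rw [sub_add_cancel] at this
    rw [ih, ← this]
    group

theorem exists_word_perm_mul {n : ℕ} (σ : Equiv.Perm (Fin (n + 2))) {w : W (n + 2)}
    (h : ∃ p, wordProd p = w) : ∃ p, wordProd p = perm σ * w := by
  have hσ : σ ∈ Submonoid.closure
      (Set.range fun i : Fin (n + 1) => Equiv.swap i.castSucc i.succ) := by
    rw [Equiv.Perm.mclosure_swap_castSucc_succ]; trivial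
  induction hσ using Submonoid.closure_induction generalizing w with
  | mem σ hσ =>
    obtain ⟨i, rfl⟩ := hσ
    exact exists_word_affRefl_mul i.succ h
  | one => exact (one_mul w).symm ▸ h
  | mul σ ρ _ _ hσ hρ =>
    rw [perm_mul, mul_assoc]
    exact hσ (hρ h)

theorem exists_word_transl_mul {n : ℕ} (v : Fin (n + 2) → ℤ) {w : W (n + 2)}
    (h : ∃ p, wordProd p = w) : ∃ p, wordProd p = transl v * w := by
  have hlast : ∀ w : W (n + 2), (∃ p, wordProd p = w) →
      ∃ p, wordProd p = transl (Pi.single (Fin.last (n + 1)) 1) * w := fun w h => by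
    have : transl (Pi.single (Fin.last (n + 1)) 1) = perm (finRotate (n + 2))⁻¹ * piElt n := by
      rw [piElt, perm_inv, inv_mul_cancel_left]
    rw [this, mul_assoc]
    exact exists_word_perm_mul _ (exists_word_pi_mul h)
  have hlast' : ∀ w : W (n + 2), (∃ p, wordProd p = w) →
      ∃ p, wordProd p = (transl (Pi.single (Fin.last (n + 1)) 1))⁻¹ * w := fun w h => by
    have : (transl (Pi.single (Fin.last (n + 1)) 1))⁻¹ =
        (piElt n)⁻¹ * perm (finRotate (n + 2)) := by
      rw [piElt, mul_inv_rev, inv_mul_cancel_right]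
    rw [this, mul_assoc]
    exact exists_word_pi_inv_mul (exists_word_perm_mul _ h)
  have hconj : ∀ i : Fin (n + 2), transl (Pi.single i 1) =
      perm (Equiv.swap i (Fin.last (n + 1))) * transl (Pi.single (Fin.last (n + 1)) 1) *
        (perm (Equiv.swap i (Fin.last (n + 1))))⁻¹ := fun i => by
    rw [perm_conj_transl]
    congr 1
    funext a
    simp [Pi.single_apply, Equiv.swap_apply_eq_iff]
  have hv : v ∈ AddSubgroup.closure (Set.range fun i : Fin (n + 2) => Pi.single (M := fun _ => ℤ) i 1) := by
    have : v = ∑ i, v i • (Pi.single i 1 : Fin (n + 2) → ℤ) := by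
      funext a
      simp [Finset.sum_apply, Pi.single_apply]
    rw [this]
    exact sum_mem fun i _ => zsmul_mem (AddSubgroup.subset_closure (Set.mem_range_self i)) _
  have key : ∀ w : W (n + 2), ((∃ p, wordProd p = w) → ∃ p, wordProd p = transl v * w) ∧
      ((∃ p, wordProd p = w) → ∃ p, wordProd p = (transl v)⁻¹ * w) := by
    induction hv using AddSubgroup.closure_induction with
    | mem v hv =>
      obtain ⟨i, rfl⟩ := hv
      intro w
      dsimp only
      rw [hconj, mul_inv_rev, mul_inv_rev, inv_inv, mul_assoc, mul_assoc, mul_assoc, mul_assoc,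
        ← perm_inv]
      exact ⟨fun h => exists_word_perm_mul _ (hlast _ (exists_word_perm_mul _ h)),
        fun h => exists_word_perm_mul _ (hlast' _ (exists_word_perm_mul _ h))⟩
    | zero =>
      intro w
      have : transl (0 : Fin (n + 2) → ℤ) = 1 := rfl
      rw [this, inv_one, one_mul]
      exact ⟨id, id⟩
    | add u v _ _ hu hv =>
      intro w
      rw [transl_add, mul_inv_rev, mul_assoc, mul_assoc]
      exact ⟨fun h => (hu _).1 ((hv w).1 h), fun h => (hv _).2 ((hu w).2 h)⟩
    | neg v _ hv =>
      intro w
      rw [transl_neg, inv_inv]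
      exact ⟨(hv w).2, (hv w).1⟩
  exact (key w).1 h

theorem exists_word {n : ℕ} (w : W (n + 2)) : ∃ p, wordProd (n := n) p = w := by
  have h : w = transl w.left.toAdd * (perm w.right * 1) := by
    rw [mul_one]
    exact (SemidirectProduct.inl_left_mul_inr_right w).symm
  rw [h]
  exact exists_word_transl_mul _ (exists_word_perm_mul _ ⟨([], 0), by simp [wordProd]⟩)

theorem exists_reduced {n : ℕ} (w : W (n + 2)) : ∃ p, IsReduced w p := by
  obtain ⟨p, hp, hmin⟩ := (measure fun p : List (Fin (n + 2)) × ℤ => p.1.length).wf.has_min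
    {p | wordProd p = w} (exists_word w)
  exact ⟨p, hp, fun p' hp' => not_lt.mp (hmin p' hp')⟩

/-- A chosen reduced expression of `w`. -/
def redWord {n : ℕ} (w : W (n + 2)) : List (Fin (n + 2)) × ℤ := (exists_reduced w).choose

/-! ### The double affine Hecke algebra -/

/-- The monomial `x_i / x_j`. -/
def xratio {N : ℕ} {q : ℂˣ} (i j : Fin N) : Laurent N q :=
  xpow (Multiplicative.ofAdd (Pi.single i 1 - Pi.single j 1))

/-- The inclusion `ℂ[T] ⊆ ℂ(T)`. -/
def toRat {N : ℕ} {q : ℂˣ} (f : Laurent N q) : RatFun N q := algebraMap _ _ f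

/-- Multiplication by the rational function `f`, as the element `f(X)` of `ℂ(T) # W`. -/
def ratX {N : ℕ} {q : ℂˣ} : RatFun N q →+* Smash N q := SkewMonoidAlgebra.singleOneRingHom

/-- The group element `w` in `ℂ(T) # W`. -/
def grp {N : ℕ} {q : ℂˣ} : W N →* Smash N q := SkewMonoidAlgebra.of (RatFun N q) (W N)

theorem grp_mul_ratX {N : ℕ} {q : ℂˣ} (w : W N) (f : RatFun N q) :
    grp w * ratX f = ratX (w • f) * grp w := by
  change SkewMonoidAlgebra.single w (1 : RatFun N q) * SkewMonoidAlgebra.single 1 f =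
    SkewMonoidAlgebra.single 1 (w • f) * SkewMonoidAlgebra.single w 1
  simp [SkewMonoidAlgebra.single_mul_single]

theorem algebraMap_smash {N : ℕ} {q : ℂˣ} (c : ℂ) :
    algebraMap ℂ (Smash N q) c = ratX (algebraMap ℂ (RatFun N q) c) := rfl

/-- The function `c_k(z) = (k⁻¹ - k z) / (1 - z)`. -/
def ck {F : Type*} [Field F] [Algebra ℂ F] (k : ℂˣ) (z : F) : F :=
  (algebraMap ℂ F ((k⁻¹ : ℂˣ) : ℂ) - algebraMap ℂ F k * z) / (1 - z)

/-- The generator `T_i = k + c_k(X_i / X_{i+1}) (s_i - 1)` in `ℂ(T) # W`. -/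
def heckeT {n : ℕ} (k q : ℂˣ) (i : Fin (n + 1)) : Smash (n + 2) q :=
  algebraMap ℂ _ (k : ℂ) +
    ratX (ck k (toRat (xratio i.castSucc i.succ))) * (grp (simpleRefl i) - 1)

theorem perm_smul_xratio {N : ℕ} {q : ℂˣ} (σ : Equiv.Perm (Fin N)) (i j : Fin N) :
    perm σ • (xratio i j : Laurent N q) = xratio (σ i) (σ j) := by
  change laurentAct q _ _ = _
  have h : permLattice N (perm σ).right (Multiplicative.ofAdd (Pi.single i 1 - Pi.single j 1)) =
      Multiplicative.ofAdd (Pi.single (σ i) 1 - Pi.single (σ j) 1) := by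
    change Multiplicative.ofAdd (fun a => (Pi.single i 1 - Pi.single j 1 : Fin N → ℤ) (σ⁻¹ a)) = _
    congr 1
    funext a
    simp only [Pi.sub_apply, Pi.single_apply, Equiv.Perm.inv_eq_iff_eq]
  have h2 : (perm σ).left.toAdd = 0 := rfl
  rw [xratio, laurentAct_xpow, xratio, h, h2]
  simp

theorem transl_smul_xratio {N : ℕ} {q : ℂˣ} (v : Fin N → ℤ) (i j : Fin N) :
    transl v • (xratio i j : Laurent N q) = ((q ^ (v j - v i) : ℂˣ) : ℂ) • xratio i j := by
  change laurentAct q _ _ = _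
  have h : permLattice N (transl v).right (Multiplicative.ofAdd (Pi.single i 1 - Pi.single j 1)) =
      Multiplicative.ofAdd (Pi.single i 1 - Pi.single j 1) := rfl
  have h2 : (transl v).left.toAdd = v := rfl
  rw [xratio, laurentAct_xpow, h, h2]
  congr 3
  simp [mul_sub, Pi.single_apply]

theorem smul_xratio {n : ℕ} {q : ℂˣ} (i : Fin (n + 1)) :
    simpleRefl i • (xratio i.castSucc i.succ : Laurent (n + 2) q) = xratio i.succ i.castSucc := by
  rw [simpleRefl, perm_smul_xratio, Equiv.swap_apply_left, Equiv.swap_apply_right]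

theorem toRat_xratio_inv {N : ℕ} {q : ℂˣ} (i j : Fin N) :
    (toRat (xratio j i) : RatFun N q) = (toRat (xratio i j))⁻¹ := by
  refine eq_inv_of_mul_eq_one_left ?_
  rw [toRat, toRat, ← map_mul, xratio, xratio, ← map_mul, ← ofAdd_add]
  simp

theorem toRat_xratio_ne_one {N : ℕ} {q : ℂˣ} {i j : Fin N} (hij : i ≠ j) :
    (toRat (xratio i j) : RatFun N q) ≠ 1 := by
  intro h
  rw [toRat, ← map_one (algebraMap (Laurent N q) (RatFun N q))] at h
  have h1 := IsFractionRing.injective (Laurent N q) (RatFun N q) h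
  have h2 := congrArg (Laurent.eval (Function.update 1 i (Units.mk0 (2 : ℂ) two_ne_zero))) h1
  rw [xratio, Laurent.eval_xpow, map_one, Finset.prod_eq_single i] at h2
  · simp [hij] at h2
  · intro b _ hb
    simp [Function.update_of_ne hb]
  · simp

theorem simpleRefl_sq {n : ℕ} (i : Fin (n + 1)) : simpleRefl i * simpleRefl i = 1 := by
  rw [simpleRefl, ← perm_mul, Equiv.swap_mul_self]
  exact map_one _

theorem ck_add_ck_inv {F : Type*} [Field F] [Algebra ℂ F] (k : ℂˣ) {z : F} (h0 : z ≠ 0)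
    (h1 : z ≠ 1) :
    ck k z + ck k z⁻¹ = algebraMap ℂ F k + algebraMap ℂ F ((k⁻¹ : ℂˣ) : ℂ) := by
  have h2 : 1 - z ≠ 0 := sub_ne_zero.mpr h1.symm
  have h3 : z - 1 ≠ 0 := sub_ne_zero.mpr h1
  unfold ck
  have : (1 : F) - z⁻¹ = (z - 1) / z := by field_simp
  rw [this]
  field_simp
  ring

theorem smul_ck {n : ℕ} {k q : ℂˣ} (i : Fin (n + 1)) :
    simpleRefl i • ck k (toRat (xratio i.castSucc i.succ) : RatFun (n + 2) q) =
      ck k (toRat (xratio i.castSucc i.succ) : RatFun (n + 2) q)⁻¹ := by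
  have h : simpleRefl i • (toRat (xratio i.castSucc i.succ) : RatFun (n + 2) q) =
      (toRat (xratio i.castSucc i.succ) : RatFun (n + 2) q)⁻¹ := by
    rw [toRat, smul_algebraMap_ratFun, smul_xratio]
    exact toRat_xratio_inv _ _
  unfold ck
  rw [smul_div₀', smul_sub, smul_sub, smul_mul', smul_algebraMap, smul_algebraMap, smul_one, h]

theorem toRat_xratio_ne_zero {N : ℕ} {q : ℂˣ} (i j : Fin N) :
    (toRat (xratio i j) : RatFun N q) ≠ 0 := by
  intro h
  have h1 := toRat_xratio_inv (q := q) j i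
  have : (toRat (xratio i j) * toRat (xratio j i) : RatFun N q) = 1 := by
    rw [toRat, toRat, ← map_mul, xratio, xratio, ← map_mul, ← ofAdd_add]
    simp
  rw [h, zero_mul] at this
  exact zero_ne_one this

/-- The quadratic relation `(T_i - k)(T_i + k⁻¹) = 0`. -/
theorem heckeT_quadratic {n : ℕ} (k q : ℂˣ) (i : Fin (n + 1)) :
    (heckeT k q i - algebraMap ℂ _ (k : ℂ)) * (heckeT k q i + algebraMap ℂ _ ((k⁻¹ : ℂˣ) : ℂ)) =
      0 := by
  set z : RatFun (n + 2) q := toRat (xratio i.castSucc i.succ) with hz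
  set A : Smash (n + 2) q := ratX (ck k z) with hA
  set A' : Smash (n + 2) q := ratX (ck k z⁻¹) with hA'
  set S : Smash (n + 2) q := grp (simpleRefl i) with hS
  have hSA : S * A = A' * S := by
    rw [hS, hA, grp_mul_ratX, smul_ck]
  have hSS : S * S = 1 := by
    rw [hS, ← map_mul, simpleRefl_sq, map_one]
  have hc : A + A' = algebraMap ℂ _ (k : ℂ) + algebraMap ℂ _ ((k⁻¹ : ℂˣ) : ℂ) := by
    rw [hA, hA', ← map_add, ck_add_ck_inv k (toRat_xratio_ne_zero _ _)
      (toRat_xratio_ne_one (Fin.castSucc_lt_succ).ne), map_add]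
    rfl
  have hT : heckeT k q i = algebraMap ℂ _ (k : ℂ) + A * (S - 1) := rfl
  rw [hT, add_sub_cancel_left]
  have hcomm : (S - 1) * (A + A') = (A + A') * (S - 1) := by
    rw [hc, ← map_add]
    exact (Algebra.commutes _ _).symm
  have e : algebraMap ℂ (Smash (n + 2) q) (k : ℂ) + A * (S - 1) +
      algebraMap ℂ _ ((k⁻¹ : ℂˣ) : ℂ) = (A + A') + A * (S - 1) := by rw [hc]; abel
  have e2 : (S - 1) * (A * (S - 1)) = (A + A') * (1 - S) := by
    calc (S - 1) * (A * (S - 1)) = (S * A) * S - S * A - A * S + A := by noncomm_ring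
      _ = A' * (S * S) - A' * S - A * S + A := by rw [hSA]; noncomm_ring
      _ = (A + A') * (1 - S) := by rw [hSS]; noncomm_ring
  rw [e, mul_assoc, mul_add (S - 1), hcomm, e2]
  noncomm_ring

/-- The double affine Hecke algebra `ℍ`: the subalgebra of `ℂ(T) # W` generated by the image of the
extended affine Hecke algebra, i.e. by `T_1, …, T_{N-1}` and `π^{±1}`, and by the multiplication
operators `f(X)`, `f ∈ ℂ[T]`. -/
def DAHA (n : ℕ) (k q : ℂˣ) : Subalgebra ℂ (Smash (n + 2) q) :=
  Algebra.adjoin ℂ (Set.range (heckeT k q) ∪ {grp (piElt n), grp (piElt n)⁻¹} ∪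
    Set.range fun f : Laurent (n + 2) q => ratX (toRat f))

/-- The finite Hecke algebra `H_0`, the subalgebra generated by `T_1, …, T_{N-1}`. -/
def H0 (n : ℕ) (k q : ℂˣ) : Subalgebra ℂ (Smash (n + 2) q) :=
  Algebra.adjoin ℂ (Set.range (heckeT k q))

theorem H0_le_DAHA (n : ℕ) (k q : ℂˣ) : H0 n k q ≤ DAHA n k q :=
  Algebra.adjoin_mono fun _ h => Or.inl (Or.inl h)

/-- The inclusion `H_0 ⊆ ℍ`. -/
def inclH0 {n : ℕ} {k q : ℂˣ} : H0 n k q →ₐ[ℂ] DAHA n k q :=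
  Subalgebra.inclusion (H0_le_DAHA n k q)

/-- `f(X) ∈ ℍ` for `f ∈ ℂ[T]`. -/
def opX {n : ℕ} {k q : ℂˣ} (f : Laurent (n + 2) q) : DAHA n k q :=
  ⟨ratX (toRat f), Algebra.subset_adjoin (Or.inr ⟨f, rfl⟩)⟩

/-- `T_i` as an element of `ℍ`. -/
def genT {n : ℕ} {k q : ℂˣ} (i : Fin (n + 1)) : DAHA n k q :=
  ⟨heckeT k q i, Algebra.subset_adjoin (Or.inl (Or.inl ⟨i, rfl⟩))⟩

theorem genT_quadratic {n : ℕ} {k q : ℂˣ} (i : Fin (n + 1)) :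
    (genT i - algebraMap ℂ (DAHA n k q) (k : ℂ)) *
      (genT i + algebraMap ℂ (DAHA n k q) ((k⁻¹ : ℂˣ) : ℂ)) = 0 :=
  Subtype.ext (heckeT_quadratic k q i)

/-- `T_i` as an invertible element of `ℍ`, with inverse `T_i - k + k⁻¹`. -/
def unitT {n : ℕ} {k q : ℂˣ} (i : Fin (n + 1)) : (DAHA n k q)ˣ where
  val := genT i
  inv := genT i - algebraMap ℂ _ (k : ℂ) + algebraMap ℂ _ ((k⁻¹ : ℂˣ) : ℂ)
  val_inv := by
    have h := genT_quadratic (k := k) (q := q) i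
    have hk : algebraMap ℂ (DAHA n k q) (k : ℂ) * algebraMap ℂ _ ((k⁻¹ : ℂˣ) : ℂ) = 1 := by
      rw [← map_mul, Units.mul_inv, map_one]
    have hc := Algebra.commutes (k : ℂ) (genT i : DAHA n k q)
    rw [sub_mul, mul_add, mul_add, hk, hc] at h
    rw [mul_add, mul_sub, ← sub_eq_zero, ← h]
    abel
  inv_val := by
    have h := genT_quadratic (k := k) (q := q) i
    have hk : algebraMap ℂ (DAHA n k q) (k : ℂ) * algebraMap ℂ _ ((k⁻¹ : ℂˣ) : ℂ) = 1 := by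
      rw [← map_mul, Units.mul_inv, map_one]
    have hc := Algebra.commutes (((k⁻¹ : ℂˣ) : ℂ)) (genT i : DAHA n k q)
    rw [sub_mul, mul_add, mul_add, hk, ← hc] at h
    rw [add_mul, sub_mul, ← sub_eq_zero, ← h]
    abel

/-- `π` as an invertible element of `ℍ`. -/
def unitPi {n : ℕ} {k q : ℂˣ} : (DAHA n k q)ˣ where
  val := ⟨grp (piElt n), Algebra.subset_adjoin (Or.inl (Or.inr (Or.inl rfl)))⟩
  inv := ⟨grp (piElt n)⁻¹, Algebra.subset_adjoin (Or.inl (Or.inr (Or.inr rfl)))⟩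
  val_inv := Subtype.ext (by
    change grp (piElt n) * grp (piElt n)⁻¹ = 1
    rw [← map_mul, mul_inv_cancel, map_one])
  inv_val := Subtype.ext (by
    change grp (piElt n)⁻¹ * grp (piElt n) = 1
    rw [← map_mul, inv_mul_cancel, map_one])

/-- `Y_j = T_{j-1}⁻¹ ⋯ T_1⁻¹ π T_{N-1} ⋯ T_j`. -/
def unitY {n : ℕ} {k q : ℂˣ} (j : Fin (n + 2)) : (DAHA n k q)ˣ :=
  (((List.finRange (n + 1)).filter fun i => i.val < j.val).reverse.map fun i => (unitT i)⁻¹).prod *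
    unitPi *
    (((List.finRange (n + 1)).filter fun i => j.val ≤ i.val).reverse.map fun i => unitT i).prod

/-- `Y^v = Y_1^{v_1} ⋯ Y_N^{v_N}` for `v ∈ ℤ^N`. -/
def Ypow {n : ℕ} {k q : ℂˣ} (v : Fin (n + 2) → ℤ) : DAHA n k q :=
  (((List.finRange (n + 2)).map fun j => unitY j ^ v j).prod : (DAHA n k q)ˣ)

/-- `X^v` for `v ∈ ℤ^N`. -/
def Xpow {n : ℕ} {k q : ℂˣ} (v : Fin (n + 2) → ℤ) : DAHA n k q :=
  opX (xpow (Multiplicative.ofAdd v))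

/-- `f(Y) = ∑ c_v Y^v ∈ ℍ` for `f = ∑ c_v x^v ∈ ℂ[T]`. -/
def opY {n : ℕ} {k q : ℂˣ} (f : Laurent (n + 2) q) : DAHA n k q :=
  (AddMonoidAlgebra.coeff f).sum fun v c => c • Ypow v

/-! ### Intertwiners -/

/-- `d_i = k - k⁻¹ x_{i+1} / x_i` for `1 ≤ i < N` and `d_0 = k - k⁻¹ q⁻¹ x_1 / x_N`. -/
def dGen {n : ℕ} (k q : ℂˣ) (j : Fin (n + 2)) : Laurent (n + 2) q :=
  Fin.cases
    (algebraMap ℂ _ (k : ℂ) - ((k⁻¹ * q⁻¹ : ℂˣ) : ℂ) • xratio 0 (Fin.last (n + 1)))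
    (fun i => algebraMap ℂ _ (k : ℂ) - ((k⁻¹ : ℂˣ) : ℂ) • xratio i.succ i.castSucc) j

/-- `S̃_j = d_j(X) s_j` for `j ∈ ℤ_N`. -/
def intGen {n : ℕ} (k q : ℂˣ) (j : Fin (n + 2)) : Smash (n + 2) q :=
  ratX (toRat (dGen k q j)) * grp (affRefl j)

theorem intGen_succ {n : ℕ} (k q : ℂˣ) (i : Fin (n + 1)) :
    intGen k q i.succ = ratX (toRat (1 - xratio i.succ i.castSucc)) *
      (heckeT k q i - algebraMap ℂ _ (k : ℂ)) + ratX (toRat (dGen k q i.succ)) := by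
  have h1 : toRat (dGen k q i.succ) =
      toRat (1 - xratio i.succ i.castSucc) * ck k (toRat (xratio i.castSucc i.succ)) := by
    have hz0 := toRat_xratio_ne_zero (q := q) i.castSucc i.succ
    have hz1 := toRat_xratio_ne_one (q := q) (i := i.castSucc) (j := i.succ)
      (Fin.castSucc_lt_succ).ne
    have hz2 : (1 : RatFun (n + 2) q) - toRat (xratio i.castSucc i.succ) ≠ 0 :=
      sub_ne_zero.mpr hz1.symm
    have hd : toRat (dGen k q i.succ) = algebraMap ℂ _ (k : ℂ) - algebraMap ℂ _ ((k⁻¹ : ℂˣ) : ℂ) *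
        (toRat (xratio i.succ i.castSucc) : RatFun (n + 2) q) := by
      change algebraMap _ _ (algebraMap ℂ (Laurent (n + 2) q) (k : ℂ) -
        ((k⁻¹ : ℂˣ) : ℂ) • xratio i.succ i.castSucc) = _
      rw [Algebra.smul_def, map_sub, map_mul, ← IsScalarTower.algebraMap_apply,
        ← IsScalarTower.algebraMap_apply]
      rfl
    have h2 : (toRat (1 - xratio i.succ i.castSucc) : RatFun (n + 2) q) =
        1 - toRat (xratio i.succ i.castSucc) := by
      rw [toRat, map_sub, map_one]; rfl
    rw [hd, h2, toRat_xratio_inv i.castSucc i.succ, ck]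
    field_simp
    ring
  have h2 : heckeT k q i - algebraMap ℂ _ (k : ℂ) =
      ratX (ck k (toRat (xratio i.castSucc i.succ))) * (grp (simpleRefl i) - 1) := by
    rw [heckeT, add_sub_cancel_left]
  have h3 : affRefl i.succ = simpleRefl i := rfl
  rw [h2, ← mul_assoc, ← map_mul, ← h1, intGen, h3, mul_sub, mul_one, sub_add_cancel]

theorem intGen_zero {n : ℕ} (k q : ℂˣ) :
    intGen k q 0 = grp (piElt n) * intGen k q (Fin.last n).succ * grp (piElt n)⁻¹ := by
  have h : piElt n • dGen k q (Fin.last n).succ = dGen k q 0 := by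
    have h1 : piElt n • (xratio (Fin.last n).succ (Fin.last n).castSucc : Laurent (n + 2) q) =
        ((q⁻¹ : ℂˣ) : ℂ) • xratio 0 (Fin.last (n + 1)) := by
      rw [piElt, mul_smul, transl_smul_xratio, smul_comm, perm_smul_xratio, Fin.succ_last,
        finRotate_last, finRotate_apply, Fin.coeSucc_eq_succ, Fin.succ_last]
      simp [Fin.castSucc_ne_last]
    change piElt n • (algebraMap ℂ (Laurent (n + 2) q) (k : ℂ) -
      ((k⁻¹ : ℂˣ) : ℂ) • xratio (Fin.last n).succ (Fin.last n).castSucc) = _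
    rw [smul_sub, smul_algebraMap, smul_comm, h1, smul_smul, ← Units.val_mul]
    rfl
  have h0 : (affRefl 0 : W (n + 2)) = piElt n * affRefl (Fin.last n).succ * (piElt n)⁻¹ := rfl
  rw [intGen, intGen, ← mul_assoc, grp_mul_ratX, toRat, toRat, smul_algebraMap_ratFun, h, h0,
    map_mul, map_mul]
  simp only [mul_assoc]

theorem intGen_mem {n : ℕ} (k q : ℂˣ) (j : Fin (n + 2)) : intGen k q j ∈ DAHA n k q := by
  have hsucc : ∀ i : Fin (n + 1), intGen k q i.succ ∈ DAHA n k q := fun i => by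
    rw [intGen_succ]
    exact add_mem (mul_mem (opX _).2 (sub_mem (genT i).2 (algebraMap_mem _ _))) (opX _).2
  refine Fin.cases ?_ hsucc j
  rw [intGen_zero]
  exact mul_mem (mul_mem (unitPi (k := k) (q := q)).val.2 (hsucc _))
    (unitPi (k := k) (q := q)).inv.2

/-- The affine intertwiner `S̃_w = S̃_{j_1} ⋯ S̃_{j_r} π^m ∈ ℍ`, for a reduced expression
`w = s_{j_1} ⋯ s_{j_r} π^m`. -/
def intertwiner {n : ℕ} (k q : ℂˣ) (w : W (n + 2)) : DAHA n k q :=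
  ((redWord w).1.map fun j => (⟨intGen k q j, intGen_mem k q j⟩ : DAHA n k q)).prod *
    ((unitPi ^ (redWord w).2 : (DAHA n k q)ˣ) : DAHA n k q)

/-- `d_{j_1} (s_{j_1} d_{j_2}) ⋯ (s_{j_1} ⋯ s_{j_{r-1}} d_{j_r})`. -/
def dWord {n : ℕ} (k q : ℂˣ) : List (Fin (n + 2)) → Laurent (n + 2) q
  | [] => 1
  | j :: l => dGen k q j * affRefl j • dWord k q l

/-- The regular function `d_w ∈ ℂ[T]`, for which `S̃_w = d_w(X) w`. -/
def dElt {n : ℕ} (k q : ℂˣ) (w : W (n + 2)) : Laurent (n + 2) q := dWord k q (redWord w).1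

theorem redWord_spec {n : ℕ} (w : W (n + 2)) : IsReduced w (redWord w) :=
  (exists_reduced w).choose_spec

theorem intertwiner_eq {n : ℕ} (k q : ℂˣ) (w : W (n + 2)) :
    (intertwiner k q w : Smash (n + 2) q) = ratX (toRat (dElt k q w)) * grp w := by
  have hl : ∀ l : List (Fin (n + 2)),
      (((l.map fun j => (⟨intGen k q j, intGen_mem k q j⟩ : DAHA n k q)).prod : DAHA n k q) :
        Smash (n + 2) q) = ratX (toRat (dWord k q l)) * grp (l.map affRefl).prod := by
    intro l
    induction l with
    | nil => simp [dWord, toRat]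
    | cons j l ih =>
      rw [List.map_cons, List.prod_cons, Subalgebra.coe_mul, ih, List.map_cons, List.prod_cons,
        map_mul, dWord]
      change ratX (toRat (dGen k q j)) * grp (affRefl j) * _ = _
      rw [mul_assoc, ← mul_assoc (grp (affRefl j)), grp_mul_ratX, toRat, toRat, toRat,
        smul_algebraMap_ratFun, map_mul, map_mul]
      simp only [mul_assoc]
  have hpi : ∀ m : ℤ, (((unitPi ^ m : (DAHA n k q)ˣ) : DAHA n k q) : Smash (n + 2) q) =
      grp (piElt n ^ m) := by
    intro m
    have h1 : Units.map (DAHA n k q).val.toRingHom.toMonoidHom (unitPi (k := k) (q := q)) =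
        Units.map grp (toUnits (piElt n)) := Units.ext rfl
    have h2 : Units.map (DAHA n k q).val.toRingHom.toMonoidHom (unitPi (k := k) (q := q) ^ m) =
        Units.map grp (toUnits (piElt n ^ m)) := by
      rw [map_zpow, h1, ← map_zpow, ← map_zpow]
    exact congrArg Units.val h2
  have hw : ((redWord w).1.map affRefl).prod * piElt n ^ (redWord w).2 = w := (redWord_spec w).1
  calc _ = ratX (toRat (dWord k q (redWord w).1)) * grp ((redWord w).1.map affRefl).prod *
        grp (piElt n ^ (redWord w).2) := by rw [intertwiner, Subalgebra.coe_mul, hl, hpi]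
    _ = ratX (toRat (dElt k q w)) *
        grp (((redWord w).1.map affRefl).prod * piElt n ^ (redWord w).2) := by
          rw [mul_assoc, ← map_mul, dElt]
    _ = _ := by rw [hw]

/-! ### The space `H_0^𝕂` and the maps on it -/

/-- `H_0^𝕂 = 𝕂 ⊗ H_0`, the space of `H_0`-valued meromorphic functions on `T × T`. -/
abbrev H0K (n : ℕ) (k q : ℂˣ) : Type := Mer (n + 2) q ⊗[ℂ] H0 n k q

/-- The action of `g ∈ 𝕎` on the coefficients, `(g f)(t, γ) = f(g⁻¹(t, γ))`. -/
def coeffAct {n : ℕ} {k q : ℂˣ} (g : BW (n + 2)) : H0K n k q ≃ₗ[ℂ] H0K n k q :=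
  TensorProduct.congr (DistribMulAction.toLinearEquiv ℂ (Mer (n + 2) q) g)
    (LinearEquiv.refl ℂ (H0 n k q))

theorem coeffAct_tmul {n : ℕ} {k q : ℂˣ} (g : BW (n + 2)) (a : Mer (n + 2) q) (h : H0 n k q) :
    coeffAct g (a ⊗ₜ[ℂ] h) = (g • a) ⊗ₜ[ℂ] h := rfl

theorem coeffAct_smul {n : ℕ} {k q : ℂˣ} (g : BW (n + 2)) (a : Mer (n + 2) q) (u : H0K n k q) :
    coeffAct g (a • u) = (g • a) • coeffAct g u := by
  induction u using TensorProduct.induction_on with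
  | zero => simp
  | tmul b h => simp [TensorProduct.smul_tmul', coeffAct_tmul, smul_mul']
  | add u v hu hv => rw [smul_add, map_add, hu, hv, map_add, smul_add]

theorem coeffAct_mul {n : ℕ} {k q : ℂˣ} (g g' : BW (n + 2)) (u : H0K n k q) :
    coeffAct (g * g') u = coeffAct g (coeffAct g' u) := by
  induction u using TensorProduct.induction_on with
  | zero => simp
  | tmul b h => simp [coeffAct_tmul, mul_smul]
  | add u v hu hv => rw [map_add, hu, hv, map_add, map_add]

theorem coeffAct_one {n : ℕ} {k q : ℂˣ} (u : H0K n k q) : coeffAct 1 u = u := by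
  induction u using TensorProduct.induction_on with
  | zero => simp
  | tmul b h => simp [coeffAct_tmul]
  | add u v hu hv => rw [map_add, hu, hv]

/-- The conjugation action `A ↦ g A g⁻¹` of `𝕎` on `GL_𝕂(H_0^𝕂)`. In terms of `End(H_0)`-valued
functions it is `(g A)(t, γ) = A(g⁻¹(t, γ))`. -/
instance (n : ℕ) (k q : ℂˣ) :
    MulDistribMulAction (BW (n + 2)) (H0K n k q ≃ₗ[Mer (n + 2) q] H0K n k q) where
  smul g A :=
    { toFun := fun u => coeffAct g (A (coeffAct g⁻¹ u))
      invFun := fun u => coeffAct g (A.symm (coeffAct g⁻¹ u))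
      map_add' := fun u v => by simp only [map_add]
      map_smul' := fun a u => by
        rw [coeffAct_smul, map_smul, coeffAct_smul, smul_inv_smul, RingHom.id_apply]
      left_inv := fun u => by
        simp only [← coeffAct_mul, inv_mul_cancel, coeffAct_one, LinearEquiv.symm_apply_apply,
          mul_inv_cancel]
      right_inv := fun u => by
        simp only [← coeffAct_mul, inv_mul_cancel, coeffAct_one, LinearEquiv.apply_symm_apply,
          mul_inv_cancel] }
  one_smul A := LinearEquiv.ext fun u => by
    change coeffAct 1 (A (coeffAct 1⁻¹ u)) = A u
    rw [inv_one, coeffAct_one, coeffAct_one]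
  mul_smul g g' A := LinearEquiv.ext fun u => by
    change coeffAct (g * g') (A (coeffAct (g * g')⁻¹ u)) =
      coeffAct g (coeffAct g' (A (coeffAct g'⁻¹ (coeffAct g⁻¹ u))))
    rw [mul_inv_rev, coeffAct_mul, coeffAct_mul]
  smul_one g := LinearEquiv.ext fun u => by
    change coeffAct g (coeffAct g⁻¹ u) = u
    rw [← coeffAct_mul, mul_inv_cancel, coeffAct_one]
  smul_mul g A B := LinearEquiv.ext fun u => by
    change coeffAct g (A (B (coeffAct g⁻¹ u))) =
      coeffAct g (A (coeffAct g⁻¹ (coeffAct g (B (coeffAct g⁻¹ u)))))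
    rw [← coeffAct_mul g⁻¹ g, inv_mul_cancel, coeffAct_one]

theorem smul_apply_H0K {n : ℕ} {k q : ℂˣ} (g : BW (n + 2))
    (A : H0K n k q ≃ₗ[Mer (n + 2) q] H0K n k q) (u : H0K n k q) :
    (g • A) u = coeffAct g (A (coeffAct g⁻¹ u)) := rfl

/-- `s` is the duality anti-involution `*` of `ℍ`: the `ℂ`-linear anti-algebra involution with
`T_i^* = T_i` (equivalently `T_w^* = T_{w⁻¹}` for `w ∈ S_N`), `(Y^v)^* = X^{-v}` and
`(X^v)^* = Y^{-v}`. -/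
structure IsDuality {n : ℕ} {k q : ℂˣ} (s : DAHA n k q →ₗ[ℂ] DAHA n k q) : Prop where
  map_one : s 1 = 1
  map_mul : ∀ a b, s (a * b) = s b * s a
  involutive : ∀ a, s (s a) = a
  map_T : ∀ i, s (genT i) = genT i
  map_Y : ∀ v, s (Ypow v) = Xpow (-v)
  map_X : ∀ v, s (Xpow v) = Ypow (-v)

/-- `j` is the canonical map `ℍ → 𝕂 ⊗_𝕃 ℍ ≅ H_0^𝕂`, where `𝕃 = ℂ[T] ⊗ ℂ[T]` acts on `ℍ` by
`(f ⊗ g) · h = f(X) h g(Y)`: it maps `f(X) h g(Y)` to `f(x) g(y) ⊗ h` for `h ∈ H_0`. -/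
def IsCanonicalMap {n : ℕ} {k q : ℂˣ} (j : DAHA n k q →ₗ[ℂ] H0K n k q) : Prop :=
  ∀ (f g : Laurent (n + 2) q) (h : H0 n k q),
    j (opX f * inclH0 h * opY g) = (inX f * inY g) ⊗ₜ[ℂ] h

/-- `E` is the extension to `H_0^𝕂` of the map `σ̃_{(w, w')}(h) = S̃_w h S̃_{w'}^*` on `ℍ`, semilinear
with respect to the action of `(w, w')` on `𝕂`. -/
def IsSigma {n : ℕ} {k q : ℂˣ} (s : DAHA n k q →ₗ[ℂ] DAHA n k q) (j : DAHA n k q →ₗ[ℂ] H0K n k q)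
    (w w' : W (n + 2)) (E : H0K n k q →ₗ[ℂ] H0K n k q) : Prop :=
  (∀ h, E (j h) = j (intertwiner k q w * h * s (intertwiner k q w'))) ∧
    ∀ (a : Mer (n + 2) q) (u : H0K n k q), E (a • u) = (bw w w' • a) • E u

/-- `E` is the extension to `H_0^𝕂` of the map `σ̃_ι(h) = h^*` on `ℍ`, semilinear with respect to the
action of `ι` on `𝕂`. -/
def IsSigmaIota {n : ℕ} {k q : ℂˣ} (s : DAHA n k q →ₗ[ℂ] DAHA n k q)
    (j : DAHA n k q →ₗ[ℂ] H0K n k q) (E : H0K n k q →ₗ[ℂ] H0K n k q) : Prop :=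
  (∀ h, E (j h) = j (s h)) ∧
    ∀ (a : Mer (n + 2) q) (u : H0K n k q), E (a • u) = ((bwIota : BW (n + 2)) • a) • E u

/-- The formulas prescribing `τ`:
`τ(w, w') f = d_w(x)⁻¹ d_{w'}^◇(y)⁻¹ · σ̃_{(w, w')} f` and `τ(ι) f = σ̃_ι f`. -/
def IsTau {n : ℕ} {k q : ℂˣ} (σ : W (n + 2) → W (n + 2) → H0K n k q →ₗ[ℂ] H0K n k q)
    (σι : H0K n k q →ₗ[ℂ] H0K n k q) (τ : BW (n + 2) →* (H0K n k q ≃ₗ[ℂ] H0K n k q)) : Prop :=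
  (∀ w w' f, τ (bw w w') f =
    ((inX (dElt k q w) : Mer (n + 2) q)⁻¹ * (inY (diamondFun (dElt k q w')))⁻¹) • σ w w' f) ∧
  ∀ f, τ bwIota f = σι f

/-! ### The bispectral quantum KZ equations -/

/-- The translation `(λ, μ) ∈ ℤ^N × ℤ^N` in `𝕎`. -/
def bwTransl {N : ℕ} (u v : Fin N → ℤ) : BW N := bw (transl u) (transl v)

/-- The set of `f ∈ H_0^𝕂` solving the BqKZ equations
`C_{(λ, μ)}(t, γ) f(q^{-λ} t, q^μ γ) = f(t, γ)` for all `λ, μ ∈ ℤ^N`. -/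
def SOL {n : ℕ} {k q : ℂˣ} (C : BW (n + 2) → (H0K n k q ≃ₗ[Mer (n + 2) q] H0K n k q)) :
    Set (H0K n k q) :=
  {f | ∀ u v : Fin (n + 2) → ℤ, C (bwTransl u v) (coeffAct (bwTransl u v) f) = f}

/-- The subfield `𝔽 ⊆ 𝕂` of functions invariant under all `(λ, μ) ∈ ℤ^N × ℤ^N`. -/
def invField (N : ℕ) (q : ℂˣ) : Subfield (Mer N q) where
  carrier := {f | ∀ u v : Fin N → ℤ, bwTransl u v • f = f}
  mul_mem' := fun ha hb u v => by rw [smul_mul', ha, hb]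
  one_mem' := fun u v => smul_one _
  add_mem' := fun ha hb u v => by rw [smul_add, ha, hb]
  zero_mem' := fun u v => smul_zero _
  neg_mem' := fun ha u v => by rw [smul_neg, ha]
  inv_mem' := fun a ha u v => by rw [smul_inv'', ha]

/-- The subgroup `𝕊_N = ℤ_2 ⋉ (S_N × S_N)` of `𝕎`. -/
def finiteSubgroup (N : ℕ) : Subgroup (BW N) where
  carrier := {g | ∃ σ ρ : Equiv.Perm (Fin N), g.left = (perm σ, perm ρ)}
  mul_mem' := by
    rintro g g' ⟨σ, ρ, h⟩ ⟨σ', ρ', h'⟩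
    by_cases hz : g.right = 1
    · exact ⟨σ * σ', ρ * ρ', by
        rw [SemidirectProduct.mul_left, h, h', hz, map_one, perm_mul, perm_mul]; rfl⟩
    · exact ⟨σ * ρ', ρ * σ', by
        rw [SemidirectProduct.mul_left, h, h', perm_mul, perm_mul]
        simp only [switchHom, MonoidHom.coe_mk, OneHom.coe_mk, if_neg hz]
        rfl⟩
  one_mem' := ⟨1, 1, rfl⟩
  inv_mem' := by
    rintro g ⟨σ, ρ, h⟩
    by_cases hz : g.right = 1
    · exact ⟨σ⁻¹, ρ⁻¹, by
        rw [SemidirectProduct.inv_left, h, hz, inv_one, map_one, perm_inv, perm_inv]; rfl⟩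
    · exact ⟨ρ⁻¹, σ⁻¹, by
        have hz' : g.right⁻¹ ≠ 1 := inv_ne_one.mpr hz
        rw [SemidirectProduct.inv_left, h, perm_inv, perm_inv]
        simp only [switchHom, MonoidHom.coe_mk, OneHom.coe_mk, if_neg hz']
        rfl⟩

end

end BqKZ

open BqKZ

namespace BqKZ

noncomputable section

/-! ### Consequences of the defining relations in a group -/

/-! Everything rests on two facts about `ℍ`: the PBW decomposition `ℍ = ℂ[X] ⊗ H_0 ⊗ ℂ[Y]` and the
duality `*`. With PBW, both `j` and the linear map underlying `*` can be prescribed on the products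
`f(X) h g(Y)`. The work left is to show that `f(X) h g(Y) ↦ g^◇(X) h^* f^◇(Y)` reverses products.

PBW. Spanning (`span_opX_mul_inclH0_mul_opYHom`) follows from the Bernstein relations and from `π ∈
ℂ[Y] H_0`. Independence (`linearIndependent_pbwY_posSet`) is a dimension count over `ℂ(T)`, which
needs neither a basis `T_w` nor triangularity. Let `M` be the finite set of nonnegative exponents of
degree at most `r`. The products `h Y^μ`, with `h` in a basis of `H_0` and `μ ∈ M`, span a space
that contains the group elements `μ σ` for all `μ ∈ M`, `σ ∈ S_N`. These are `|M| N!` independent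
vectors, while `dim H_0 ≤ N!` (`finrank_H0_le`), so the products cannot be dependent. Multiplying by
a power of `Y_1 ⋯ Y_N` removes the restriction on `μ`, and `linearIndependent_pbw` passes from
`ℂ(T)` to `ℂ`.

Duality. By `eq_top_of_closed` only left multiplication by generators must be checked. For `T_i`,
`exists_bernsteinRel` gives `T_i f(X) = (s_i f)(X) T_i + g(X)` together with its mirror image in
`Y`, with the same `g`. For `π`, the image is `(T_1 ⋯ T_{N-1})⁻¹ X_1⁻¹`, and this element moves the
`Y_j` as `π` moves the `X_j` (`opYHom_diamondFun_mul_unitDualPi`). That is a computation in the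
double affine braid group, done first for an arbitrary group. On `H_0`, `*` is the restriction of `f
w ↦ δ⁻¹ w⁻¹ δ f` on `ℂ(T) # W`, with a weight `δ` for which every `T_i` is fixed.

The action `τ`. From `S̃_w = d_w(X) w` one gets `S̃_w f(X) = (w f)(X) S̃_w`, so `h ↦ S̃_w h
S̃_{w'}^*` extends semilinearly to `H_0^𝕂`. Moreover `S̃_w S̃_v` is `S̃_{wv}` up to the factor `d_w
(w d_v) / d_{wv}`, which the normalisation of `τ` removes (`normalized_mul`). Since `*` exchanges
left and right factors, `ι` intertwines `(w, w')` with `(w', w)`, and `τ` comes from the universal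
property of the semidirect product.

BqKZ. As `C_g g = τ(g)`, the equations say that `f` is fixed by `τ` of the lattice. Holonomy is
commutativity of the lattice, and `SOL` is stable under `𝕊_N` because `𝕊_N` normalises the lattice.
-/

/-- The descending product `t_{l-1} ⋯ t_0`. -/
def descProd {G : Type*} [Group G] (t : ℕ → G) : ℕ → G
  | 0 => 1
  | l + 1 => t l * descProd t l

/-- The ascending product `t_0 ⋯ t_{l-1}`. -/
def ascProd {G : Type*} [Group G] (t : ℕ → G) : ℕ → G
  | 0 => 1
  | l + 1 => ascProd t l * t l

/-- The braid relations for `t_0, …, t_{m-1}`. -/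
structure IsBraid {G : Type*} [Group G] (m : ℕ) (t : ℕ → G) : Prop where
  braid : ∀ i, i + 1 < m → t i * t (i + 1) * t i = t (i + 1) * t i * t (i + 1)
  comm : ∀ i j, i + 1 < j → j < m → Commute (t i) (t j)

/-- The relations between `t_i`, `π` and the elements `y_j` of the extended affine braid group. -/
structure IsAffineBraid {G : Type*} [Group G] (m : ℕ) (t y : ℕ → G) (p : G) : Prop
    extends IsBraid m t where
  pi_mul : ∀ i, i + 1 < m → p * t i = t (i + 1) * p
  pi_sq : p * p * t (m - 1) = t 0 * (p * p)
  pos : 0 < m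
  y_zero : y 0 = p * descProd t m
  y_succ : ∀ j, j < m → y (j + 1) = (t j)⁻¹ * y j * (t j)⁻¹

/-- The relations between `t_i`, `π`, `y_j`, `x_j` and the central element `z` in the double affine
braid group. -/
structure IsDoubleAffineBraid {G : Type*} [Group G] (m : ℕ) (t x y : ℕ → G) (p z : G) : Prop
    extends IsAffineBraid m t y p where
  x_succ : ∀ j, j < m → x (j + 1) = t j * x j * t j
  comm_x : ∀ i j, i < m → j ≤ m → j ≠ i → j ≠ i + 1 → Commute (t i) (x j)
  pi_x : ∀ j, j < m → p * x j = x (j + 1) * p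
  pi_x_last : p * x m = z * x 0 * p
  central : ∀ g, Commute z g

section

variable {G : Type*} [Group G] {m : ℕ} {t x y : ℕ → G} {p z : G}

/-! ### Affine braid relations: the `y_j` commute (indices start at `0`, and `m = N - 1`) -/

theorem mul_inv_mul_inv_of_braid {a b : G} (h : a * b * a = b * a * b) :
    a * b⁻¹ * a⁻¹ = b⁻¹ * a⁻¹ * b := by
  calc a * b⁻¹ * a⁻¹ = b⁻¹ * a⁻¹ * (a * b * a) * b⁻¹ * a⁻¹ := by group
    _ = b⁻¹ * a⁻¹ * b := by rw [h]; group

theorem inv_mul_inv_mul_of_braid {a b : G} (h : a * b * a = b * a * b) :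
    a⁻¹ * b⁻¹ * a = b * a⁻¹ * b⁻¹ := by
  calc a⁻¹ * b⁻¹ * a = a⁻¹ * b⁻¹ * (a * b * a) * a⁻¹ * b⁻¹ := by group
    _ = b * a⁻¹ * b⁻¹ := by rw [h]; group

theorem IsBraid.commute_descProd (h : IsBraid m t) {i l : ℕ} (hl : l < i) (hi : i < m) :
    Commute (t i) (descProd t l) := by
  induction l with
  | zero => exact Commute.one_right _
  | succ l ih => exact ((h.comm l i hl hi).symm).mul_right (ih (by omega))

theorem IsBraid.commute_ascProd (h : IsBraid m t) {i l : ℕ} (hl : l < i) (hi : i < m) :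
    Commute (t i) (ascProd t l) := by
  induction l with
  | zero => exact Commute.one_right _
  | succ l ih => exact (ih (by omega)).mul_right ((h.comm l i hl hi).symm)

/-- `t_i` slides past `t_{l-1}, …, t_{i+2}`, the braid relation turns `t_i t_{i+1} t_i` into
`t_{i+1} t_i t_{i+1}`, and `t_{i+1}` slides past the rest: crossing the descending product raises an
index by one. -/
theorem IsBraid.mul_descProd (h : IsBraid m t) {i l : ℕ} (hi : i + 1 < l) (hl : l ≤ m) :
    t i * descProd t l = descProd t l * t (i + 1) := by
  induction l with
  | zero => omega
  | succ l ih =>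
    rcases Nat.lt_or_ge (i + 1) l with hi' | hi'
    · rw [descProd, ← mul_assoc, (h.comm i l hi' (by omega)).eq, mul_assoc, ih hi' (by omega),
        mul_assoc]
    · obtain rfl : l = i + 1 := by omega
      have := (h.commute_descProd (i := i + 1) (l := i) (by omega) (by omega)).eq
      rw [descProd, descProd, mul_assoc, mul_assoc, ← this]
      simp only [← mul_assoc]
      rw [h.braid i (by omega)]

theorem IsBraid.ascProd_mul (h : IsBraid m t) {i l : ℕ} (hi : i + 1 < l) (hl : l ≤ m) :
    ascProd t l * t i = t (i + 1) * ascProd t l := by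
  induction l with
  | zero => omega
  | succ l ih =>
    rcases Nat.lt_or_ge (i + 1) l with hi' | hi'
    · rw [ascProd, mul_assoc, ← (h.comm i l hi' (by omega)).eq, ← mul_assoc, ih hi' (by omega),
        mul_assoc]
    · obtain rfl : l = i + 1 := by omega
      have := (h.commute_ascProd (i := i + 1) (l := i) (by omega) (by omega)).eq
      rw [ascProd, ascProd, ← mul_assoc, ← mul_assoc, this, mul_assoc, mul_assoc, mul_assoc,
        mul_assoc]
      congr 1
      simpa only [mul_assoc] using h.braid i (by omega)

/-- In `y_0 = p D`, crossing `p` lowers the index of `t_{i+1}` and crossing `D` raises it back. -/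
theorem IsAffineBraid.commute_y_zero (h : IsAffineBraid m t y p) {i : ℕ} (hi : i + 1 < m) :
    Commute (t (i + 1)) (y 0) := by
  rw [h.y_zero, commute_iff_eq, ← mul_assoc, ← h.pi_mul i hi, mul_assoc,
    h.mul_descProd hi le_rfl, mul_assoc]

theorem IsAffineBraid.commute_t_y (h : IsAffineBraid m t y p) {i j : ℕ} (hi : i < m) (hj : j ≤ m)
    (h1 : j ≠ i) (h2 : j ≠ i + 1) : Commute (t i) (y j) := by
  induction j using Nat.strong_induction_on generalizing i with
  | _ j ih =>
    rcases j with _ | j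
    · obtain ⟨i, rfl⟩ : ∃ i', i = i' + 1 := ⟨i - 1, by omega⟩
      exact h.commute_y_zero hi
    · rw [h.y_succ j (by omega)]
      have key : ∀ i, i < m → j ≠ i → j ≠ i + 1 → Commute (t i) (t j) →
          Commute (t i) ((t j)⁻¹ * y j * (t j)⁻¹) := fun i hi a b c =>
        ((c.inv_right).mul_right (ih j (by omega) hi (by omega) a b)).mul_right c.inv_right
      -- Only `y_{i+2}` needs the braid relation: it is unfolded twice, down to `y_i`, which
      -- commutes with `t_{i+1}`. Otherwise `t_i` commutes with `t_j` and with `y_j`, hence with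
      -- `y_{j+1}`.
      by_cases hij : j = i + 1
      · subst hij
        have hc := ih i (by omega) (i := i + 1) (by omega) (by omega) (by omega) (by omega)
        have hbr := h.braid i (by omega)
        rw [h.y_succ i (by omega)]
        have e1 := mul_inv_mul_inv_of_braid hbr
        have e2 := inv_mul_inv_mul_of_braid hbr
        set a := t i
        set b := t (i + 1)
        rw [commute_iff_eq]
        calc a * (b⁻¹ * (a⁻¹ * y i * a⁻¹) * b⁻¹) = (a * b⁻¹ * a⁻¹) * y i * a⁻¹ * b⁻¹ := by group
          _ = b⁻¹ * a⁻¹ * (b * y i) * a⁻¹ * b⁻¹ := by rw [e1]; group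
          _ = b⁻¹ * a⁻¹ * y i * (b * a⁻¹ * b⁻¹) := by rw [hc.eq]; group
          _ = b⁻¹ * (a⁻¹ * y i * a⁻¹) * b⁻¹ * a := by rw [← e2]; group
      · rcases Nat.lt_or_ge i j with hlt | hge
        · exact key i hi (by omega) (by omega) (h.comm i j (by omega) (by omega))
        · exact key i hi (by omega) (by omega) (h.comm j i (by omega) (by omega)).symm

/-- The left factor `D_{l+1} t_0⁻¹` is `t_l ⋯ t_1`, which is the conjugate of `t_{l-1} ⋯ t_0` by
`p`. -/
theorem IsAffineBraid.descProd_mul_pi (h : IsAffineBraid m t y p) {l : ℕ} (hl : l + 1 ≤ m) :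
    descProd t (l + 1) * (t 0)⁻¹ * p = p * descProd t l := by
  induction l with
  | zero => simp [descProd]
  | succ l ih =>
    rw [descProd, mul_assoc, mul_assoc, ← mul_assoc (descProd t (l + 1)), ih (by omega),
      ← mul_assoc, ← h.pi_mul l (by omega), mul_assoc]
    rfl

/-- Again `D_{l+1} t_0⁻¹ = t_l ⋯ t_1`, and crossing the full descending product from right to left
lowers each index by one. -/
theorem IsBraid.descProd_mul_descProd (h : IsBraid m t) {l : ℕ} (hl : l + 1 ≤ m) :
    descProd t m * (descProd t (l + 1) * (t 0)⁻¹) = descProd t l * descProd t m := by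
  induction l with
  | zero => simp [descProd]
  | succ l ih =>
    rw [descProd, mul_assoc, ← mul_assoc (descProd t m), ← h.mul_descProd (by omega) le_rfl,
      mul_assoc, ih (by omega), ← mul_assoc]
    rfl

/-- With `P = y_0 t_0⁻¹` one has `y_0 = P t_0` and `y_1 = t_0⁻¹ P`. So the claim is that `t_0`
commutes with `P²`, and this comes from `p² t_{m-1} = t_0 p²` once both factors `p` of `P²` are
collected on the left. -/
theorem IsAffineBraid.commute_y_zero_y_one (h : IsAffineBraid m t y p) :
    Commute (y 0) (y 1) := by
  obtain ⟨l, rfl⟩ : ∃ l, m = l + 1 := ⟨m - 1, by have := h.pos; omega⟩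
  have h1 := h.descProd_mul_pi (l := l) le_rfl
  have h2 := h.descProd_mul_descProd (l := l) le_rfl
  have h3 : descProd t (l + 1) = t l * descProd t l := rfl
  have h4 : p * p * t l = t 0 * (p * p) := h.pi_sq
  set D := descProd t (l + 1)
  set E := descProd t l
  set P := p * D * (t 0)⁻¹ with hP
  have hPP : P * P = p * p * (E * D) * (t 0)⁻¹ := by
    calc P * P = p * (D * (t 0)⁻¹ * p) * D * (t 0)⁻¹ := by rw [hP]; group
      _ = _ := by rw [h1]; group
  have hc : t 0 * (P * P) = P * P * t 0 := by
    rw [hPP]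
    calc t 0 * (p * p * (E * D) * (t 0)⁻¹) = (t 0 * (p * p)) * E * D * (t 0)⁻¹ := by group
      _ = p * p * (t l * E) * D * (t 0)⁻¹ := by rw [← h4]; group
      _ = p * p * (D * (D * (t 0)⁻¹)) := by rw [← h3]; group
      _ = _ := by rw [h2]; group
  have h0 : y 0 = P * t 0 := by rw [h.y_zero, hP, inv_mul_cancel_right]
  rw [commute_iff_eq, h.y_succ 0 (by omega), h0]
  calc P * t 0 * ((t 0)⁻¹ * (P * t 0) * (t 0)⁻¹) = P * P := by group
    _ = (t 0)⁻¹ * (t 0 * (P * P)) := by group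
    _ = (t 0)⁻¹ * (P * t 0) * (t 0)⁻¹ * (P * t 0) := by rw [hc]; group

/-- The recursion for `y_{j+1}` propagates the case `(0, 1)` first in the second index, as `t_{j+1}`
commutes with `y_0`, and then in the first, as `t_i` commutes with `y_j` for `j > i + 1`. -/
theorem IsAffineBraid.commute_y (h : IsAffineBraid m t y p) {i j : ℕ} (hi : i ≤ m) (hj : j ≤ m) :
    Commute (y i) (y j) := by
  have h0 : ∀ j, j + 1 ≤ m → Commute (y 0) (y (j + 1)) := by
    intro j hj
    induction j with
    | zero => exact h.commute_y_zero_y_one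
    | succ j ih =>
      have := (h.commute_y_zero (i := j) (by omega)).symm.inv_right
      rw [h.y_succ (j + 1) (by omega)]
      exact (this.mul_right (ih (by omega))).mul_right this
  have hlt : ∀ i j, i < j → j ≤ m → Commute (y i) (y j) := by
    intro i j hij hj
    induction i with
    | zero =>
      obtain ⟨j, rfl⟩ : ∃ j', j = j' + 1 := ⟨j - 1, by omega⟩
      exact h0 j hj
    | succ i ih =>
      have := (h.commute_t_y (i := i) (j := j) (by omega) hj (by omega) (by omega)).inv_left
      rw [h.y_succ i (by omega)]
      exact (this.mul_left (ih (by omega))).mul_left this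
  rcases lt_trichotomy i j with hij | rfl | hij
  · exact hlt i j hij hj
  · exact Commute.refl _
  · exact (hlt j i hij hi).symm

/-! ### The dual of `p` and its relations with the `y_j` -/

/-- The element dual to `π`. -/
def dualPi (m : ℕ) (t x : ℕ → G) : G := (ascProd t m)⁻¹ * (x 0)⁻¹

theorem IsDoubleAffineBraid.commute_t_x_zero (h : IsDoubleAffineBraid m t x y p z) {i : ℕ}
    (hi : i + 1 < m) : Commute (t (i + 1)) (x 0) :=
  h.comm_x _ _ hi (by omega) (by omega) (by omega)

/-- The dual of `p t_i = t_{i+1} p`, in reversed order: `t_{i+1}` commutes with `x_0` and loses one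
from its index on crossing the inverse ascending product. -/
theorem IsDoubleAffineBraid.dualPi_mul_t (h : IsDoubleAffineBraid m t x y p z) {i : ℕ}
    (hi : i + 1 < m) : dualPi m t x * t (i + 1) = t i * dualPi m t x := by
  have h1 := h.ascProd_mul hi le_rfl
  have h2 := (h.commute_t_x_zero hi).inv_right.eq
  rw [dualPi, mul_assoc, ← h2, ← mul_assoc, ← mul_assoc]
  congr 1
  rw [inv_mul_eq_iff_eq_mul, ← mul_assoc, h1, mul_inv_cancel_right]

theorem IsAffineBraid.y_eq (h : IsAffineBraid m t y p) {l : ℕ} (hl : l ≤ m) :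
    y l = (ascProd t l)⁻¹ * y 0 * (descProd t l)⁻¹ := by
  induction l with
  | zero => simp [ascProd, descProd]
  | succ l ih =>
    rw [h.y_succ l hl, ih (by omega), ascProd, descProd]
    group

/-- The recursion unrolls to `x_l = D_l x_0 A_l`, with `D_l`, `A_l` the descending and ascending
products. For `l = m` this is a second expression for the dual of `p`. -/
theorem IsDoubleAffineBraid.x_inv_mul_descProd (h : IsDoubleAffineBraid m t x y p z) {l : ℕ}
    (hl : l ≤ m) : (x l)⁻¹ * descProd t l = (ascProd t l)⁻¹ * (x 0)⁻¹ := by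
  induction l with
  | zero => simp [ascProd, descProd]
  | succ l ih =>
    rw [h.x_succ l hl, ascProd, descProd, mul_inv_rev (ascProd t l), mul_assoc _ _ (x 0)⁻¹,
      ← ih (by omega)]
    group

/-- The duality is to exchange `x_j` with `y_j⁻¹` and reverse products, so this is the image of `p
x_m = z x_0 p`. It is derived from that same relation. -/
theorem IsDoubleAffineBraid.dualPi_mul_y_zero (h : IsDoubleAffineBraid m t x y p z) :
    dualPi m t x * y 0 = z * y m * dualPi m t x := by
  have hx := h.pi_x_last
  have h1 : (x 0)⁻¹ * p = z * p * (x m)⁻¹ := by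
    rw [eq_mul_inv_iff_mul_eq, mul_assoc, hx, ← mul_assoc, ← mul_assoc, (h.central _).symm.eq]
    group
  have h2 : y m = (ascProd t m)⁻¹ * p := by rw [h.y_eq le_rfl, h.y_zero]; group
  rw [h2, dualPi, h.y_zero]
  calc (ascProd t m)⁻¹ * (x 0)⁻¹ * (p * descProd t m) =
      (ascProd t m)⁻¹ * ((x 0)⁻¹ * p) * descProd t m := by group
    _ = ((ascProd t m)⁻¹ * z) * p * ((x m)⁻¹ * descProd t m) := by rw [h1]; group
    _ = _ := by rw [← (h.central _).eq, h.x_inv_mul_descProd le_rfl]; group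

/-- The image of `p x_0 = x_1 p` under the expected duality. Inside the product, `x_0⁻¹ t_0⁻¹ = t_0
x_1⁻¹`, then `p` turns `x_1⁻¹` back into `x_0⁻¹`, which commutes with `t_l ⋯ t_1`. What is left is a
rearrangement of the `t_i` and `p` (`h3`, `h4`), in which each crossing shifts indices by one. -/
theorem IsDoubleAffineBraid.dualPi_mul_y_one (h : IsDoubleAffineBraid m t x y p z) :
    dualPi m t x * y 1 = y 0 * dualPi m t x := by
  obtain ⟨l, rfl⟩ : ∃ l, m = l + 1 := ⟨m - 1, by have := h.pos; omega⟩
  have h1 : (x 0)⁻¹ * (t 0)⁻¹ = t 0 * (x 1)⁻¹ := by rw [h.x_succ 0 (by omega)]; group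
  have h2 : (x 1)⁻¹ * p = p * (x 0)⁻¹ := by
    rw [inv_mul_eq_iff_eq_mul, ← mul_assoc, ← h.pi_x 0 (by omega)]; group
  have h3 : ∀ l', l' ≤ l → p * ascProd t l' = (t 0)⁻¹ * ascProd t (l' + 1) * p := by
    intro l' hl'
    induction l' with
    | zero => simp [ascProd]
    | succ l' ih =>
      rw [ascProd, ← mul_assoc, ih (by omega), mul_assoc, h.pi_mul l' (by omega), ← mul_assoc,
        mul_assoc (t 0)⁻¹]
      rfl
  have h4 : ∀ l', l' ≤ l → ascProd t l' * descProd t (l + 1) =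
      descProd t (l + 1) * ((t 0)⁻¹ * ascProd t (l' + 1)) := by
    intro l' hl'
    induction l' with
    | zero => simp [ascProd]
    | succ l' ih =>
      rw [ascProd, mul_assoc, h.mul_descProd (by omega) le_rfl, ← mul_assoc, ih (by omega),
        mul_assoc, mul_assoc]
      rfl
  have h5 : ∀ l', l' ≤ l → Commute (x 0) (descProd t (l' + 1) * (t 0)⁻¹) := by
    intro l' hl'
    induction l' with
    | zero => simp [descProd]
    | succ l' ih =>
      rw [descProd, mul_assoc]
      exact (h.commute_t_x_zero (by omega)).symm.mul_right (ih (by omega))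
  have h3 := h3 l le_rfl
  have h4 := h4 l le_rfl
  have h5 := (h5 l le_rfl).inv_left.eq
  rw [dualPi, h.y_succ 0 (by omega), h.y_zero]
  set A := ascProd t (l + 1)
  set A' := ascProd t l
  set D := descProd t (l + 1)
  have h6 : A⁻¹ * t 0 * p = p * A'⁻¹ := by
    rw [eq_mul_inv_iff_mul_eq, mul_assoc, h3]; group
  have h7 : A'⁻¹ * D * (t 0)⁻¹ = D * A⁻¹ := by
    rw [mul_assoc, inv_mul_eq_iff_eq_mul, ← mul_assoc, h4]; group
  calc A⁻¹ * (x 0)⁻¹ * ((t 0)⁻¹ * (p * D) * (t 0)⁻¹) =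
        A⁻¹ * ((x 0)⁻¹ * (t 0)⁻¹) * p * (D * (t 0)⁻¹) := by group
    _ = A⁻¹ * t 0 * ((x 1)⁻¹ * p) * (D * (t 0)⁻¹) := by rw [h1]; group
    _ = (A⁻¹ * t 0 * p) * ((x 0)⁻¹ * (D * (t 0)⁻¹)) := by rw [h2]; group
    _ = p * (A'⁻¹ * D * (t 0)⁻¹) * (x 0)⁻¹ := by rw [h5, h6]; group
    _ = _ := by rw [h7]; group

/-- Conjugation by the dual of `p` takes `t_{i+1}` to `t_i`, so it carries the recursion defining
`y_{i+2}` to the one defining `y_{i+1}`. -/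
theorem IsDoubleAffineBraid.dualPi_mul_y_succ (h : IsDoubleAffineBraid m t x y p z) {i : ℕ}
    (hi : i < m) : dualPi m t x * y (i + 1) = y i * dualPi m t x := by
  induction i with
  | zero => exact h.dualPi_mul_y_one
  | succ i ih =>
    have h1 := h.dualPi_mul_t hi
    have h2 : dualPi m t x * (t (i + 1))⁻¹ = (t i)⁻¹ * dualPi m t x := by
      rw [eq_inv_mul_iff_mul_eq, ← mul_assoc, ← h1, mul_inv_cancel_right]
    calc dualPi m t x * y (i + 1 + 1) =
        (dualPi m t x * (t (i + 1))⁻¹) * y (i + 1) * (t (i + 1))⁻¹ := by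
          rw [h.y_succ (i + 1) hi]; group
      _ = (t i)⁻¹ * (dualPi m t x * y (i + 1)) * (t (i + 1))⁻¹ := by rw [h2]; group
      _ = (t i)⁻¹ * y i * (dualPi m t x * (t (i + 1))⁻¹) := by rw [ih (by omega)]; group
      _ = y (i + 1) * dualPi m t x := by rw [h2, h.y_succ i (by omega)]; group

end

/-! ### The braid relations -/

/-- The element `k + c_k(z) (s - 1)` of the smash product. -/
def heckeElt {N : ℕ} {q : ℂˣ} (k : ℂˣ) (z : RatFun N q) (s : W N) : Smash N q :=
  algebraMap ℂ _ (k : ℂ) + ratX (ck k z) * (grp s - 1)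

theorem ratX_mul_grp {N : ℕ} {q : ℂˣ} (f : RatFun N q) (w : W N) :
    (ratX f * grp w : Smash N q) = SkewMonoidAlgebra.single w f := by
  change SkewMonoidAlgebra.single 1 f * SkewMonoidAlgebra.single w 1 = _
  simp [SkewMonoidAlgebra.single_mul_single]

theorem ratX_eq_single {N : ℕ} {q : ℂˣ} (f : RatFun N q) :
    (ratX f : Smash N q) = SkewMonoidAlgebra.single 1 f := rfl

theorem heckeElt_eq {N : ℕ} {q : ℂˣ} (k : ℂˣ) (z : RatFun N q) (s : W N) :
    heckeElt k z s = SkewMonoidAlgebra.single 1 (algebraMap ℂ _ (k : ℂ) - ck k z) +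
      SkewMonoidAlgebra.single s (ck k z) := by
  rw [heckeElt, mul_sub, ratX_mul_grp, mul_one, algebraMap_smash, ratX_eq_single, ratX_eq_single,
    sub_eq_add_neg (algebraMap ℂ (RatFun N q) (k : ℂ)), SkewMonoidAlgebra.single_add,
    SkewMonoidAlgebra.single_neg]
  abel

/-- This is the coefficient of the identity in `T_i`. Its numerator no longer depends on `z`, which
is what keeps the next identity short. -/
theorem sub_ck {F : Type*} [Field F] [Algebra ℂ F] (k : ℂˣ) {z : F} (h1 : z ≠ 1) :
    algebraMap ℂ F (k : ℂ) - ck k z =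
      (algebraMap ℂ F (k : ℂ) - algebraMap ℂ F ((k⁻¹ : ℂˣ) : ℂ)) / (1 - z) := by
  have h2 : 1 - z ≠ 0 := sub_ne_zero.mpr h1.symm
  rw [ck]
  field_simp
  ring

theorem smul_ck' {N : ℕ} {q : ℂˣ} (k : ℂˣ) (w : W N) (z : RatFun N q) :
    w • ck k z = ck k (w • z) := by
  unfold ck
  rw [smul_div₀', smul_sub, smul_sub, smul_mul', smul_algebraMap, smul_algebraMap, smul_one]

theorem grp_mul_heckeElt {N : ℕ} {q : ℂˣ} (k : ℂˣ) (w : W N) (z : RatFun N q) (s : W N) :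
    grp w * heckeElt k z s = heckeElt k (w • z) (w * s * w⁻¹) * grp w := by
  rw [heckeElt, heckeElt, mul_add, add_mul, ← mul_assoc, grp_mul_ratX, smul_ck',
    ← Algebra.commutes, mul_assoc, mul_assoc, mul_sub, sub_mul, ← map_mul, ← map_mul, mul_one,
    one_mul, inv_mul_cancel_right]

/-- After division by `(k - k⁻¹)²` this is the partial fraction identity `1/((1-x)(1-y)) +
1/((1-xy)(1-x⁻¹)) = 1/((1-y)(1-xy))`. -/
theorem sub_ck_mul_sub_ck {F : Type*} [Field F] [Algebra ℂ F] (k : ℂˣ) {x y : F} (hx0 : x ≠ 0)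
    (hx : x ≠ 1) (hy : y ≠ 1) (hxy : x * y ≠ 1) :
    (algebraMap ℂ F (k : ℂ) - ck k x) * (algebraMap ℂ F (k : ℂ) - ck k y) +
        (algebraMap ℂ F (k : ℂ) - ck k (x * y)) * (algebraMap ℂ F (k : ℂ) - ck k x⁻¹) =
      (algebraMap ℂ F (k : ℂ) - ck k y) * (algebraMap ℂ F (k : ℂ) - ck k (x * y)) := by
  rw [sub_ck k hx, sub_ck k hy, sub_ck k hxy, sub_ck k (inv_ne_one.mpr hx)]
  have h1 : 1 - x ≠ 0 := sub_ne_zero.mpr hx.symm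
  have h2 : 1 - y ≠ 0 := sub_ne_zero.mpr hy.symm
  have h3 : 1 - x * y ≠ 0 := sub_ne_zero.mpr hxy.symm
  have h4 : x - 1 ≠ 0 := sub_ne_zero.mpr hx
  have : 1 - x⁻¹ = (x - 1) / x := by field_simp
  rw [this]
  field_simp
  ring

/-- Here `x`, `y` play the simple roots of a system of type `A_2`. Both sides are expanded into
group elements with coefficients in `ℂ(T)` on the left, and the coefficients are compared. -/
theorem heckeElt_braid {N : ℕ} {q : ℂˣ} (k : ℂˣ) {x y : RatFun N q} {s r : W N}
    (hx0 : x ≠ 0) (hy0 : y ≠ 0) (hx : x ≠ 1) (hy : y ≠ 1) (hxy : x * y ≠ 1)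
    (hsx : s • x = x⁻¹) (hsy : s • y = x * y) (hrx : r • x = x * y) (hry : r • y = y⁻¹)
    (hs : s * s = 1) (hr : r * r = 1) (hsr : s * r * s = r * s * r) :
    heckeElt k x s * heckeElt k y r * heckeElt k x s =
      heckeElt k y r * heckeElt k x s * heckeElt k y r := by
  have hsu : ∀ z : RatFun N q, s • (algebraMap ℂ (RatFun N q) (k : ℂ) - ck k z) =
      algebraMap ℂ (RatFun N q) (k : ℂ) - ck k (s • z) := fun z => by
    rw [smul_sub, smul_algebraMap, smul_ck']
  have hru : ∀ z : RatFun N q, r • (algebraMap ℂ (RatFun N q) (k : ℂ) - ck k z) =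
      algebraMap ℂ (RatFun N q) (k : ℂ) - ck k (r • z) := fun z => by
    rw [smul_sub, smul_algebraMap, smul_ck']
  have hrxy : r • (x * y) = x := by
    rw [smul_mul', hrx, hry, mul_assoc, mul_inv_cancel₀ hy0, mul_one]
  have hsxy : s • (x * y) = y := by
    rw [smul_mul', hsx, hsy, ← mul_assoc, inv_mul_cancel₀ hx0, one_mul]
  have hsr' : s * (r * s) = r * (s * r) := by rw [← mul_assoc, hsr, mul_assoc]
  have e1 := sub_ck_mul_sub_ck k hx0 hx hy hxy
  have e2 := sub_ck_mul_sub_ck k hy0 hy hx (by rwa [mul_comm])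
  rw [mul_comm y x] at e2
  have e3 := ck_add_ck_inv k hx0 hx
  have e4 := ck_add_ck_inv k hy0 hy
  have hab : algebraMap ℂ (RatFun N q) (k : ℂ) * algebraMap ℂ (RatFun N q) ((k⁻¹ : ℂˣ) : ℂ) = 1 := by
    rw [← map_mul, Units.mul_inv, map_one]
  have hT := heckeElt_eq (N := N) (q := q) k
  generalize algebraMap ℂ (RatFun N q) (k : ℂ) = a at *
  generalize algebraMap ℂ (RatFun N q) ((k⁻¹ : ℂˣ) : ℂ) = b at *
  simp only [hT, mul_add, add_mul, SkewMonoidAlgebra.single_mul_single, one_mul, mul_one,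
    one_smul, hsu, hru, smul_ck', hsx, hsy, hrx, hry, mul_smul, hs, hr, mul_assoc, hsr', hrxy,
    hsxy]
  -- The identity coefficient needs both instances of the partial fraction identity and `c_k(z) +
  -- c_k(z⁻¹) = k + k⁻¹`; those of `s` and `r` need one instance each.
  have f0 : SkewMonoidAlgebra.single (1 : W N) ((a - ck k x) * ((a - ck k y) * (a - ck k x))) +
      SkewMonoidAlgebra.single 1 (ck k x * ((a - ck k (x * y)) * ck k x⁻¹)) =
      SkewMonoidAlgebra.single 1 ((a - ck k y) * ((a - ck k x) * (a - ck k y))) +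
      SkewMonoidAlgebra.single 1 (ck k y * ((a - ck k (x * y)) * ck k y⁻¹)) := by
    rw [← SkewMonoidAlgebra.single_add, ← SkewMonoidAlgebra.single_add]
    congr 1
    rw [eq_sub_of_add_eq' e3] at e1 ⊢
    rw [eq_sub_of_add_eq' e4] at e2 ⊢
    linear_combination (a - ck k x) * e1 - (a - ck k y) * e2
  have f1 : SkewMonoidAlgebra.single s (ck k x * ((a - ck k (x * y)) * (a - ck k x⁻¹))) +
      SkewMonoidAlgebra.single s ((a - ck k x) * ((a - ck k y) * ck k x)) =
      SkewMonoidAlgebra.single s ((a - ck k y) * (ck k x * (a - ck k (x * y)))) := by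
    rw [← SkewMonoidAlgebra.single_add]
    congr 1
    linear_combination ck k x * e1
  have f2 : SkewMonoidAlgebra.single r (ck k y * ((a - ck k (x * y)) * (a - ck k y⁻¹))) +
      SkewMonoidAlgebra.single r ((a - ck k y) * ((a - ck k x) * ck k y)) =
      SkewMonoidAlgebra.single r ((a - ck k x) * (ck k y * (a - ck k (x * y)))) := by
    rw [← SkewMonoidAlgebra.single_add]
    congr 1
    linear_combination ck k y * e2
  -- The coefficients of `s r`, `r s` and `s r s` agree up to the order of the factors.
  rw [show ck k x * (ck k (x * y) * (a - ck k y)) = (a - ck k y) * (ck k x * ck k (x * y)) by ring,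
    show (a - ck k x) * (ck k y * ck k (x * y)) = ck k y * (ck k (x * y) * (a - ck k x)) by ring,
    show ck k x * (ck k (x * y) * ck k y) = ck k y * (ck k (x * y) * ck k x) by ring]
  linear_combination (norm := abel) f0 + f1 - f2

/-! ### Relations in the double affine Hecke algebra -/

theorem heckeT_eq_heckeElt {n : ℕ} (k q : ℂˣ) (i : Fin (n + 1)) :
    heckeT k q i = heckeElt k (toRat (xratio i.castSucc i.succ)) (simpleRefl i) := rfl

theorem perm_smul_toRat_xratio {N : ℕ} {q : ℂˣ} (σ : Equiv.Perm (Fin N)) (i j : Fin N) :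
    perm σ • (toRat (xratio i j) : RatFun N q) = toRat (xratio (σ i) (σ j)) := by
  rw [toRat, smul_algebraMap_ratFun, perm_smul_xratio, toRat]

theorem toRat_xratio_mul {N : ℕ} {q : ℂˣ} (i j l : Fin N) :
    (toRat (xratio i j) * toRat (xratio j l) : RatFun N q) = toRat (xratio i l) := by
  rw [toRat, toRat, toRat, ← map_mul, xratio, xratio, xratio, ← map_mul, ← ofAdd_add,
    sub_add_sub_cancel]

theorem heckeT_braid {n : ℕ} (k q : ℂˣ) (i : Fin n) :
    heckeT k q i.castSucc * heckeT k q i.succ * heckeT k q i.castSucc =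
      heckeT k q i.succ * heckeT k q i.castSucc * heckeT k q i.succ := by
  simp only [heckeT_eq_heckeElt]
  rw [← Fin.castSucc_succ]
  have h01 : i.castSucc.castSucc ≠ i.succ.castSucc := by simp [Fin.ext_iff]
  have h12 : i.succ.castSucc ≠ i.succ.succ := by simp [Fin.ext_iff]
  have h02 : i.castSucc.castSucc ≠ i.succ.succ := by simp [Fin.ext_iff]; omega
  refine heckeElt_braid k (toRat_xratio_ne_zero _ _) (toRat_xratio_ne_zero _ _)
    (toRat_xratio_ne_one h01) (toRat_xratio_ne_one h12) ?_ ?_ ?_ ?_ ?_ (simpleRefl_sq _)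
    (simpleRefl_sq _) ?_
  · rw [toRat_xratio_mul]; exact toRat_xratio_ne_one h02
  · rw [simpleRefl, perm_smul_toRat_xratio, ← toRat_xratio_inv]; simp
  · rw [simpleRefl, perm_smul_toRat_xratio, toRat_xratio_mul]
    rw [← Fin.castSucc_succ, Equiv.swap_apply_right,
      Equiv.swap_apply_of_ne_of_ne h02.symm h12.symm]
  · rw [simpleRefl, perm_smul_toRat_xratio, toRat_xratio_mul]
    rw [Equiv.swap_apply_left, Equiv.swap_apply_of_ne_of_ne h01 h02]
  · rw [simpleRefl, perm_smul_toRat_xratio, ← toRat_xratio_inv]; simp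
  · rw [simpleRefl, simpleRefl, ← perm_mul, ← perm_mul, ← perm_mul, ← perm_mul]
    congr 1
    rw [← Fin.castSucc_succ, Equiv.swap_mul_swap_mul_swap h01 h02,
      Equiv.swap_comm i.succ.castSucc i.succ.succ, Equiv.swap_comm i.castSucc.castSucc,
      Equiv.swap_mul_swap_mul_swap h12.symm h02.symm, Equiv.swap_comm]

/-- In `T_i = (k - c) + c s_i` only the second term twists `f`, and the defect is `(k - c)(f - s_i
f)`. In particular `T_i` commutes with the `s_i`-invariant functions. -/
theorem heckeT_mul_ratX {n : ℕ} (k q : ℂˣ) (i : Fin (n + 1)) (f : RatFun (n + 2) q) :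
    heckeT k q i * ratX f = ratX (simpleRefl i • f) * heckeT k q i +
      ratX ((algebraMap ℂ _ (k : ℂ) - ck k (toRat (xratio i.castSucc i.succ))) *
        (f - simpleRefl i • f)) := by
  rw [heckeT_eq_heckeElt, heckeElt_eq, ratX_eq_single, ratX_eq_single, ratX_eq_single]
  simp only [mul_add, add_mul, SkewMonoidAlgebra.single_mul_single, one_smul, one_mul, mul_one]
  have h : ∀ (w : W (n + 2)) (a b c d : RatFun (n + 2) q) (e : RatFun (n + 2) q), a = c + e →
      b = d → (SkewMonoidAlgebra.single 1 a + SkewMonoidAlgebra.single w b : Smash (n + 2) q) =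
      SkewMonoidAlgebra.single 1 c + SkewMonoidAlgebra.single w d +
        SkewMonoidAlgebra.single 1 e := by
    rintro w _ _ c d e rfl rfl
    rw [SkewMonoidAlgebra.single_add]
    abel
  exact h _ _ _ _ _ _ (by ring) (mul_comm _ _)

theorem heckeT_comm {n : ℕ} (k q : ℂˣ) {i j : Fin (n + 1)} (h : i.val + 1 < j.val) :
    heckeT k q i * heckeT k q j = heckeT k q j * heckeT k q i := by
  have h1 : j.castSucc ≠ i.castSucc := by simp [Fin.ext_iff]; omega
  have h2 : j.castSucc ≠ i.succ := by simp [Fin.ext_iff]; omega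
  have h3 : j.succ ≠ i.castSucc := by simp [Fin.ext_iff]; omega
  have h4 : j.succ ≠ i.succ := by simp [Fin.ext_iff]; omega
  have hs : simpleRefl i * simpleRefl j * (simpleRefl i)⁻¹ = simpleRefl j := by
    rw [simpleRefl, simpleRefl, ← perm_mul, ← perm_inv, ← perm_mul]
    congr 1
    rw [← Equiv.swap_apply_apply, Equiv.swap_apply_of_ne_of_ne h1 h2,
      Equiv.swap_apply_of_ne_of_ne h3 h4]
  have hx : simpleRefl i • (toRat (xratio j.castSucc j.succ) : RatFun (n + 2) q) =
      toRat (xratio j.castSucc j.succ) := by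
    rw [simpleRefl, perm_smul_toRat_xratio, Equiv.swap_apply_of_ne_of_ne h1 h2,
      Equiv.swap_apply_of_ne_of_ne h3 h4]
  have hc : simpleRefl j • ck k (toRat (xratio i.castSucc i.succ) : RatFun (n + 2) q) =
      ck k (toRat (xratio i.castSucc i.succ)) := by
    rw [smul_ck', simpleRefl, perm_smul_toRat_xratio, Equiv.swap_apply_of_ne_of_ne h1.symm h3.symm,
      Equiv.swap_apply_of_ne_of_ne h2.symm h4.symm]
  have key : Commute (grp (simpleRefl i)) (heckeT k q j) := by
    rw [commute_iff_eq, heckeT_eq_heckeElt, grp_mul_heckeElt, hx, hs]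
  have key2 : Commute (ratX (ck k (toRat (xratio i.castSucc i.succ)))) (heckeT k q j) := by
    rw [commute_iff_eq, heckeT_mul_ratX, hc, sub_self, mul_zero, map_zero, add_zero]
  have key3 : Commute (algebraMap ℂ _ (k : ℂ)) (heckeT k q j) := Algebra.commutes _ _
  exact (key3.add_left (key2.mul_left (key.sub_left (Commute.one_left _)))).eq

/-- The coordinate function `x_i`. -/
def xcoord {N : ℕ} {q : ℂˣ} (i : Fin N) : Laurent N q :=
  xpow (Multiplicative.ofAdd (Pi.single i 1))

theorem xratio_mul_xcoord {N : ℕ} {q : ℂˣ} (i j : Fin N) :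
    (xratio i j * xcoord j : Laurent N q) = xcoord i := by
  rw [xratio, xcoord, xcoord, ← map_mul, ← ofAdd_add, sub_add_cancel]

theorem perm_smul_xcoord {N : ℕ} {q : ℂˣ} (σ : Equiv.Perm (Fin N)) (i : Fin N) :
    perm σ • (xcoord i : Laurent N q) = xcoord (σ i) := by
  change laurentAct q _ _ = _
  have h : permLattice N (perm σ).right (Multiplicative.ofAdd (Pi.single i 1)) =
      Multiplicative.ofAdd (Pi.single (σ i) 1) := by
    change Multiplicative.ofAdd (fun a => (Pi.single i 1 : Fin N → ℤ) (σ⁻¹ a)) = _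
    congr 1
    funext a
    simp only [Pi.single_apply, Equiv.Perm.inv_eq_iff_eq]
  have h2 : (perm σ).left.toAdd = 0 := rfl
  rw [xcoord, laurentAct_xpow, xcoord, h, h2]
  simp

theorem transl_smul_xcoord {N : ℕ} {q : ℂˣ} (v : Fin N → ℤ) (i : Fin N) :
    transl v • (xcoord i : Laurent N q) = ((q ^ (-v i) : ℂˣ) : ℂ) • xcoord i := by
  change laurentAct q _ _ = _
  have h : permLattice N (transl v).right (Multiplicative.ofAdd (Pi.single i 1)) =
      Multiplicative.ofAdd (Pi.single i 1) := rfl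
  have h2 : (transl v).left.toAdd = v := rfl
  rw [xcoord, laurentAct_xpow, h, h2]
  congr 3
  simp [Pi.single_apply]

theorem piElt_smul_xcoord_castSucc {n : ℕ} {q : ℂˣ} (i : Fin (n + 1)) :
    piElt n • (xcoord i.castSucc : Laurent (n + 2) q) = xcoord i.succ := by
  rw [piElt, mul_smul, transl_smul_xcoord, smul_comm, perm_smul_xcoord, finRotate_apply,
    Fin.coeSucc_eq_succ]
  simp [Fin.castSucc_ne_last]

theorem piElt_smul_xcoord_last {n : ℕ} {q : ℂˣ} :
    piElt n • (xcoord (Fin.last (n + 1)) : Laurent (n + 2) q) =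
      ((q⁻¹ : ℂˣ) : ℂ) • xcoord 0 := by
  rw [piElt, mul_smul, transl_smul_xcoord, smul_comm, perm_smul_xcoord, finRotate_last]
  simp

theorem toRat_xcoord_ne_zero {N : ℕ} {q : ℂˣ} (i : Fin N) : (toRat (xcoord i) : RatFun N q) ≠ 0 := by
  have h : (xcoord i * xpow (Multiplicative.ofAdd (-Pi.single i 1)) : Laurent N q) = 1 := by
    rw [xcoord, ← map_mul, ← ofAdd_add, add_neg_cancel]
    exact map_one _
  intro h0
  have := congrArg (algebraMap (Laurent N q) (RatFun N q)) h
  rw [map_mul, map_one] at this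
  change toRat (xcoord i) * _ = 1 at this
  rw [h0, zero_mul] at this
  exact zero_ne_one this

theorem toRat_xratio {N : ℕ} {q : ℂˣ} (i j : Fin N) :
    (toRat (xratio i j) : RatFun N q) = toRat (xcoord i) / toRat (xcoord j) := by
  rw [eq_div_iff (toRat_xcoord_ne_zero j), toRat, toRat, ← map_mul, xratio_mul_xcoord, toRat]

theorem smul_toRat {N : ℕ} {q : ℂˣ} (w : W N) (f : Laurent N q) :
    w • (toRat f : RatFun N q) = toRat (w • f) := by
  rw [toRat, smul_algebraMap_ratFun, toRat]

theorem grp_piElt_mul_heckeT {n : ℕ} (k q : ℂˣ) (i : Fin n) :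
    grp (piElt n) * heckeT k q i.castSucc = heckeT k q i.succ * grp (piElt n) := by
  have h := pi_conj_affRefl (n := n) i.castSucc.succ
  rw [← Fin.castSucc_succ, Fin.coeSucc_eq_succ, Fin.castSucc_succ] at h
  change _ * simpleRefl i.castSucc * _ = simpleRefl i.succ at h
  rw [heckeT_eq_heckeElt, heckeT_eq_heckeElt, grp_mul_heckeElt, h, toRat_xratio, smul_div₀',
    smul_toRat, smul_toRat, piElt_smul_xcoord_castSucc, ← Fin.castSucc_succ,
    piElt_smul_xcoord_castSucc, ← toRat_xratio]

theorem grp_piElt_sq_mul_heckeT {n : ℕ} (k q : ℂˣ) :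
    grp (piElt n) * grp (piElt n) * heckeT k q (Fin.last n) =
      heckeT k q 0 * (grp (piElt n) * grp (piElt n)) := by
  have h : piElt n * piElt n * simpleRefl (Fin.last n) * (piElt n * piElt n)⁻¹ = simpleRefl 0 := by
    have h := pi_conj_affRefl (n := n) 0
    change piElt n * (piElt n * simpleRefl (Fin.last n) * (piElt n)⁻¹) * _ = _ at h
    rw [zero_add] at h
    refine Eq.trans ?_ h
    group
  -- Applying `π` twice moves `x_{N-1}`, `x_N` to `q⁻¹ x_1`, `q⁻¹ x_2`; the factors cancel in the
  -- ratio.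
  have hx : (piElt n * piElt n) • (toRat (xratio (Fin.last n).castSucc (Fin.last n).succ) :
      RatFun (n + 2) q) = toRat (xratio (0 : Fin (n + 1)).castSucc (0 : Fin (n + 1)).succ) := by
    have e : toRat (((q⁻¹ : ℂˣ) : ℂ) • xcoord 0) =
      algebraMap ℂ (RatFun (n + 2) q) ((q⁻¹ : ℂˣ) : ℂ) * toRat (xcoord 0) := by
      rw [toRat, Algebra.smul_def, map_mul, ← IsScalarTower.algebraMap_apply, toRat]
    have e2 : algebraMap ℂ (RatFun (n + 2) q) ((q⁻¹ : ℂˣ) : ℂ) ≠ 0 := by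
      rw [map_ne_zero]; exact (q⁻¹).ne_zero
    rw [mul_smul, toRat_xratio, smul_div₀', smul_toRat, smul_toRat, piElt_smul_xcoord_castSucc,
      Fin.succ_last, piElt_smul_xcoord_last, smul_div₀', smul_toRat, smul_toRat,
      piElt_smul_xcoord_last, smul_comm, ← Fin.castSucc_zero, piElt_smul_xcoord_castSucc]
    rw [toRat_xratio]
    simp only [toRat, Algebra.smul_def, map_mul, ← IsScalarTower.algebraMap_apply]
    rw [mul_div_mul_left _ _ e2]
  rw [heckeT_eq_heckeElt, heckeT_eq_heckeElt, ← map_mul, grp_mul_heckeElt, h, hx]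

/-- For `f = x_i` the defect `(k - c)(x_i - x_{i+1})` is `(k⁻¹ - k) x_{i+1}`, so `T_i X_i = X_{i+1}
(T_i - k + k⁻¹) = X_{i+1} T_i⁻¹` by the quadratic relation. -/
theorem heckeT_mul_xcoord_mul_heckeT {n : ℕ} (k q : ℂˣ) (i : Fin (n + 1)) :
    heckeT k q i * ratX (toRat (xcoord i.castSucc)) * heckeT k q i = ratX (toRat (xcoord i.succ)) := by
  have h1 : simpleRefl i • (toRat (xcoord i.castSucc) : RatFun (n + 2) q) =
      toRat (xcoord i.succ) := by
    rw [simpleRefl, smul_toRat, perm_smul_xcoord, Equiv.swap_apply_left]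
  have hq := heckeT_quadratic k q i
  have h2 : (algebraMap ℂ _ (k : ℂ) - ck k (toRat (xratio i.castSucc i.succ))) *
      (toRat (xcoord i.castSucc) - toRat (xcoord i.succ) : RatFun (n + 2) q) =
      toRat (xcoord i.succ) * algebraMap ℂ _ (((k⁻¹ : ℂˣ) : ℂ) - k) := by
    rw [sub_ck k (toRat_xratio_ne_one Fin.castSucc_lt_succ.ne), map_sub]
    have h3 := sub_ne_zero.mpr
      (toRat_xratio_ne_one (q := q) (i := i.castSucc) (j := i.succ) Fin.castSucc_lt_succ.ne).symm
    rw [div_mul_eq_mul_div, div_eq_iff h3, toRat_xratio]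
    have := toRat_xcoord_ne_zero (q := q) i.succ
    field_simp
    ring
  rw [heckeT_mul_ratX, h1, h2, map_mul, ← mul_add, mul_assoc]
  have h4 : (heckeT k q i + ratX (algebraMap ℂ _ (((k⁻¹ : ℂˣ) : ℂ) - k))) * heckeT k q i = 1 := by
    rw [← algebraMap_smash, map_sub]
    have hk : algebraMap ℂ (Smash (n + 2) q) (k : ℂ) * algebraMap ℂ _ ((k⁻¹ : ℂˣ) : ℂ) = 1 := by
      rw [← map_mul, Units.mul_inv, map_one]
    have hc := Algebra.commutes ((k⁻¹ : ℂˣ) : ℂ) (heckeT k q i)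
    rw [sub_mul, mul_add, mul_add, hk, ← hc] at hq
    rw [add_mul, sub_mul, ← sub_eq_zero, ← hq]
    abel
  rw [h4, mul_one]

theorem commute_heckeT_xcoord {n : ℕ} (k q : ℂˣ) (i : Fin (n + 1)) (j : Fin (n + 2))
    (h1 : j ≠ i.castSucc) (h2 : j ≠ i.succ) :
    Commute (heckeT k q i) (ratX (toRat (xcoord j))) := by
  have h : simpleRefl i • (toRat (xcoord j) : RatFun (n + 2) q) = toRat (xcoord j) := by
    rw [simpleRefl, smul_toRat, perm_smul_xcoord, Equiv.swap_apply_of_ne_of_ne h1 h2]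
  rw [commute_iff_eq, heckeT_mul_ratX, h, sub_self, mul_zero, map_zero, add_zero]

/-! ### The double affine braid group acting in `ℍ` -/

/-- The extension of a finite family in a group to `ℕ`, by `1`. -/
def natExt {G : Type*} [Group G] {m : ℕ} (f : Fin m → G) (i : ℕ) : G :=
  if h : i < m then f ⟨i, h⟩ else 1

theorem natExt_val {G : Type*} [Group G] {m : ℕ} (f : Fin m → G) (i : Fin m) :
    natExt f i = f i := by
  simp [natExt]

theorem natExt_of_lt {G : Type*} [Group G] {m : ℕ} (f : Fin m → G) {i : ℕ} (h : i < m) :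
    natExt f i = f ⟨i, h⟩ := dif_pos h

theorem prod_reverse_map_finRange {G : Type*} [Group G] {m : ℕ} (f : Fin m → G) :
    ((List.finRange m).reverse.map f).prod = descProd (natExt f) m := by
  have key : ∀ l (hl : l ≤ m),
      ((List.finRange l).reverse.map fun i => f (i.castLE hl)).prod = descProd (natExt f) l := by
    intro l hl
    induction l with
    | zero => rfl
    | succ l ih =>
      rw [List.finRange_succ_last, List.reverse_append, List.map_append, List.prod_append,
        ← List.map_reverse, List.map_map]
      have := ih (by omega)
      rw [descProd, ← this, natExt_of_lt f (by omega : l < m)]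
      simp [Function.comp_def, Fin.last]
  exact key m le_rfl

theorem filter_finRange_lt_succ {m : ℕ} (i : Fin m) :
    (List.finRange m).filter (fun a => a.val < i.val + 1) =
      (List.finRange m).filter (fun a => a.val < i.val) ++ [i] := by
  refine List.Pairwise.eq_of_mem_iff (r := (· < ·))
    ((List.sortedLT_finRange m).pairwise.filter _) ?_ fun a => ?_
  · rw [List.pairwise_append]
    refine ⟨(List.sortedLT_finRange m).pairwise.filter _, by simp, fun a ha b hb => ?_⟩
    simp only [List.mem_filter, List.mem_singleton, decide_eq_true_eq] at ha hb
    rw [hb]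
    exact ha.2
  · simp only [List.mem_filter, List.mem_finRange, true_and, decide_eq_true_eq, List.mem_append,
      List.mem_singleton, Fin.ext_iff]
    omega

theorem filter_finRange_le {m : ℕ} (i : Fin m) :
    (List.finRange m).filter (fun a => i.val ≤ a.val) =
      i :: (List.finRange m).filter (fun a => i.val + 1 ≤ a.val) := by
  refine List.Pairwise.eq_of_mem_iff (r := (· < ·))
    ((List.sortedLT_finRange m).pairwise.filter _) ?_ fun a => ?_
  · rw [List.pairwise_cons]
    refine ⟨fun b hb => ?_, (List.sortedLT_finRange m).pairwise.filter _⟩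
    simp only [List.mem_filter, decide_eq_true_eq] at hb
    exact hb.2
  · simp only [List.mem_filter, List.mem_finRange, true_and, decide_eq_true_eq, List.mem_cons,
      Fin.ext_iff]
    omega

variable {n : ℕ} {k q : ℂˣ}

theorem unitY_zero : (unitY 0 : (DAHA n k q)ˣ) =
    unitPi * descProd (natExt unitT) (n + 1) := by
  rw [unitY, ← prod_reverse_map_finRange]
  simp

/-- Passing from `Y_i` to `Y_{i+1}` removes `T_i` from the right-hand product and adds `T_i⁻¹` to
the left-hand one. -/
theorem unitY_succ (i : Fin (n + 1)) : (unitY i.succ : (DAHA n k q)ˣ) =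
    (unitT i)⁻¹ * unitY i.castSucc * (unitT i)⁻¹ := by
  have h1 : ((List.finRange (n + 1)).filter fun a => a.val < i.succ.val) = _ :=
    filter_finRange_lt_succ i
  have h2 : ((List.finRange (n + 1)).filter fun a => i.castSucc.val ≤ a.val) = _ :=
    filter_finRange_le i
  rw [unitY, unitY, h1, h2]
  simp only [List.reverse_append, List.reverse_cons, List.map_append, List.prod_append,
    List.map_cons, List.map_nil, List.prod_cons, List.prod_nil, List.reverse_nil, List.nil_append,
    Fin.val_succ, Fin.val_castSucc, mul_one, List.singleton_append, mul_assoc, mul_inv_cancel]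

/-- `f ↦ f(X)` as an algebra homomorphism. -/
def opXHom : Laurent (n + 2) q →ₐ[ℂ] DAHA n k q where
  toFun := opX
  map_one' := Subtype.ext (by change ratX (toRat 1) = 1; simp [toRat])
  map_mul' f g := Subtype.ext (by
    change ratX (toRat (f * g)) = ratX (toRat f) * ratX (toRat g); simp [toRat])
  map_zero' := Subtype.ext (by change ratX (toRat 0) = 0; simp [toRat])
  map_add' f g := Subtype.ext (by
    change ratX (toRat (f + g)) = ratX (toRat f) + ratX (toRat g); simp [toRat])
  commutes' c := Subtype.ext (by
    change ratX (toRat (algebraMap ℂ _ c)) = algebraMap ℂ (Smash (n + 2) q) c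
    rw [algebraMap_smash, toRat, ← IsScalarTower.algebraMap_apply])

theorem opXHom_apply (f : Laurent (n + 2) q) : (opXHom f : DAHA n k q) = opX f := rfl

/-- `X_i` as an invertible element of `ℍ`. -/
def unitX (i : Fin (n + 2)) : (DAHA n k q)ˣ :=
  Units.map (opXHom (k := k)).toRingHom.toMonoidHom
    (Units.map xpow (toUnits (Multiplicative.ofAdd (Pi.single i 1))))

theorem val_unitX (i : Fin (n + 2)) : ((unitX i : (DAHA n k q)ˣ) : DAHA n k q) = opX (xcoord i) :=
  rfl

theorem unit_ext {a b : (DAHA n k q)ˣ} (h : ((a : DAHA n k q) : Smash (n + 2) q) = (b : DAHA n k q)) :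
    a = b := Units.ext (Subtype.ext h)

/-- The scalars `ℂ^×` in `ℍ^×`. -/
def unitScalar : ℂˣ →* (DAHA n k q)ˣ :=
  Units.map (algebraMap ℂ (DAHA n k q)).toMonoidHom

/-- The bridge from the abstract group relations to `ℍ`. The central element is `q⁻¹` because `π`
sends `x_N` to `q⁻¹ x_1`. -/
theorem isDoubleAffineBraid : IsDoubleAffineBraid (n + 1) (natExt unitT)
    (natExt unitX) (natExt unitY) (unitPi : (DAHA n k q)ˣ) (unitScalar q⁻¹) where
  braid i hi := by
    rw [natExt_of_lt _ (by omega : i < n + 1), natExt_of_lt _ hi]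
    exact unit_ext (heckeT_braid k q ⟨i, by omega⟩)
  comm i j hij hj := by
    rw [natExt_of_lt _ (by omega : i < n + 1), natExt_of_lt _ hj]
    exact unit_ext (heckeT_comm k q hij)
  pi_mul i hi := by
    rw [natExt_of_lt _ (by omega : i < n + 1), natExt_of_lt _ hi]
    exact unit_ext (grp_piElt_mul_heckeT k q ⟨i, by omega⟩)
  pi_sq := by
    rw [natExt_of_lt _ (by omega : n + 1 - 1 < n + 1), natExt_of_lt _ (by omega : 0 < n + 1)]
    exact unit_ext (grp_piElt_sq_mul_heckeT k q)
  pos := by omega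
  y_zero := by
    rw [natExt_of_lt _ (by omega : 0 < n + 2)]
    exact unitY_zero
  y_succ j hj := by
    rw [natExt_of_lt _ hj, natExt_of_lt _ (by omega : j < n + 2),
      natExt_of_lt _ (by omega : j + 1 < n + 2)]
    exact unitY_succ ⟨j, hj⟩
  x_succ j hj := by
    rw [natExt_of_lt _ hj, natExt_of_lt _ (by omega : j < n + 2),
      natExt_of_lt _ (by omega : j + 1 < n + 2)]
    exact unit_ext (heckeT_mul_xcoord_mul_heckeT k q ⟨j, hj⟩).symm
  comm_x i j hi hj h1 h2 := by
    rw [natExt_of_lt _ hi, natExt_of_lt _ (by omega : j < n + 2)]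
    exact unit_ext (commute_heckeT_xcoord k q ⟨i, hi⟩ ⟨j, by omega⟩
      (by simpa [Fin.ext_iff] using h1) (by simpa [Fin.ext_iff] using h2))
  pi_x j hj := by
    rw [natExt_of_lt _ (by omega : j < n + 2), natExt_of_lt _ (by omega : j + 1 < n + 2)]
    refine unit_ext ?_
    change grp (piElt n) * ratX (toRat (xcoord (Fin.castSucc ⟨j, hj⟩))) =
      ratX (toRat (xcoord (Fin.succ ⟨j, hj⟩))) * grp (piElt n)
    rw [grp_mul_ratX, smul_toRat, piElt_smul_xcoord_castSucc]
  pi_x_last := by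
    rw [natExt_of_lt _ (by omega : n + 1 < n + 2), natExt_of_lt _ (by omega : 0 < n + 2)]
    refine unit_ext ?_
    change grp (piElt n) * ratX (toRat (xcoord (Fin.last (n + 1)))) =
      algebraMap ℂ (Smash (n + 2) q) ((q⁻¹ : ℂˣ) : ℂ) * ratX (toRat (xcoord 0)) * grp (piElt n)
    rw [grp_mul_ratX, smul_toRat, piElt_smul_xcoord_last, algebraMap_smash, ← map_mul, toRat,
      Algebra.smul_def, map_mul, ← IsScalarTower.algebraMap_apply, toRat]
  central g := Units.ext (Algebra.commutes _ _)

theorem commute_unitY (i j : Fin (n + 2)) : Commute (unitY i : (DAHA n k q)ˣ) (unitY j) := by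
  have h := (isDoubleAffineBraid (n := n) (k := k) (q := q)).commute_y
    (i := i.val) (j := j.val) (by omega) (by omega)
  rwa [natExt_val, natExt_val] at h

theorem commute_unitT_unitY (i : Fin (n + 1)) (j : Fin (n + 2)) (h1 : j ≠ i.castSucc)
    (h2 : j ≠ i.succ) : Commute (unitT i : (DAHA n k q)ˣ) (unitY j) := by
  have h := (isDoubleAffineBraid (n := n) (k := k) (q := q)).commute_t_y
    (i := i.val) (j := j.val) (by omega) (by omega)
    (by simpa [Fin.ext_iff] using h1) (by simpa [Fin.ext_iff] using h2)
  rwa [natExt_val, natExt_val] at h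

/-- The product of `Y_i^{v_i}`, as a homomorphism. -/
def unitYHom : Multiplicative (Fin (n + 2) → ℤ) →* (DAHA n k q)ˣ where
  toFun v := ((List.finRange (n + 2)).map fun j => unitY j ^ v.toAdd j).prod
  map_one' := by simp
  map_mul' v w := by
    have key : ∀ l : List (Fin (n + 2)),
        (l.map fun j => (unitY j : (DAHA n k q)ˣ) ^ (v * w).toAdd j).prod =
          (l.map fun j => unitY j ^ v.toAdd j).prod * (l.map fun j => unitY j ^ w.toAdd j).prod := by
      intro l
      induction l with
      | nil => simp
      | cons j l ih =>
        have hc : Commute ((unitY j : (DAHA n k q)ˣ) ^ w.toAdd j)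
            (l.map fun j => unitY j ^ v.toAdd j).prod := by
          refine Commute.list_prod_right _ _ fun a ha => ?_
          obtain ⟨i, _, rfl⟩ := List.mem_map.mp ha
          exact ((commute_unitY j i).zpow_left _).zpow_right _
        rw [List.map_cons, List.prod_cons, ih, toAdd_mul, Pi.add_apply, zpow_add, mul_assoc,
          ← mul_assoc (unitY j ^ w.toAdd j), hc.eq]
        simp only [List.map_cons, List.prod_cons, mul_assoc]
    exact key _

theorem unitYHom_single (i : Fin (n + 2)) :
    unitYHom (Multiplicative.ofAdd (Pi.single i 1)) = (unitY i : (DAHA n k q)ˣ) := by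
  change ((List.finRange (n + 2)).map fun j => (unitY j : (DAHA n k q)ˣ) ^
    (Pi.single i 1 : Fin (n + 2) → ℤ) j).prod = _
  rw [List.prod_map_eq_pow_single i]
  · rw [List.count_eq_one_of_mem (List.nodup_finRange _) (List.mem_finRange _)]
    simp
  · intro j hj _
    simp [Pi.single_eq_of_ne hj]

theorem Ypow_eq (v : Fin (n + 2) → ℤ) :
    (Ypow v : DAHA n k q) = (unitYHom (Multiplicative.ofAdd v) : (DAHA n k q)ˣ) := rfl

theorem Ypow_add (v w : Fin (n + 2) → ℤ) : (Ypow (v + w) : DAHA n k q) = Ypow v * Ypow w := by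
  rw [Ypow_eq, Ypow_eq, Ypow_eq, ofAdd_add, map_mul, Units.val_mul]

theorem Ypow_zero : (Ypow 0 : DAHA n k q) = 1 := by
  rw [Ypow_eq, ofAdd_zero, map_one, Units.val_one]

theorem Ypow_single (i : Fin (n + 2)) : (Ypow (Pi.single i 1) : DAHA n k q) = (unitY i : (DAHA n k q)ˣ) := by
  rw [Ypow_eq, unitYHom_single]

/-- `f ↦ f(Y)` as an algebra homomorphism. -/
def opYHom : Laurent (n + 2) q →ₐ[ℂ] DAHA n k q :=
  Laurent.lift ((Units.coeHom _).comp unitYHom)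

theorem opYHom_apply (f : Laurent (n + 2) q) : (opYHom f : DAHA n k q) = opY f := by
  exact AddMonoidAlgebra.lift_apply (R := ℂ) (M := Fin (n + 2) → ℤ) (A := DAHA n k q) _ f

theorem opYHom_xpow (v : Multiplicative (Fin (n + 2) → ℤ)) :
    (opYHom (xpow v) : DAHA n k q) = Ypow v.toAdd :=
  Laurent.lift_xpow _ _

/-! ### Bernstein relations -/

theorem simpleRefl_smul_xcoord_castSucc (i : Fin (n + 1)) :
    simpleRefl i • (xcoord i.castSucc : Laurent (n + 2) q) = xcoord i.succ := by
  rw [simpleRefl, perm_smul_xcoord, Equiv.swap_apply_left]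

theorem simpleRefl_smul_xcoord_succ (i : Fin (n + 1)) :
    simpleRefl i • (xcoord i.succ : Laurent (n + 2) q) = xcoord i.castSucc := by
  rw [simpleRefl, perm_smul_xcoord, Equiv.swap_apply_right]

theorem simpleRefl_smul_xcoord_of_ne (i : Fin (n + 1)) {j : Fin (n + 2)} (h1 : j ≠ i.castSucc)
    (h2 : j ≠ i.succ) : simpleRefl i • (xcoord j : Laurent (n + 2) q) = xcoord j := by
  rw [simpleRefl, perm_smul_xcoord, Equiv.swap_apply_of_ne_of_ne h1 h2]

theorem diamondFun_xpow {N : ℕ} (v : Multiplicative (Fin N → ℤ)) :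
    diamondFun (xpow v : Laurent N q) = xpow v⁻¹ := by
  rw [diamondFun, Laurent.lift_xpow]
  rfl

theorem diamondFun_diamondFun {N : ℕ} (f : Laurent N q) : diamondFun (diamondFun f) = f := by
  change (diamondFun.comp diamondFun) f = AlgHom.id ℂ _ f
  congr 1
  refine Laurent.algHom_ext fun v => ?_
  rw [AlgHom.comp_apply, diamondFun_xpow, diamondFun_xpow, inv_inv]
  rfl

/-- Reduces relations compatible with products to the coordinate functions; negative exponents are
covered by closure under inverses, so no relation for `x_i⁻¹` has to be found. -/
theorem Laurent.induction_xcoord {N : ℕ} {P : Laurent N q → Prop} (hx : ∀ i, P (xcoord i))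
    (hone : P 1) (hmul : ∀ f g, P f → P g → P (f * g)) (hinv : ∀ f g, f * g = 1 → P f → P g)
    (hadd : ∀ f g, P f → P g → P (f + g)) (hsmul : ∀ (c : ℂ) f, P f → P (c • f))
    (f : Laurent N q) : P f := by
  refine Laurent.induction (fun v => ?_) hadd hsmul f
  have hv : v.toAdd ∈ AddSubgroup.closure
      (Set.range fun i : Fin N => Pi.single (M := fun _ => ℤ) i 1) := by
    have : v.toAdd = ∑ i, v.toAdd i • (Pi.single i 1 : Fin N → ℤ) := by
      funext a
      simp [Finset.sum_apply, Pi.single_apply]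
    rw [this]
    exact sum_mem fun i _ => zsmul_mem (AddSubgroup.subset_closure (Set.mem_range_self i)) _
  suffices ∀ u ∈ AddSubgroup.closure (Set.range fun i : Fin N => Pi.single (M := fun _ => ℤ) i 1),
      P (xpow (Multiplicative.ofAdd u)) from this _ hv
  intro u hu
  induction hu using AddSubgroup.closure_induction with
  | mem u hu =>
    obtain ⟨j, rfl⟩ := hu
    exact hx j
  | zero => rwa [ofAdd_zero, map_one]
  | add u v _ _ hu hv =>
    rw [ofAdd_add, map_mul]
    exact hmul _ _ hu hv
  | neg u _ hu =>
    refine hinv _ _ ?_ hu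
    rw [← map_mul, ← ofAdd_add, add_neg_cancel, ofAdd_zero, map_one]

theorem opYHom_diamondFun_xcoord (i : Fin (n + 2)) :
    (opYHom (diamondFun (xcoord i)) : DAHA n k q) = ((unitY i)⁻¹ : (DAHA n k q)ˣ) := by
  rw [xcoord, diamondFun_xpow, opYHom, Laurent.lift_xpow, MonoidHom.comp_apply, map_inv,
    unitYHom_single]
  rfl

/-- The simultaneous Bernstein relations for `f(X)` and `f^◇(Y)`, with the same error term. -/
def BernsteinRel (k : ℂˣ) (i : Fin (n + 1)) (f f' g : Laurent (n + 2) q) : Prop :=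
  (genT i * opXHom f : DAHA n k q) = opXHom f' * genT i + opXHom g ∧
    (opYHom (diamondFun f) * genT i : DAHA n k q) =
      genT i * opYHom (diamondFun f') + opYHom (diamondFun g)

/-- Two successive crossings of `T_i` give the error `f' d + g e`. In `Y` the factors are crossed in
the opposite order, and commutativity of `ℂ[T]` makes the two errors match. -/
theorem BernsteinRel.mul {i : Fin (n + 1)} {f f' g e e' d : Laurent (n + 2) q}
    (h : BernsteinRel k i f f' g) (h' : BernsteinRel k i e e' d) :
    BernsteinRel k i (f * e) (f' * e') (f' * d + g * e) := by
  refine ⟨?_, ?_⟩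
  · rw [map_mul, ← mul_assoc, h.1, add_mul, mul_assoc, h'.1]
    simp only [map_mul, map_add]
    noncomm_ring
  · rw [mul_comm f e, map_mul, map_mul, mul_assoc, h.2, mul_add, ← mul_assoc, h'.2, mul_comm f' e',
      mul_comm g e, mul_comm f' d]
    simp only [map_mul, map_add]
    noncomm_ring

/-- Multiply `T f = f' T + g` by `f'⁻¹` on the left and `f⁻¹` on the right, and symmetrically in
`Y`. -/
theorem BernsteinRel.inv {i : Fin (n + 1)} {f f' g e e' : Laurent (n + 2) q}
    (h : BernsteinRel k i f f' g) (he : f * e = 1) (he' : f' * e' = 1) :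
    BernsteinRel k i e e' (-(e' * g * e)) := by
  have a1 : (opXHom e' * opXHom f' : DAHA n k q) = 1 := by rw [← map_mul, mul_comm, he', map_one]
  have a2 : (opXHom f * opXHom e : DAHA n k q) = 1 := by rw [← map_mul, he, map_one]
  have a3 : (opYHom (diamondFun e) * opYHom (diamondFun f) : DAHA n k q) = 1 := by
    rw [← map_mul, ← map_mul, mul_comm, he, map_one, map_one]
  have a4 : (opYHom (diamondFun f') * opYHom (diamondFun e') : DAHA n k q) = 1 := by
    rw [← map_mul, ← map_mul, he', map_one, map_one]
  refine ⟨?_, ?_⟩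
  · have := congrArg (fun x : DAHA n k q => opXHom e' * x * opXHom e) h.1
    beta_reduce at this
    rw [mul_add, add_mul, ← mul_assoc, mul_assoc _ (opXHom f) (opXHom e), a2, mul_one,
      ← mul_assoc (opXHom e') (opXHom f'), a1, one_mul] at this
    rw [this]
    simp only [map_neg, map_mul]
    noncomm_ring
  · have := congrArg (fun x : DAHA n k q => opYHom (diamondFun e) * x * opYHom (diamondFun e')) h.2
    beta_reduce at this
    rw [mul_add, add_mul, ← mul_assoc (opYHom (diamondFun e)), a3, one_mul, mul_assoc,
      mul_assoc, a4, mul_one] at this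
    rw [this, mul_comm e' g, mul_assoc, mul_comm (g * e') e]
    simp only [map_neg, map_mul]
    abel

theorem unitX_succ (i : Fin (n + 1)) :
    (unitX i.succ : (DAHA n k q)ˣ) = unitT i * unitX i.castSucc * unitT i := by
  have := (isDoubleAffineBraid (n := n) (k := k) (q := q)).x_succ i.val i.isLt
  rw [natExt_val, natExt_of_lt _ (by omega : i.val < n + 2),
    natExt_of_lt _ (by omega : i.val + 1 < n + 2)] at this
  exact this

/-! ### The relation `a' = t a t` with `t⁻¹ = t - c`, read from both sides -/

section

variable {R : Type*} [Ring R] {c : R} {t a a' : Rˣ}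

/-- One factor `t` of `t a t` is moved across as `t⁻¹ = t - c`. This lemma and its three variants
serve `X_{i+1} = T_i X_i T_i` as well as `Y_{i+1}⁻¹ = T_i Y_i⁻¹ T_i`, with `c = k - k⁻¹`. -/
theorem unit_mul_eq_sub (hc : ∀ x, c * x = x * c) (ht : ((t⁻¹ : Rˣ) : R) = t - c)
    (h : a' = t * a * t) : (t * a : R) = a' * t + -(c * a') := by
  have : t * a = a' * t⁻¹ := by rw [h]; group
  rw [← Units.val_mul, this, Units.val_mul, ht, hc]
  noncomm_ring

theorem unit_mul_eq_add (ht : ((t⁻¹ : Rˣ) : R) = t - c)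
    (h : a' = t * a * t) : (t * a' : R) = a * t + c * a' := by
  have : a * t = t⁻¹ * a' := by rw [h]; group
  rw [← Units.val_mul a, this, Units.val_mul, ht]
  noncomm_ring

theorem mul_unit_eq_sub (ht : ((t⁻¹ : Rˣ) : R) = t - c)
    (h : a' = t * a * t) : (a * t : R) = t * a' + -(c * a') := by
  rw [unit_mul_eq_add ht h]
  abel

theorem mul_unit_eq_add (hc : ∀ x, c * x = x * c) (ht : ((t⁻¹ : Rˣ) : R) = t - c)
    (h : a' = t * a * t) : (a' * t : R) = t * a + c * a' := by
  rw [unit_mul_eq_sub hc ht h]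
  abel

end

theorem unitY_succ_inv (i : Fin (n + 1)) : ((unitY i.succ)⁻¹ : (DAHA n k q)ˣ) =
    unitT i * (unitY i.castSucc)⁻¹ * unitT i := by
  rw [unitY_succ]
  group

/-- The pairs `X_i, X_{i+1}` and `Y_i⁻¹, Y_{i+1}⁻¹` satisfy the same recursion, so the same error
term, `∓(k - k⁻¹) x_{i+1}` or `0`, works for both. -/
theorem bernsteinRel_xcoord (i : Fin (n + 1)) (j : Fin (n + 2)) :
    ∃ g, BernsteinRel k i (xcoord j : Laurent (n + 2) q) (simpleRefl i • xcoord j) g := by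
  set c : DAHA n k q := algebraMap ℂ _ ((k : ℂ) - ((k⁻¹ : ℂˣ) : ℂ)) with hc
  have hTi : (((unitT i)⁻¹ : (DAHA n k q)ˣ) : DAHA n k q) = (unitT i : (DAHA n k q)ˣ) - c := by
    change genT i - _ + _ = genT i - c
    rw [hc, map_sub]
    abel
  have hcX : ∀ f : Laurent (n + 2) q, (opXHom (((k : ℂ) - ((k⁻¹ : ℂˣ) : ℂ)) • f) : DAHA n k q) =
      c * opXHom f := fun f => by rw [map_smul, Algebra.smul_def]
  have hcY : ∀ f : Laurent (n + 2) q, (opYHom (diamondFun (((k : ℂ) - ((k⁻¹ : ℂˣ) : ℂ)) • f)) :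
      DAHA n k q) = c * opYHom (diamondFun f) := fun f => by
    rw [map_smul, map_smul, Algebra.smul_def]
  have hX : ∀ j, (opXHom (xcoord j) : DAHA n k q) = (unitX j : (DAHA n k q)ˣ) := fun _ => rfl
  have hT : (genT i : DAHA n k q) = (unitT i : (DAHA n k q)ˣ) := rfl
  have hcc : ∀ x : DAHA n k q, c * x = x * c := Algebra.commutes _
  have hxs := unitX_succ (k := k) (q := q) i
  have hys := unitY_succ_inv (k := k) (q := q) i
  by_cases h1 : j = i.castSucc
  · subst h1
    rw [simpleRefl_smul_xcoord_castSucc]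
    refine ⟨-(((k : ℂ) - ((k⁻¹ : ℂˣ) : ℂ)) • xcoord i.succ), ?_, ?_⟩
    · rw [map_neg, hcX, hX, hX, hT]
      exact unit_mul_eq_sub hcc hTi hxs
    · rw [map_neg, map_neg, hcY, opYHom_diamondFun_xcoord, opYHom_diamondFun_xcoord, hT]
      exact mul_unit_eq_sub hTi hys
  · by_cases h2 : j = i.succ
    · subst h2
      rw [simpleRefl_smul_xcoord_succ]
      refine ⟨((k : ℂ) - ((k⁻¹ : ℂˣ) : ℂ)) • xcoord i.succ, ?_, ?_⟩
      · rw [hcX, hX, hX, hT]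
        exact unit_mul_eq_add hTi hxs
      · rw [hcY, opYHom_diamondFun_xcoord, opYHom_diamondFun_xcoord, hT]
        exact mul_unit_eq_add hcc hTi hys
    · rw [simpleRefl_smul_xcoord_of_ne i h1 h2]
      refine ⟨0, ?_, ?_⟩
      · rw [map_zero, add_zero]
        exact Subtype.ext (commute_heckeT_xcoord k q i j h1 h2).eq
      · rw [map_zero, map_zero, add_zero, opYHom_diamondFun_xcoord, hT, ← Units.val_mul,
          ← Units.val_mul, (commute_unitT_unitY i j h1 h2).inv_right.eq]

/-- The form of `g` is irrelevant later. What counts is that one `g` serves both relations, since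
this makes `*` exchange them. -/
theorem exists_bernsteinRel (k : ℂˣ) (i : Fin (n + 1)) (f : Laurent (n + 2) q) :
    ∃ g, BernsteinRel k i f (simpleRefl i • f) g := by
  induction f using Laurent.induction_xcoord with
  | hx j => exact bernsteinRel_xcoord i j
  | hone => refine ⟨0, ?_, ?_⟩ <;> simp
  | hmul f e hf he =>
    obtain ⟨g, hg⟩ := hf
    obtain ⟨d, hd⟩ := he
    rw [smul_mul']
    exact ⟨_, hg.mul hd⟩
  | hinv f e hfe hf =>
    obtain ⟨g, hg⟩ := hf
    exact ⟨_, hg.inv hfe (by rw [← smul_mul', hfe, smul_one])⟩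
  | hadd f e hf he =>
    obtain ⟨g, hg⟩ := hf
    obtain ⟨d, hd⟩ := he
    refine ⟨g + d, ?_, ?_⟩
    · rw [smul_add, map_add, mul_add, hg.1, hd.1, map_add, map_add, add_mul]
      abel
    · simp only [smul_add, map_add, mul_add, add_mul, hg.2, hd.2]
      abel
  | hsmul c f hf =>
    obtain ⟨g, hg⟩ := hf
    refine ⟨c • g, ?_, ?_⟩
    · rw [smul_comm, map_smul opXHom c, map_smul opXHom c, map_smul opXHom c, mul_smul_comm, hg.1,
        smul_add, smul_mul_assoc]
    · rw [smul_comm]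
      simp only [map_smul, smul_mul_assoc, mul_smul_comm, hg.2, smul_add]

/-! ### Relations with the element dual to `π` -/

/-- The element of `ℍ^×` dual to `π`. -/
def unitDualPi : (DAHA n k q)ˣ := dualPi (n + 1) (natExt unitT) (natExt unitX)

theorem unitDualPi_mul_unitY_succ (i : Fin (n + 1)) :
    unitDualPi * unitY i.succ = (unitY i.castSucc * unitDualPi : (DAHA n k q)ˣ) := by
  have := (isDoubleAffineBraid (n := n) (k := k) (q := q)).dualPi_mul_y_succ i.isLt
  rw [natExt_of_lt _ (by omega : i.val < n + 2), natExt_of_lt _ (by omega : i.val + 1 < n + 2)]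
    at this
  exact this

theorem unitDualPi_mul_unitY_zero :
    unitDualPi * unitY 0 =
      (unitScalar q⁻¹ * unitY (Fin.last (n + 1)) * unitDualPi : (DAHA n k q)ˣ) := by
  have := (isDoubleAffineBraid (n := n) (k := k) (q := q)).dualPi_mul_y_zero
  rw [natExt_of_lt _ (by omega : n + 1 < n + 2), natExt_of_lt _ (by omega : 0 < n + 2)] at this
  exact this

theorem unitDualPi_eq : (unitDualPi : (DAHA n k q)ˣ) =
    (ascProd (natExt unitT) (n + 1))⁻¹ * (unitX 0)⁻¹ := by
  rw [unitDualPi, dualPi, natExt_of_lt unitX (by omega : 0 < n + 2)]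
  rfl

/-- The relation dual to `π f(X) = (π f)(X) π`. -/
theorem opYHom_diamondFun_mul_unitDualPi (f : Laurent (n + 2) q) :
    opYHom (diamondFun f) * ((unitDualPi : (DAHA n k q)ˣ) : DAHA n k q) =
      ((unitDualPi : (DAHA n k q)ˣ) : DAHA n k q) * opYHom (diamondFun (piElt n • f)) := by
  induction f using Laurent.induction_xcoord with
  | hx i =>
    refine Fin.lastCases ?_ (fun i => ?_) i
    · rw [piElt_smul_xcoord_last, map_smul, map_smul, opYHom_diamondFun_xcoord,
        opYHom_diamondFun_xcoord, Algebra.smul_def]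
      have h : (unitY (Fin.last (n + 1)))⁻¹ * unitDualPi =
          (unitDualPi * (unitScalar q⁻¹ * (unitY 0)⁻¹) : (DAHA n k q)ˣ) := by
        have h1 := unitDualPi_mul_unitY_zero (n := n) (k := k) (q := q)
        have h2 := (isDoubleAffineBraid (n := n) (k := k) (q := q)).central
        rw [inv_mul_eq_iff_eq_mul, ← mul_assoc, ← mul_assoc, eq_mul_inv_iff_mul_eq, h1,
          mul_assoc (unitScalar q⁻¹), (h2 _).eq]
      exact congrArg Units.val h
    · rw [piElt_smul_xcoord_castSucc, opYHom_diamondFun_xcoord, opYHom_diamondFun_xcoord]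
      have h : (unitY i.castSucc)⁻¹ * unitDualPi = (unitDualPi * (unitY i.succ)⁻¹ :
          (DAHA n k q)ˣ) := by
        rw [inv_mul_eq_iff_eq_mul, ← mul_assoc, eq_mul_inv_iff_mul_eq, unitDualPi_mul_unitY_succ]
      exact congrArg Units.val h
  | hone => simp
  | hmul f g hf hg =>
    rw [smul_mul', map_mul, map_mul, map_mul, map_mul, mul_assoc, hg, ← mul_assoc, hf, mul_assoc]
  | hinv f g hfg hf =>
    have a1 : (opYHom (diamondFun g) * opYHom (diamondFun f) : DAHA n k q) = 1 := by
      rw [← map_mul, ← map_mul, mul_comm, hfg, map_one, map_one]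
    have a2 : (opYHom (diamondFun (piElt n • f)) * opYHom (diamondFun (piElt n • g)) :
        DAHA n k q) = 1 := by
      rw [← map_mul, ← map_mul, ← smul_mul', hfg, smul_one, map_one, map_one]
    have := congrArg (fun x : DAHA n k q => opYHom (diamondFun g) * x *
      opYHom (diamondFun (piElt n • g))) hf
    beta_reduce at this
    rw [← mul_assoc (opYHom (diamondFun g)), a1, one_mul, mul_assoc, mul_assoc, a2, mul_one] at this
    exact this.symm
  | hadd f g hf hg => simp only [smul_add, map_add, add_mul, mul_add, hf, hg]
  | hsmul c f hf =>
    rw [smul_comm]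
    simp only [map_smul diamondFun c, map_smul opYHom c, smul_mul_assoc, mul_smul_comm, hf]

/-! ### The dimension of the finite Hecke algebra -/

/-- A quotient of the Hecke algebra with `m` generators is spanned by `(m + 1)!` elements. -/
theorem exists_span_adjoin {R : Type*} [Ring R] [Algebra ℂ R] {m : ℕ} {t : ℕ → Rˣ}
    (ht : IsBraid m t) (c : ℂ) (hq : ∀ i, i < m → (t i * t i : R) = 1 + c • (t i : R)) (l : ℕ)
    (hl : l ≤ m) : ∃ s : Finset R, s.card ≤ (l + 1).factorial ∧
      Subalgebra.toSubmodule (Algebra.adjoin ℂ ((fun i => (t i : R)) '' Set.Iio l)) ≤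
        Submodule.span ℂ (s : Set R) := by
  classical
  induction l with
  | zero =>
    refine ⟨{1}, by simp, ?_⟩
    have : (fun i => (t i : R)) '' Set.Iio 0 = ∅ := by simp
    rw [this, Algebra.adjoin_empty, Algebra.toSubmodule_bot, Submodule.one_eq_span]
    simp
  | succ l ih =>
    obtain ⟨s, hs, hspan⟩ := ih (by omega)
    set A := Algebra.adjoin ℂ ((fun i => (t i : R)) '' Set.Iio l) with hA
    -- `d j = t_l ⋯ t_j`, with `d (l + 1) = 1`: the `l + 2` minimal representatives of the right
    -- cosets of `S_{l+1}` in `S_{l+2}`.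
    let d : ℕ → R := fun j => ((descProd t (l + 1) * (descProd t j)⁻¹ : Rˣ) : R)
    refine ⟨Finset.image₂ (· * ·) s ((Finset.range (l + 2)).image d), ?_, ?_⟩
    · refine (Finset.card_image₂_le _ _ _).trans ?_
      refine (Nat.mul_le_mul hs (Finset.card_image_le)).trans ?_
      rw [Finset.card_range, Nat.factorial_succ (l + 1), mul_comm]
    · set P := Submodule.span ℂ
        ((Finset.image₂ (· * ·) s ((Finset.range (l + 2)).image d) : Finset R) : Set R) with hP
      have hsP : ∀ j, j ≤ l + 1 → ∀ a ∈ Submodule.span ℂ (s : Set R), a * d j ∈ P := by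
        intro j hj a ha
        induction ha using Submodule.span_induction with
        | mem x hx =>
          refine Submodule.subset_span ?_
          rw [Finset.mem_coe]
          exact Finset.mem_image₂_of_mem hx
            (Finset.mem_image_of_mem _ (Finset.mem_range.mpr (by omega)))
        | zero => rw [zero_mul]; exact zero_mem _
        | add x y _ _ hx hy => rw [add_mul]; exact add_mem hx hy
        | smul c x _ hx => rw [smul_mul_assoc]; exact Submodule.smul_mem _ _ hx
      -- Stability is shown with coefficients in the algebra `A`, which is closed under products,
      -- and only then transferred to the finite spanning set.
      set P' := Submodule.span ℂ {x : R | ∃ a ∈ A, ∃ j ≤ l + 1, x = a * d j} with hP'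
      have hPP : P' ≤ P := by
        rw [hP', Submodule.span_le]
        rintro _ ⟨a, ha, j, hj, rfl⟩
        exact hsP j hj a (hspan ha)
      have hmem : ∀ a ∈ A, ∀ j ≤ l + 1, a * d j ∈ P' := fun a ha j hj =>
        Submodule.subset_span ⟨a, ha, j, hj, rfl⟩
      have htA : ∀ i, i < l → (t i : R) ∈ A := fun i hi =>
        Algebra.subset_adjoin ⟨i, hi, rfl⟩
      have hgen : ∀ i, i < l + 1 → ∀ a ∈ A, ∀ j ≤ l + 1, a * d j * t i ∈ P' := by
        intro i hi a ha j hj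
        have hunit : ∀ u v : Rˣ, ∀ j, descProd t (l + 1) * (descProd t j)⁻¹ * u =
            v * (descProd t (l + 1) * (descProd t j)⁻¹) → d j * u = v * d j := fun u v j h =>
          congrArg Units.val h
        have hd : ∀ j, d (j + 1) * t j = d j := fun j => congrArg Units.val
          (show descProd t (l + 1) * (t j * descProd t j)⁻¹ * t j = _ by group)
        -- The cases: `d_j t_i = t_i d_j` for `i + 1 < j`, `d_j t_{j-1} = d_{j-1}`, `d_j t_j =
        -- d_{j+1} + c d_j` by the quadratic relation, and `d_j t_i = t_{i-1} d_j` for `i > j`.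
        rcases lt_trichotomy i j with hij | rfl | hij
        · obtain ⟨j, rfl⟩ : ∃ j', j = j' + 1 := ⟨j - 1, by omega⟩
          rcases Nat.lt_succ_iff_lt_or_eq.mp hij with hij | rfl
          · have h1 := ht.mul_descProd (i := i) (l := j + 1) (by omega) (by omega)
            have h2 := ht.mul_descProd (i := i) (l := l + 1) (by omega) (by omega)
            rw [mul_assoc, hunit (t i) (t i) (j + 1), ← mul_assoc]
            · exact hmem _ (mul_mem ha (htA i (by omega))) _ hj
            · rw [← mul_assoc, h2, mul_assoc, mul_assoc, inv_mul_eq_iff_eq_mul.mpr]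
              rw [← mul_assoc, ← h1, mul_inv_cancel_right]
          · rw [mul_assoc, hd]
            exact hmem a ha _ (by omega)
        · rw [mul_assoc, ← hd i, mul_assoc, hq i (by omega), mul_add, mul_smul_comm, mul_one, hd,
            mul_add, mul_smul_comm]
          exact add_mem (hmem a ha _ (by omega)) (Submodule.smul_mem _ _ (hmem a ha _ (by omega)))
        · obtain ⟨i, rfl⟩ : ∃ i', i = i' + 1 := ⟨i - 1, by omega⟩
          have h1 := ht.commute_descProd (i := i + 1) (l := j) hij (by omega)
          have h2 := ht.mul_descProd (i := i) (l := l + 1) (by omega) (by omega)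
          rw [mul_assoc, hunit (t (i + 1)) (t i) j, ← mul_assoc]
          · exact hmem _ (mul_mem ha (htA i (by omega))) _ hj
          · rw [← mul_assoc, h2, mul_assoc, mul_assoc, h1.inv_right.eq]
      have hright : ∀ i, i < l + 1 → ∀ p ∈ P', p * t i ∈ P' := by
        intro i hi p hp
        rw [hP'] at hp
        induction hp using Submodule.span_induction with
        | mem x hx =>
          obtain ⟨a, ha, j, hj, rfl⟩ := hx
          exact hgen i hi a ha j hj
        | zero => rw [zero_mul]; exact zero_mem _
        | add x y _ _ hx hy => rw [add_mul]; exact add_mem hx hy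
        | smul c x _ hx => rw [smul_mul_assoc]; exact Submodule.smul_mem _ _ hx
      have hall : ∀ x ∈ Algebra.adjoin ℂ ((fun i => (t i : R)) '' Set.Iio (l + 1)),
          ∀ p ∈ P', p * x ∈ P' := by
        intro x hx
        induction hx using Algebra.adjoin_induction with
        | mem x hx =>
          obtain ⟨i, hi, rfl⟩ := hx
          exact hright i hi
        | algebraMap c =>
          intro p hp
          rw [← Algebra.commutes, ← Algebra.smul_def]
          exact Submodule.smul_mem _ _ hp
        | add x y _ _ hx hy =>
          intro p hp
          rw [mul_add]
          exact add_mem (hx p hp) (hy p hp)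
        | mul x y _ _ hx hy =>
          intro p hp
          rw [← mul_assoc]
          exact hy _ (hx p hp)
      intro x hx
      have h1 : (1 : R) ∈ P' := by
        have := hmem 1 (one_mem _) (l + 1) le_rfl
        simpa [d] using this
      have := hall x hx 1 h1
      rw [one_mul] at this
      exact hPP this

theorem exists_span_H0 (n : ℕ) (k q : ℂˣ) : ∃ s : Finset (Smash (n + 2) q),
    s.card ≤ (n + 2).factorial ∧
      Subalgebra.toSubmodule (H0 n k q) ≤ Submodule.span ℂ (s : Set (Smash (n + 2) q)) := by
  classical
  have hB := (isDoubleAffineBraid (n := n) (k := k) (q := q)).toIsBraid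
  have hq : ∀ i, i < n + 1 → ((natExt unitT i : (DAHA n k q)ˣ) : DAHA n k q) *
      ((natExt unitT i : (DAHA n k q)ˣ) : DAHA n k q) =
      1 + ((k : ℂ) - ((k⁻¹ : ℂˣ) : ℂ)) • ((natExt unitT i : (DAHA n k q)ˣ) : DAHA n k q) := by
    intro i hi
    rw [natExt_of_lt _ hi]
    have h := genT_quadratic (k := k) (q := q) (⟨i, hi⟩ : Fin (n + 1))
    have hk : algebraMap ℂ (DAHA n k q) (k : ℂ) * algebraMap ℂ _ ((k⁻¹ : ℂˣ) : ℂ) = 1 := by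
      rw [← map_mul, Units.mul_inv, map_one]
    have hc := Algebra.commutes (((k⁻¹ : ℂˣ) : ℂ)) (genT (⟨i, hi⟩ : Fin (n + 1)) : DAHA n k q)
    rw [sub_mul, mul_add, mul_add, hk, ← hc] at h
    change genT _ * genT _ = 1 + _ • genT _
    rw [← sub_eq_zero, ← h, sub_smul, Algebra.smul_def, Algebra.smul_def]
    abel
  obtain ⟨s, hs, hspan⟩ := exists_span_adjoin hB _ hq (n + 1) le_rfl
  refine ⟨s.image (DAHA n k q).val, Finset.card_image_le.trans hs, ?_⟩
  rw [Finset.coe_image]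
  have h1 := Submodule.map_mono (f := (DAHA n k q).val.toLinearMap) hspan
  rw [Submodule.map_span] at h1
  refine le_trans ?_ h1
  have h2 : Subalgebra.toSubmodule (H0 n k q) = Submodule.map (DAHA n k q).val.toLinearMap
      (Subalgebra.toSubmodule (Algebra.adjoin ℂ
        ((fun i => ((natExt unitT i : (DAHA n k q)ˣ) : DAHA n k q)) '' Set.Iio (n + 1)))) := by
    rw [← Subalgebra.map_toSubmodule, AlgHom.map_adjoin, H0]
    congr 2
    ext x
    constructor
    · rintro ⟨i, rfl⟩
      exact ⟨_, ⟨i.val, i.isLt, rfl⟩, by beta_reduce; rw [natExt_val]; rfl⟩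
    · rintro ⟨_, ⟨i, hi, rfl⟩, rfl⟩
      exact ⟨⟨i, hi⟩, by beta_reduce; rw [natExt_of_lt _ hi]; rfl⟩
  exact h2.le

instance : FiniteDimensional ℂ (H0 n k q) := by
  obtain ⟨s, -, hs⟩ := exists_span_H0 n k q
  have : FiniteDimensional ℂ (Submodule.span ℂ (s : Set (Smash (n + 2) q))) :=
    FiniteDimensional.span_finset ℂ s
  exact Submodule.finiteDimensional_of_le hs

/-- The upper bound that enters the dimension count for PBW; the lower bound is never needed
separately. -/
theorem finrank_H0_le (n : ℕ) (k q : ℂˣ) :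
    Module.finrank ℂ (H0 n k q) ≤ (n + 2).factorial := by
  obtain ⟨s, hc, hs⟩ := exists_span_H0 n k q
  have : FiniteDimensional ℂ (Submodule.span ℂ (s : Set (Smash (n + 2) q))) :=
    FiniteDimensional.span_finset ℂ s
  exact (Submodule.finrank_mono hs).trans ((finrank_span_finset_le_card s).trans hc)

/-! ### The Poincaré–Birkhoff–Witt theorem: linear independence -/

theorem ratX_mul_eq_smul {N : ℕ} (f : RatFun N q) (a : Smash N q) : ratX f * a = f • a := by
  ext w
  rw [ratX_eq_single, SkewMonoidAlgebra.coeff_single_one_mul, SkewMonoidAlgebra.coeff_smul]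
  rfl

theorem smash_smul_mul {N : ℕ} (f : RatFun N q) (a b : Smash N q) : f • a * b = f • (a * b) := by
  rw [← ratX_mul_eq_smul, ← ratX_mul_eq_smul, mul_assoc]

theorem grp_mul_smul {N : ℕ} (w : W N) (f : RatFun N q) (a : Smash N q) :
    grp w * f • a = (w • f) • (grp w * a) := by
  rw [← ratX_mul_eq_smul, ← ratX_mul_eq_smul, ← mul_assoc, grp_mul_ratX, mul_assoc]

theorem smash_algebraMap_smul {N : ℕ} (c : ℂ) (a : Smash N q) :
    algebraMap ℂ (RatFun N q) c • a = c • a := by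
  rw [← ratX_mul_eq_smul, ← algebraMap_smash, Algebra.smul_def]

theorem linearIndependent_grp (N : ℕ) (q : ℂˣ) :
    LinearIndependent (RatFun N q) (grp : W N → Smash N q) := by
  let φ : Smash N q →ₗ[RatFun N q] (W N →₀ RatFun N q) :=
    { toFun := SkewMonoidAlgebra.coeff
      map_add' := SkewMonoidAlgebra.coeff_add
      map_smul' := SkewMonoidAlgebra.coeff_smul }
  refine LinearIndependent.of_comp φ ?_
  exact Finsupp.linearIndependent_single_one (RatFun N q) (W N)

theorem heckeT_mem_H0 (i : Fin (n + 1)) : heckeT k q i ∈ H0 n k q :=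
  Algebra.subset_adjoin ⟨i, rfl⟩

theorem inv_unitT_mem_H0 (i : Fin (n + 1)) :
    ((((unitT i)⁻¹ : (DAHA n k q)ˣ) : DAHA n k q) : Smash (n + 2) q) ∈ H0 n k q :=
  add_mem (sub_mem (heckeT_mem_H0 i) (algebraMap_mem _ _)) (algebraMap_mem _ _)

theorem inv_descProd_mem_H0 {l : ℕ} (hl : l ≤ n + 1) :
    ((((descProd (natExt unitT) l)⁻¹ : (DAHA n k q)ˣ) : DAHA n k q) : Smash (n + 2) q) ∈
      H0 n k q := by
  induction l with
  | zero =>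
    rw [descProd, inv_one]
    exact one_mem (H0 n k q)
  | succ l ih =>
    rw [descProd, mul_inv_rev, natExt_of_lt _ hl, Units.val_mul, Subalgebra.coe_mul]
    exact mul_mem (ih (by omega)) (inv_unitT_mem_H0 _)

/-- The subspace `∑_l H_0 Y_l`. -/
def spanH0Y (n : ℕ) (k q : ℂˣ) : Submodule ℂ (Smash (n + 2) q) :=
  Submodule.span ℂ {x | ∃ a ∈ H0 n k q, ∃ l,
    x = a * (((unitY l : (DAHA n k q)ˣ) : DAHA n k q) : Smash (n + 2) q)}

theorem inv_unitT_eq (i : Fin (n + 1)) : (((unitT i)⁻¹ : (DAHA n k q)ˣ) : DAHA n k q) =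
    ((unitT i : (DAHA n k q)ˣ) : DAHA n k q) -
      algebraMap ℂ (DAHA n k q) ((k : ℂ) - ((k⁻¹ : ℂˣ) : ℂ)) := by
  change genT i - _ + _ = genT i - _
  rw [map_sub]
  abel

theorem mul_unit_eq_of_add_eq_zero {R : Type*} [Ring R] {c c' : R} {t a a' : Rˣ}
    (ht : ((t⁻¹ : Rˣ) : R) = t - c) (h : a' = t * a * t) (hc : c' + c = 0) :
    (a * t : R) = t * a' + c' * a' := by
  rw [mul_unit_eq_sub ht h, eq_neg_of_add_eq_zero_left hc, neg_mul]

/-- A Bernstein relation whose error is visibly a multiple of a single `Y`, so that degree one in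
`Y` is preserved. -/
theorem exists_unitY_mul_unitT (i : Fin (n + 1)) (l : Fin (n + 2)) :
    ∃ (c : ℂ) (m m' : Fin (n + 2)),
      (((unitY l : (DAHA n k q)ˣ) : DAHA n k q) * ((unitT i : (DAHA n k q)ˣ) : DAHA n k q)) =
        ((unitT i : (DAHA n k q)ˣ) : DAHA n k q) * ((unitY m : (DAHA n k q)ˣ) : DAHA n k q) +
          algebraMap ℂ (DAHA n k q) c * ((unitY m' : (DAHA n k q)ˣ) : DAHA n k q) := by
  have hc : ∀ x : DAHA n k q, algebraMap ℂ (DAHA n k q) ((k : ℂ) - ((k⁻¹ : ℂˣ) : ℂ)) * x =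
      x * algebraMap ℂ (DAHA n k q) ((k : ℂ) - ((k⁻¹ : ℂˣ) : ℂ)) := Algebra.commutes _
  -- In this form the roles are reversed: `a = Y_{i+1}` and `a' = Y_i`.
  have hy : (unitY i.castSucc : (DAHA n k q)ˣ) = unitT i * unitY i.succ * unitT i := by
    rw [unitY_succ]; group
  by_cases h1 : l = i.castSucc
  · subst h1
    exact ⟨_, i.succ, i.castSucc, mul_unit_eq_add hc (inv_unitT_eq i) hy⟩
  · by_cases h2 : l = i.succ
    · subst h2
      refine ⟨-((k : ℂ) - ((k⁻¹ : ℂˣ) : ℂ)), i.castSucc, i.castSucc, ?_⟩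
      refine mul_unit_eq_of_add_eq_zero (inv_unitT_eq i) hy ?_
      rw [← map_add, neg_add_cancel, map_zero]
    · refine ⟨0, l, l, ?_⟩
      rw [map_zero, zero_mul, add_zero, ← Units.val_mul, ← Units.val_mul,
        (commute_unitT_unitY i l h1 h2).eq]

theorem spanH0Y_mul_heckeT {x : Smash (n + 2) q} (hx : x ∈ spanH0Y n k q) (i : Fin (n + 1)) :
    x * heckeT k q i ∈ spanH0Y n k q := by
  have hmem : ∀ a ∈ H0 n k q, ∀ l,
      a * (((unitY l : (DAHA n k q)ˣ) : DAHA n k q) : Smash (n + 2) q) ∈ spanH0Y n k q :=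
    fun a ha l => Submodule.subset_span ⟨a, ha, l, rfl⟩
  have hT := heckeT_mem_H0 (k := k) (q := q) i
  induction hx using Submodule.span_induction with
  | mem x hx =>
    obtain ⟨a, ha, l, rfl⟩ := hx
    obtain ⟨c, m, m', h⟩ := exists_unitY_mul_unitT (k := k) (q := q) i l
    have h' := congrArg (DAHA n k q).val h
    rw [map_mul, map_add, map_mul, map_mul, AlgHom.commutes] at h'
    have hTi : (DAHA n k q).val ((unitT i : (DAHA n k q)ˣ) : DAHA n k q) = heckeT k q i := rfl
    rw [hTi] at h'
    have hl : ∀ l, (((unitY l : (DAHA n k q)ˣ) : DAHA n k q) : Smash (n + 2) q) =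
      (DAHA n k q).val ((unitY l : (DAHA n k q)ˣ) : DAHA n k q) := fun _ => rfl
    rw [mul_assoc, hl, h', mul_add, ← mul_assoc, ← mul_assoc]
    exact add_mem (hmem _ (mul_mem ha hT) _) (hmem _ (mul_mem ha (algebraMap_mem _ _)) _)
  | zero => rw [zero_mul]; exact zero_mem _
  | add x y _ _ hx hy => rw [add_mul]; exact add_mem hx hy
  | smul c x _ hx => rw [smul_mul_assoc]; exact Submodule.smul_mem _ _ hx

/-- Used to rewrite `Y_1 H_0`, hence `π H_0`, with the `Y`s on the right. -/
theorem spanH0Y_mul {x a : Smash (n + 2) q} (hx : x ∈ spanH0Y n k q) (ha : a ∈ H0 n k q) :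
    x * a ∈ spanH0Y n k q := by
  induction ha using Algebra.adjoin_induction generalizing x with
  | mem a ha =>
    obtain ⟨i, rfl⟩ := ha
    exact spanH0Y_mul_heckeT hx i
  | algebraMap c =>
    rw [← Algebra.commutes, ← Algebra.smul_def]
    exact Submodule.smul_mem _ _ hx
  | add a b _ _ ha hb =>
    rw [mul_add]
    exact add_mem (ha hx) (hb hx)
  | mul a b _ _ ha hb =>
    rw [← mul_assoc]
    exact hb (ha hx)

/-! ### Filtration by degree in `Y` and the dimension count over `ℂ(T)` -/

/-- The set of `μ ∈ ℤ^N` with nonnegative coordinates and `∑ μ_i ≤ r`. -/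
def posSet (N r : ℕ) : Set (Fin N → ℤ) := {μ | (∀ i, 0 ≤ μ i) ∧ ∑ i, μ i ≤ r}

theorem finite_posSet (N r : ℕ) : (posSet N r).Finite := by
  refine (Set.finite_Icc (0 : Fin N → ℤ) (fun _ => (r : ℤ))).subset fun μ hμ => ⟨hμ.1, fun i => ?_⟩
  exact (Finset.single_le_sum (fun i _ => hμ.1 i) (Finset.mem_univ i)).trans hμ.2

theorem single_add_mem_posSet {N r : ℕ} {μ : Fin N → ℤ} (hμ : μ ∈ posSet N r) (l : Fin N) :
    Pi.single l 1 + μ ∈ posSet N (r + 1) := by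
  refine ⟨fun i => ?_, ?_⟩
  · have : 0 ≤ (Pi.single l 1 : Fin N → ℤ) i := by
      rw [Pi.single_apply]; split_ifs <;> simp
    exact add_nonneg this (hμ.1 i)
  · simp only [Pi.add_apply, Finset.sum_add_distrib, Finset.sum_pi_single', Finset.mem_univ,
      if_true, Nat.cast_add, Nat.cast_one]
    linarith [hμ.2]

/-- The `ℂ(T)`-span of the elements `h Y^μ` with `h ∈ H_0` and `μ` in `posSet`. -/
def spanPos (n : ℕ) (k q : ℂˣ) (r : ℕ) : Submodule (RatFun (n + 2) q) (Smash (n + 2) q) :=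
  Submodule.span (RatFun (n + 2) q) {x | ∃ a ∈ H0 n k q, ∃ μ ∈ posSet (n + 2) r,
    x = a * ((Ypow μ : DAHA n k q) : Smash (n + 2) q)}

theorem mul_Ypow_mem_spanPos {r : ℕ} {a : Smash (n + 2) q} (ha : a ∈ H0 n k q)
    {μ : Fin (n + 2) → ℤ} (hμ : μ ∈ posSet (n + 2) r) :
    a * ((Ypow μ : DAHA n k q) : Smash (n + 2) q) ∈ spanPos n k q r :=
  Submodule.subset_span ⟨a, ha, μ, hμ, rfl⟩

/-- Left multiplication by `w` is semilinear, so that its effect may be tested on generators. -/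
theorem grp_mul_mem_spanPos {r s : ℕ} (w : W (n + 2))
    (h : ∀ a ∈ H0 n k q, ∀ μ ∈ posSet (n + 2) r,
      grp w * (a * ((Ypow μ : DAHA n k q) : Smash (n + 2) q)) ∈ spanPos n k q s)
    {x : Smash (n + 2) q} (hx : x ∈ spanPos n k q r) : grp w * x ∈ spanPos n k q s := by
  induction hx using Submodule.span_induction with
  | mem x hx =>
    obtain ⟨a, ha, μ, hμ, rfl⟩ := hx
    exact h a ha μ hμ
  | zero => rw [mul_zero]; exact zero_mem _
  | add x y _ _ hx hy => rw [mul_add]; exact add_mem hx hy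
  | smul c x _ hx => rw [grp_mul_smul]; exact Submodule.smul_mem _ _ hx

theorem ck_ne_zero {N : ℕ} {i j : Fin N} (hij : i ≠ j) :
    ck k (toRat (xratio i j) : RatFun N q) ≠ 0 := by
  rw [ck, div_ne_zero_iff]
  refine ⟨fun h => ?_, sub_ne_zero.mpr (toRat_xratio_ne_one hij).symm⟩
  have h1 : algebraMap (Laurent N q) (RatFun N q) (algebraMap ℂ _ ((k⁻¹ : ℂˣ) : ℂ) -
      algebraMap ℂ _ (k : ℂ) * xratio i j) = 0 := by
    rw [map_sub, map_mul, ← IsScalarTower.algebraMap_apply, ← IsScalarTower.algebraMap_apply]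
    exact h
  rw [map_eq_zero_iff _ (IsFractionRing.injective (Laurent N q) (RatFun N q))] at h1
  -- If the numerator vanished, evaluating the ratio at `1` and at `2` would force `k = 0`.
  have key : ∀ c : ℂˣ, ((k⁻¹ : ℂˣ) : ℂ) - k * c = 0 := by
    intro c
    have h2 := congrArg (Laurent.eval (Function.update 1 i c)) h1
    rw [map_sub, map_mul, map_zero, xratio, Laurent.eval_xpow, Finset.prod_eq_single i,
      AlgHom.commutes, AlgHom.commutes] at h2
    · simpa [hij] using h2
    · intro b _ hb
      simp [Function.update_of_ne hb]
    · simp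
  have h3 := key 1
  have h4 := key (Units.mk0 (2 : ℂ) two_ne_zero)
  have hk := k.ne_zero
  simp only [Units.val_one, mul_one, Units.val_mk0] at h3 h4
  exact hk (by linear_combination h3 - h4)

/-- Over `ℂ(T)` the function `c_k` is invertible, so `s_i = c⁻¹ (T_i - k) + 1`, which leaves the
degree in `Y` unchanged. -/
theorem simpleRefl_mul_mem_spanPos {r : ℕ} (i : Fin (n + 1)) {x : Smash (n + 2) q}
    (hx : x ∈ spanPos n k q r) : grp (simpleRefl i) * x ∈ spanPos n k q r := by
  refine grp_mul_mem_spanPos _ (fun a ha μ hμ => ?_) hx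
  set c := ck k (toRat (xratio i.castSucc i.succ) : RatFun (n + 2) q)
  have hc : c ≠ 0 := ck_ne_zero Fin.castSucc_lt_succ.ne
  have h : (grp (simpleRefl i) : Smash (n + 2) q) =
      c⁻¹ • (heckeT k q i - algebraMap ℂ _ (k : ℂ)) + 1 := by
    rw [heckeT, add_sub_cancel_left, ratX_mul_eq_smul, smul_smul, inv_mul_cancel₀ hc, one_smul,
      sub_add_cancel]
  rw [h, add_mul, one_mul, smash_smul_mul, ← mul_assoc]
  exact add_mem (Submodule.smul_mem _ _ (mul_Ypow_mem_spanPos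
    (mul_mem (sub_mem (heckeT_mem_H0 i) (algebraMap_mem _ _)) ha) hμ)) (mul_Ypow_mem_spanPos ha hμ)

theorem perm_mul_mem_spanPos {r : ℕ} (σ : Equiv.Perm (Fin (n + 2))) {x : Smash (n + 2) q}
    (hx : x ∈ spanPos n k q r) : grp (perm σ) * x ∈ spanPos n k q r := by
  have hσ : σ ∈ Submonoid.closure
      (Set.range fun i : Fin (n + 1) => Equiv.swap i.castSucc i.succ) := by
    rw [Equiv.Perm.mclosure_swap_castSucc_succ]; trivial
  induction hσ using Submonoid.closure_induction generalizing x with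
  | mem σ hσ =>
    obtain ⟨i, rfl⟩ := hσ
    exact simpleRefl_mul_mem_spanPos i hx
  | one =>
    rw [show perm (1 : Equiv.Perm (Fin (n + 2))) = 1 from map_one _, map_one, one_mul]
    exact hx
  | mul σ ρ _ _ hσ hρ =>
    rw [perm_mul, map_mul, mul_assoc]
    exact hσ (hρ hx)

/-- Since `π = Y_1 (T_{N-1} ⋯ T_1)⁻¹`, the product `π h` lies in `∑ H_0 Y_l`, and the degree grows
by one. -/
theorem piElt_mul_mem_spanPos {r : ℕ} {x : Smash (n + 2) q}
    (hx : x ∈ spanPos n k q r) : grp (piElt n) * x ∈ spanPos n k q (r + 1) := by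
  refine grp_mul_mem_spanPos _ (fun a ha μ hμ => ?_) hx
  have h1 : (unitPi : (DAHA n k q)ˣ) = unitY 0 * (descProd (natExt unitT) (n + 1))⁻¹ := by
    rw [unitY_zero, mul_inv_cancel_right]
  have h2 : (grp (piElt n) : Smash (n + 2) q) =
      (((unitY 0 : (DAHA n k q)ˣ) : DAHA n k q) : Smash (n + 2) q) *
      ((((descProd (natExt unitT) (n + 1))⁻¹ : (DAHA n k q)ˣ) : DAHA n k q) : Smash (n + 2) q) :=
    congrArg (fun u : (DAHA n k q)ˣ => ((u : DAHA n k q) : Smash (n + 2) q)) h1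
  have h3 : (((unitY 0 : (DAHA n k q)ˣ) : DAHA n k q) : Smash (n + 2) q) ∈ spanH0Y n k q :=
    Submodule.subset_span ⟨1, one_mem _, 0, (one_mul _).symm⟩
  rw [← mul_assoc, h2, mul_assoc _ _ a]
  have h4 := spanH0Y_mul h3 (mul_mem (inv_descProd_mem_H0 (k := k) (q := q) le_rfl) ha)
  have h5 : ∀ z ∈ spanH0Y n k q, z * ((Ypow μ : DAHA n k q) : Smash (n + 2) q) ∈
      spanPos n k q (r + 1) := by
    intro z hz
    induction hz using Submodule.span_induction with
    | mem x hx =>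
      obtain ⟨b, hb, l, rfl⟩ := hx
      rw [mul_assoc, ← Ypow_single, ← Subalgebra.coe_mul, ← Ypow_add]
      exact mul_Ypow_mem_spanPos hb (single_add_mem_posSet hμ l)
    | zero => rw [zero_mul]; exact zero_mem _
    | add x y _ _ hx hy => rw [add_mul]; exact add_mem hx hy
    | smul c x _ hx =>
      rw [smul_mul_assoc, ← smash_algebraMap_smul]
      exact Submodule.smul_mem _ _ hx
  exact h5 _ h4

/-- Every `ε_i` involves `π` exactly once and `π⁻¹` never, so nonnegative exponents suffice for
nonnegative translations. -/
theorem transl_single_eq (i : Fin (n + 2)) : (transl (Pi.single i 1) : W (n + 2)) =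
    perm (Equiv.swap i (Fin.last (n + 1)) * (finRotate (n + 2))⁻¹) * piElt n *
      perm (Equiv.swap i (Fin.last (n + 1))) := by
  have h1 : transl (Pi.single i 1) =
      perm (Equiv.swap i (Fin.last (n + 1))) * transl (Pi.single (Fin.last (n + 1)) 1) *
        (perm (Equiv.swap i (Fin.last (n + 1))))⁻¹ := by
    rw [perm_conj_transl]
    congr 1
    funext a
    simp [Pi.single_apply, Equiv.swap_apply_eq_iff]
  rw [h1, piElt, perm_mul, perm_inv, ← perm_inv (Equiv.swap _ _), Equiv.swap_inv]
  group

/-- Peeling off one `ε_i` at a time costs one factor `π`, and so one degree in `Y`. -/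
theorem grp_mem_spanPos {r : ℕ} {μ : Fin (n + 2) → ℤ} (hμ : μ ∈ posSet (n + 2) r)
    (σ : Equiv.Perm (Fin (n + 2))) : grp (transl μ * perm σ) ∈ spanPos n k q r := by
  have h0 : ∀ r, grp (perm σ) ∈ spanPos n k q r := by
    intro r
    rw [← mul_one (grp (perm σ))]
    refine perm_mul_mem_spanPos σ ?_
    have := mul_Ypow_mem_spanPos (r := r) (one_mem (H0 n k q)) (μ := 0) ⟨fun i => le_rfl, by simp⟩
    rwa [Ypow_zero, Subalgebra.coe_one, mul_one] at this
  induction r generalizing μ with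
  | zero =>
    have : μ = 0 := by
      funext i
      have h1 := Finset.single_le_sum (fun i _ => hμ.1 i) (Finset.mem_univ i)
      have h2 := hμ.1 i
      have h3 := hμ.2
      simp only [Nat.cast_zero] at h3
      exact le_antisymm (h1.trans h3) h2
    rw [this, show (transl 0 : W (n + 2)) = 1 from rfl, one_mul]
    exact h0 0
  | succ r ih =>
    by_cases hz : μ = 0
    · rw [hz, show (transl 0 : W (n + 2)) = 1 from rfl, one_mul]
      exact h0 _
    · obtain ⟨i, hi⟩ : ∃ i, μ i ≠ 0 := by
        by_contra! h
        exact hz (funext h)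
      have hi' : 1 ≤ μ i := by have := hμ.1 i; omega
      have hmem : μ - Pi.single i 1 ∈ posSet (n + 2) r := by
        refine ⟨fun a => ?_, ?_⟩
        · by_cases hai : a = i
          · subst hai; simpa using hi'
          · simpa [hai] using hμ.1 a
        · have := hμ.2
          simp only [Pi.sub_apply, Finset.sum_sub_distrib, Finset.sum_pi_single', Finset.mem_univ,
            if_true]
          push_cast at this
          linarith
      have h1 : transl μ = transl (Pi.single i 1) * transl (μ - Pi.single i 1) := by
        rw [← transl_add, add_sub_cancel]
      rw [h1, transl_single_eq, mul_assoc, map_mul, map_mul, map_mul, mul_assoc, mul_assoc]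
      exact perm_mul_mem_spanPos _ (piElt_mul_mem_spanPos (perm_mul_mem_spanPos _ (ih hmem)))

/-- The element `h_i Y^μ` for a basis `h` of `H_0`. -/
def pbwY (n : ℕ) (k q : ℂˣ) (p : Fin (Module.finrank ℂ (H0 n k q)) × (Fin (n + 2) → ℤ)) :
    Smash (n + 2) q :=
  (Module.finBasis ℂ (H0 n k q) p.1 : Smash (n + 2) q) *
    ((Ypow p.2 : DAHA n k q) : Smash (n + 2) q)

theorem spanPos_le_span_pbwY (r : ℕ) : spanPos n k q r ≤ Submodule.span (RatFun (n + 2) q)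
    (Set.range fun p : Fin (Module.finrank ℂ (H0 n k q)) × posSet (n + 2) r =>
      pbwY n k q (p.1, p.2)) := by
  refine Submodule.span_le.mpr ?_
  rintro _ ⟨a, ha, μ, hμ, rfl⟩
  have h := (Module.finBasis ℂ (H0 n k q)).sum_repr ⟨a, ha⟩
  have h' := congrArg (H0 n k q).val h
  rw [map_sum] at h'
  have h2 : a = ∑ i, (Module.finBasis ℂ (H0 n k q)).repr ⟨a, ha⟩ i •
      (Module.finBasis ℂ (H0 n k q) i : Smash (n + 2) q) := by
    exact h'.symm.trans (Finset.sum_congr rfl fun i _ => map_smul _ _ _)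
  rw [SetLike.mem_coe, h2, Finset.sum_mul]
  refine sum_mem fun i _ => ?_
  rw [smul_mul_assoc, ← smash_algebraMap_smul]
  exact Submodule.smul_mem _ _ (Submodule.subset_span ⟨(i, ⟨μ, hμ⟩), rfl⟩)

theorem transl_mul_perm_injective {N : ℕ} :
    Function.Injective fun p : (Fin N → ℤ) × Equiv.Perm (Fin N) => transl p.1 * perm p.2 := by
  rintro ⟨μ, σ⟩ ⟨ν, ρ⟩ h
  have hl := congrArg SemidirectProduct.left h
  have hr := congrArg SemidirectProduct.right h
  simp only [transl, perm, SemidirectProduct.mul_left, SemidirectProduct.mul_right,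
    SemidirectProduct.left_inl, SemidirectProduct.right_inl, SemidirectProduct.left_inr,
    SemidirectProduct.right_inr, map_one, mul_one, one_mul] at hl hr
  exact Prod.ext (Multiplicative.ofAdd.injective hl) hr

/-- A dimension count: the span of these vectors contains `|posSet| · N!` independent group
elements, and there are `|posSet| · dim H_0 ≤ |posSet| · N!` vectors. -/
theorem linearIndependent_pbwY_posSet (r : ℕ) : LinearIndependent (RatFun (n + 2) q)
    (fun p : Fin (Module.finrank ℂ (H0 n k q)) × posSet (n + 2) r => pbwY n k q (p.1, p.2)) := by
  have : Fintype (posSet (n + 2) r) := (finite_posSet _ _).fintype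
  rw [linearIndependent_iff_card_le_finrank_span, Set.finrank]
  set P := Submodule.span (RatFun (n + 2) q)
    (Set.range fun p : Fin (Module.finrank ℂ (H0 n k q)) × posSet (n + 2) r =>
      pbwY n k q (p.1, p.2))
  have : FiniteDimensional (RatFun (n + 2) q) P :=
    FiniteDimensional.span_of_finite _ (Set.finite_range _)
  let v : posSet (n + 2) r × Equiv.Perm (Fin (n + 2)) → P := fun p =>
    ⟨grp (transl p.1.1 * perm p.2), spanPos_le_span_pbwY r (grp_mem_spanPos p.1.2 p.2)⟩
  have hv : LinearIndependent (RatFun (n + 2) q) v := by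
    refine LinearIndependent.of_comp P.subtype ?_
    refine (linearIndependent_grp (n + 2) q).comp
      (fun p : posSet (n + 2) r × Equiv.Perm (Fin (n + 2)) => transl p.1.1 * perm p.2) ?_
    refine transl_mul_perm_injective.comp
      (f := fun p : posSet (n + 2) r × Equiv.Perm (Fin (n + 2)) => (p.1.1, p.2)) ?_
    rintro ⟨μ, σ⟩ ⟨ν, ρ⟩ h
    rw [Prod.mk.injEq] at h
    exact Prod.ext (Subtype.ext h.1) h.2
  -- It remains to compare cardinalities, where `dim H_0 ≤ N!` enters.
  refine le_trans ?_ hv.fintype_card_le_finrank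
  rw [Fintype.card_prod, Fintype.card_prod, Fintype.card_perm, Fintype.card_fin, Fintype.card_fin,
    mul_comm]
  exact Nat.mul_le_mul_left _ (finrank_H0_le n k q)

/-- Independence concerns finitely many exponents at a time. Right multiplication by `(Y_1 ⋯ Y_N)^m`
is `ℂ(T)`-linear and shifts them all into the nonnegative range. -/
theorem linearIndependent_pbwY : LinearIndependent (RatFun (n + 2) q) (pbwY n k q) := by
  rw [linearIndependent_iff_finset_linearIndependent]
  intro s
  obtain ⟨m, hm⟩ : ∃ m : ℕ, ∀ p ∈ s, ∀ i, |p.2 i| ≤ m := by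
    refine ⟨∑ p ∈ s, ∑ i, (p.2 i).natAbs, fun p hp i => ?_⟩
    rw [Int.abs_eq_natAbs]
    exact_mod_cast (Finset.single_le_sum (f := fun i => (p.2 i).natAbs)
      (fun _ _ => Nat.zero_le _) (Finset.mem_univ i)).trans
      (Finset.single_le_sum (f := fun p : _ × (Fin (n + 2) → ℤ) => ∑ i, (p.2 i).natAbs)
        (fun _ _ => Nat.zero_le _) hp)
  let φ : Smash (n + 2) q →ₗ[RatFun (n + 2) q] Smash (n + 2) q :=
    { toFun := fun x => x * ((Ypow (fun _ => (m : ℤ)) : DAHA n k q) : Smash (n + 2) q)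
      map_add' := fun x y => add_mul _ _ _
      map_smul' := fun c x => smash_smul_mul _ _ _ }
  refine LinearIndependent.of_comp φ ?_
  -- The shifted coordinates lie between `0` and `2m`, hence the degree bound `(n + 2)(2m)`.
  have hmem : ∀ p : s, p.1.2 + (fun _ => (m : ℤ)) ∈ posSet (n + 2) ((n + 2) * (2 * m)) := by
    intro p
    refine ⟨fun i => ?_, ?_⟩
    · have := (abs_le.mp (hm p.1 p.2 i)).1
      simp only [Pi.add_apply]
      linarith
    · calc ∑ i, (p.1.2 i + (m : ℤ)) ≤ ∑ _i : Fin (n + 2), (2 * m : ℤ) := by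
            refine Finset.sum_le_sum fun i _ => ?_
            have := (abs_le.mp (hm p.1 p.2 i)).2
            linarith
        _ = (((n + 2) * (2 * m) : ℕ) : ℤ) := by simp
  have h := (linearIndependent_pbwY_posSet (n := n) (k := k) (q := q) ((n + 2) * (2 * m))).comp
    (fun p : s => (p.1.1, ⟨_, hmem p⟩)) ?_
  · convert h using 1
    funext p
    simp only [Function.comp_apply, pbwY, φ, LinearMap.coe_mk, AddHom.coe_mk]
    rw [mul_assoc, ← Subalgebra.coe_mul, ← Ypow_add]
  · rintro ⟨⟨i, μ⟩, hp⟩ ⟨⟨j, ν⟩, hp'⟩ h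
    simp only [Prod.mk.injEq, Subtype.mk.injEq, add_left_inj] at h
    exact Subtype.ext (Prod.ext h.1 h.2)

/-! ### Independence over `ℂ` of the products `X^u h Y^v` -/

theorem linearIndependent_toRat_xpow (N : ℕ) (q : ℂˣ) : LinearIndependent ℂ
    (fun u : Fin N → ℤ => (toRat (xpow (Multiplicative.ofAdd u)) : RatFun N q)) := by
  have h1 : LinearIndependent ℂ
      (fun u : Fin N → ℤ => (xpow (Multiplicative.ofAdd u) : Laurent N q)) := by
    let φ : AddMonoidAlgebra ℂ (Fin N → ℤ) →ₗ[ℂ] ((Fin N → ℤ) →₀ ℂ) :=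
      { toFun := AddMonoidAlgebra.coeff
        map_add' := AddMonoidAlgebra.coeff_add
        map_smul' := AddMonoidAlgebra.coeff_smul }
    refine LinearIndependent.of_comp (M := Laurent N q) φ ?_
    exact Finsupp.linearIndependent_single_one ℂ (Fin N → ℤ)
  exact h1.map' (IsScalarTower.toAlgHom ℂ (Laurent N q) (RatFun N q)).toLinearMap
    (LinearMap.ker_eq_bot.mpr (IsFractionRing.injective (Laurent N q) (RatFun N q)))

/-- The element `X^u h_i Y^v` of `ℍ`. -/
def pbw (n : ℕ) (k q : ℂˣ)
    (p : (Fin (n + 2) → ℤ) × Fin (Module.finrank ℂ (H0 n k q)) × (Fin (n + 2) → ℤ)) :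
    DAHA n k q :=
  Xpow p.1 * inclH0 (Module.finBasis ℂ (H0 n k q) p.2.1) * Ypow p.2.2

/-- The coefficients of an element of `ℂ(T) # W`, as a `ℂ(T)`-linear map. -/
def coeffRat (N : ℕ) (q : ℂˣ) : Smash N q →ₗ[RatFun N q] (W N →₀ RatFun N q) where
  toFun := SkewMonoidAlgebra.coeff
  map_add' := SkewMonoidAlgebra.coeff_add
  map_smul' := SkewMonoidAlgebra.coeff_smul

/-- The coefficients of an element of `ℂ(T) # W`, as a `ℂ`-linear map. -/
def coeffComplex (N : ℕ) (q : ℂˣ) : Smash N q →ₗ[ℂ] (W N →₀ RatFun N q) where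
  toFun := coeffRat N q
  map_add' := map_add (coeffRat N q)
  map_smul' c x := by
    rw [Algebra.smul_def, algebraMap_smash, ratX_mul_eq_smul, map_smul, RingHom.id_apply,
      algebraMap_smul]

theorem coeffRat_injective (N : ℕ) (q : ℂˣ) : Function.Injective (coeffRat N q) := fun _ _ h =>
  SkewMonoidAlgebra.coeff_inj.mp h

theorem val_Xpow (u : Fin (n + 2) → ℤ) : ((Xpow u : DAHA n k q) : Smash (n + 2) q) =
    ratX (toRat (xpow (Multiplicative.ofAdd u))) := rfl

theorem val_inclH0 (h : H0 n k q) : ((inclH0 h : DAHA n k q) : Smash (n + 2) q) = h :=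
  Subalgebra.coe_inclusion (H0_le_DAHA n k q) h

theorem val_pbw (p : (Fin (n + 2) → ℤ) × Fin (Module.finrank ℂ (H0 n k q)) ×
    (Fin (n + 2) → ℤ)) : (pbw n k q p : Smash (n + 2) q) =
      (toRat (xpow (Multiplicative.ofAdd p.1)) : RatFun (n + 2) q) • pbwY n k q p.2 := by
  rw [← ratX_mul_eq_smul, pbwY, ← mul_assoc, pbw, Subalgebra.coe_mul, Subalgebra.coe_mul,
    val_Xpow, val_inclH0]

/-- The tower argument: the `x^u` are independent in `ℂ(T)` over `ℂ`, and the `h_i Y^v` are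
independent over `ℂ(T)`. It is carried out on coefficient vectors, where `ℂ` acts through `ℂ(T)`. -/
theorem linearIndependent_pbw : LinearIndependent ℂ (pbw n k q) := by
  refine LinearIndependent.of_comp ((coeffComplex (n + 2) q).comp (DAHA n k q).val.toLinearMap) ?_
  have h := linearIndependent_smul (linearIndependent_toRat_xpow (n + 2) q)
    ((linearIndependent_pbwY (n := n) (k := k) (q := q)).map' (coeffRat (n + 2) q)
      (LinearMap.ker_eq_bot.mpr (coeffRat_injective _ _)))
  have e : (coeffComplex (n + 2) q).comp (DAHA n k q).val.toLinearMap ∘ pbw n k q = fun p =>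
      (toRat (xpow (Multiplicative.ofAdd p.1)) : RatFun (n + 2) q) •
        (coeffRat (n + 2) q ∘ pbwY n k q) p.2 := by
    funext p
    have h1 : ((coeffComplex (n + 2) q).comp (DAHA n k q).val.toLinearMap) (pbw n k q p) =
      coeffRat (n + 2) q (pbw n k q p : Smash (n + 2) q) := rfl
    rw [Function.comp_apply, h1, val_pbw, map_smul, Function.comp_apply]
  rw [e]
  exact h

/-! ### The Poincaré–Birkhoff–Witt theorem: spanning -/

/-- Used twice: for the spanning half of PBW and for the anti-multiplicativity of the duality. -/
theorem eq_top_of_closed {U : Submodule ℂ (DAHA n k q)} (h1 : 1 ∈ U)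
    (hT : ∀ i, ∀ x ∈ U, genT i * x ∈ U)
    (hpi : ∀ x ∈ U, ((unitPi : (DAHA n k q)ˣ) : DAHA n k q) * x ∈ U)
    (hpi' : ∀ x ∈ U, ((unitPi⁻¹ : (DAHA n k q)ˣ) : DAHA n k q) * x ∈ U)
    (hX : ∀ f, ∀ x ∈ U, opX f * x ∈ U) : U = ⊤ := by
  rw [eq_top_iff]
  rintro ⟨a, ha⟩ -
  suffices ∀ x ∈ U, ⟨a, ha⟩ * x ∈ U by
    have := this 1 h1
    rwa [mul_one] at this
  induction ha using Algebra.adjoin_induction with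
  | mem a ha =>
    rcases ha with (⟨i, rfl⟩ | rfl | rfl) | ⟨f, rfl⟩
    · exact hT i
    · exact hpi
    · exact hpi'
    · exact hX f
  | algebraMap c =>
    intro x hx
    have : algebraMap ℂ (DAHA n k q) c * x ∈ U := by
      rw [← Algebra.smul_def]
      exact Submodule.smul_mem _ _ hx
    exact this
  | add a b ha hb hha hhb =>
    intro x hx
    have : ((⟨a, ha⟩ : DAHA n k q) + ⟨b, hb⟩) * x ∈ U := by
      rw [add_mul]
      exact add_mem (hha x hx) (hhb x hx)
    exact this
  | mul a b ha hb hha hhb =>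
    intro x hx
    have : ((⟨a, ha⟩ : DAHA n k q) * ⟨b, hb⟩) * x ∈ U := by
      rw [mul_assoc]
      exact hha _ (hhb x hx)
    exact this

/-- The subspace `H_0 ℂ[Y]` of `ℍ`. -/
def spanHY (n : ℕ) (k q : ℂˣ) : Submodule ℂ (DAHA n k q) :=
  Submodule.span ℂ {x | ∃ (h : H0 n k q) (g : Laurent (n + 2) q), x = inclH0 h * opYHom g}

theorem inclH0_mul_mem_spanHY (h : H0 n k q) {x : DAHA n k q} (hx : x ∈ spanHY n k q) :
    inclH0 h * x ∈ spanHY n k q := by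
  induction hx using Submodule.span_induction with
  | mem x hx =>
    obtain ⟨h', g, rfl⟩ := hx
    rw [← mul_assoc, ← map_mul]
    exact Submodule.subset_span ⟨_, _, rfl⟩
  | zero => rw [mul_zero]; exact zero_mem _
  | add x y _ _ hx hy => rw [mul_add]; exact add_mem hx hy
  | smul c x _ hx => rw [mul_smul_comm]; exact Submodule.smul_mem _ _ hx

theorem mul_opYHom_mem_spanHY (g : Laurent (n + 2) q) {x : DAHA n k q} (hx : x ∈ spanHY n k q) :
    x * opYHom g ∈ spanHY n k q := by
  induction hx using Submodule.span_induction with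
  | mem x hx =>
    obtain ⟨h', g', rfl⟩ := hx
    rw [mul_assoc, ← map_mul]
    exact Submodule.subset_span ⟨_, _, rfl⟩
  | zero => rw [zero_mul]; exact zero_mem _
  | add x y _ _ hx hy => rw [add_mul]; exact add_mem hx hy
  | smul c x _ hx => rw [smul_mul_assoc]; exact Submodule.smul_mem _ _ hx

/-- The generator `T_i` as an element of `H_0`. -/
def genT0 (i : Fin (n + 1)) : H0 n k q := ⟨heckeT k q i, heckeT_mem_H0 i⟩

theorem inclH0_genT0 (i : Fin (n + 1)) : (inclH0 (genT0 i) : DAHA n k q) = genT i := rfl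

theorem H0_induction {P : H0 n k q → Prop} (hT : ∀ i, P (genT0 i))
    (hc : ∀ c, P (algebraMap ℂ _ c)) (hadd : ∀ a b, P a → P b → P (a + b))
    (hmul : ∀ a b, P a → P b → P (a * b)) (h : H0 n k q) : P h := by
  obtain ⟨a, ha⟩ := h
  induction ha using Algebra.adjoin_induction with
  | mem a ha =>
    obtain ⟨i, rfl⟩ := ha
    exact hT i
  | algebraMap c => exact hc c
  | add a b ha hb hha hhb => exact hadd ⟨a, ha⟩ ⟨b, hb⟩ hha hhb
  | mul a b ha hb hha hhb => exact hmul ⟨a, ha⟩ ⟨b, hb⟩ hha hhb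

/-- The Bernstein relation in `Y` moves `g(Y)` to the right of each `T_i`; the rest is induction on
the element of `H_0`. -/
theorem opYHom_mul_inclH0_mem_spanHY (h : H0 n k q) (g : Laurent (n + 2) q) :
    opYHom g * inclH0 h ∈ spanHY n k q := by
  have hmem : ∀ h g, inclH0 h * opYHom g ∈ spanHY n k q := fun h g =>
    Submodule.subset_span ⟨h, g, rfl⟩
  induction h using H0_induction generalizing g with
  | hT i =>
    obtain ⟨e, he⟩ := exists_bernsteinRel k i (diamondFun g)
    have h2 := he.2
    rw [diamondFun_diamondFun] at h2
    rw [inclH0_genT0, h2, ← inclH0_genT0]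
    refine add_mem (hmem _ _) ?_
    have := hmem 1 (diamondFun e)
    rwa [map_one, one_mul] at this
  | hc c =>
    rw [AlgHom.commutes, ← Algebra.commutes, ← AlgHom.commutes inclH0]
    exact hmem _ _
  | hadd a b ha hb =>
    rw [map_add, mul_add]
    exact add_mem (ha g) (hb g)
  | hmul a b ha hb =>
    rw [map_mul, ← mul_assoc]
    have key : ∀ x ∈ spanHY n k q, x * inclH0 b ∈ spanHY n k q := by
      intro x hx
      induction hx using Submodule.span_induction with
      | mem x hx =>
        obtain ⟨h', g', rfl⟩ := hx
        rw [mul_assoc]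
        exact inclH0_mul_mem_spanHY _ (hb g')
      | zero => rw [zero_mul]; exact zero_mem _
      | add x y _ _ hx hy => rw [add_mul]; exact add_mem hx hy
      | smul c x _ hx => rw [smul_mul_assoc]; exact Submodule.smul_mem _ _ hx
    exact key _ (ha g)

theorem opYHom_mul_mem_spanHY (g : Laurent (n + 2) q) {x : DAHA n k q} (hx : x ∈ spanHY n k q) :
    opYHom g * x ∈ spanHY n k q := by
  induction hx using Submodule.span_induction with
  | mem x hx =>
    obtain ⟨h', g', rfl⟩ := hx
    rw [← mul_assoc]
    exact mul_opYHom_mem_spanHY _ (opYHom_mul_inclH0_mem_spanHY _ _)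
  | zero => rw [mul_zero]; exact zero_mem _
  | add x y _ _ hx hy => rw [mul_add]; exact add_mem hx hy
  | smul c x _ hx => rw [mul_smul_comm]; exact Submodule.smul_mem _ _ hx

theorem exists_inclH0_eq_descProd {l : ℕ} (hl : l ≤ n + 1) : ∃ h : H0 n k q,
    inclH0 h = ((descProd (natExt unitT) l : (DAHA n k q)ˣ) : DAHA n k q) := by
  induction l with
  | zero => exact ⟨1, by rw [map_one, descProd, Units.val_one]⟩
  | succ l ih =>
    obtain ⟨h, hh⟩ := ih (by omega)
    refine ⟨genT0 ⟨l, hl⟩ * h, ?_⟩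
    rw [map_mul, hh, descProd, natExt_of_lt _ hl, Units.val_mul]
    rfl

theorem exists_inclH0_eq_inv_descProd {l : ℕ} (hl : l ≤ n + 1) : ∃ h : H0 n k q,
    inclH0 h = (((descProd (natExt unitT) l)⁻¹ : (DAHA n k q)ˣ) : DAHA n k q) :=
  ⟨⟨_, inv_descProd_mem_H0 hl⟩, rfl⟩

theorem unitPi_eq : (unitPi : (DAHA n k q)ˣ) =
    unitY 0 * (descProd (natExt unitT) (n + 1))⁻¹ := by
  rw [unitY_zero, mul_inv_cancel_right]

theorem opYHom_xcoord (i : Fin (n + 2)) :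
    (opYHom (xcoord i) : DAHA n k q) = ((unitY i : (DAHA n k q)ˣ) : DAHA n k q) := by
  rw [xcoord, opYHom_xpow, toAdd_ofAdd, Ypow_single]

/-- `π` lies in `ℂ[Y] H_0`, and both factors preserve `H_0 ℂ[Y]`. -/
theorem unitPi_mul_mem_spanHY {x : DAHA n k q} (hx : x ∈ spanHY n k q) :
    ((unitPi : (DAHA n k q)ˣ) : DAHA n k q) * x ∈ spanHY n k q := by
  obtain ⟨h, hh⟩ := exists_inclH0_eq_inv_descProd (k := k) (q := q) (le_refl (n + 1))
  rw [unitPi_eq, Units.val_mul, ← hh, ← opYHom_xcoord, mul_assoc]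
  exact opYHom_mul_mem_spanHY _ (inclH0_mul_mem_spanHY _ hx)

theorem unitPi_inv_mul_mem_spanHY {x : DAHA n k q} (hx : x ∈ spanHY n k q) :
    ((unitPi⁻¹ : (DAHA n k q)ˣ) : DAHA n k q) * x ∈ spanHY n k q := by
  obtain ⟨h, hh⟩ := exists_inclH0_eq_descProd (k := k) (q := q) (le_refl (n + 1))
  rw [unitPi_eq, mul_inv_rev, inv_inv, Units.val_mul, ← hh, ← opYHom_diamondFun_xcoord, mul_assoc]
  exact inclH0_mul_mem_spanHY _ (opYHom_mul_mem_spanHY _ hx)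

theorem unitPi_mul_opX (f : Laurent (n + 2) q) :
    ((unitPi : (DAHA n k q)ˣ) : DAHA n k q) * opX f = opX (piElt n • f) * ((unitPi : (DAHA n k q)ˣ) : DAHA n k q) := by
  refine Subtype.ext ?_
  change grp (piElt n) * ratX (toRat f) = ratX (toRat (piElt n • f)) * grp (piElt n)
  rw [grp_mul_ratX, smul_toRat]

theorem unitPi_inv_mul_opX (f : Laurent (n + 2) q) :
    ((unitPi⁻¹ : (DAHA n k q)ˣ) : DAHA n k q) * opX f =
      opX ((piElt n)⁻¹ • f) * ((unitPi⁻¹ : (DAHA n k q)ˣ) : DAHA n k q) := by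
  refine Subtype.ext ?_
  change grp (piElt n)⁻¹ * ratX (toRat f) = ratX (toRat ((piElt n)⁻¹ • f)) * grp (piElt n)⁻¹
  rw [grp_mul_ratX, smul_toRat]

/-- A generator is first moved past `f(X)`, `T_i` by the Bernstein relation and `π^{±1}` by its
action on functions, and is then absorbed into `H_0 ℂ[Y]`. -/
theorem span_opX_mul_inclH0_mul_opYHom : Submodule.span ℂ {x : DAHA n k q |
    ∃ (f : Laurent (n + 2) q) (h : H0 n k q) (g : Laurent (n + 2) q),
      x = opX f * inclH0 h * opYHom g} = ⊤ := by
  set U := Submodule.span ℂ {x : DAHA n k q |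
    ∃ (f : Laurent (n + 2) q) (h : H0 n k q) (g : Laurent (n + 2) q),
      x = opX f * inclH0 h * opYHom g} with hU
  have hmem : ∀ f, ∀ x ∈ spanHY n k q, opX f * x ∈ U := by
    intro f x hx
    induction hx using Submodule.span_induction with
    | mem x hx =>
      obtain ⟨h, g, rfl⟩ := hx
      rw [← mul_assoc]
      exact Submodule.subset_span ⟨f, h, g, rfl⟩
    | zero => rw [mul_zero]; exact zero_mem _
    | add x y _ _ hx hy => rw [mul_add]; exact add_mem hx hy
    | smul c x _ hx => rw [mul_smul_comm]; exact Submodule.smul_mem _ _ hx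
  have hspan : ∀ h g, inclH0 h * opYHom g ∈ spanHY n k q := fun h g =>
    Submodule.subset_span ⟨h, g, rfl⟩
  have hext : ∀ a : DAHA n k q, (∀ f, ∀ x ∈ spanHY n k q, a * (opX f * x) ∈ U) →
      ∀ x ∈ U, a * x ∈ U := by
    intro a ha x hx
    induction hx using Submodule.span_induction with
    | mem x hx =>
      obtain ⟨f, h, g, rfl⟩ := hx
      rw [mul_assoc (opX f)]
      exact ha f _ (hspan h g)
    | zero => rw [mul_zero]; exact zero_mem _
    | add x y _ _ hx hy => rw [mul_add]; exact add_mem hx hy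
    | smul c x _ hx => rw [mul_smul_comm]; exact Submodule.smul_mem _ _ hx
  refine eq_top_of_closed ?_ (fun i => hext _ fun f x hx => ?_) (hext _ fun f x hx => ?_)
    (hext _ fun f x hx => ?_) (fun f => hext _ fun f' x hx => ?_)
  · refine Submodule.subset_span ⟨1, 1, 1, ?_⟩
    rw [map_one, map_one, mul_one, mul_one, ← opXHom_apply, map_one]
  · obtain ⟨g, hg⟩ := exists_bernsteinRel k i f
    have h1 := hg.1
    simp only [opXHom_apply] at h1
    rw [← mul_assoc, h1, add_mul, mul_assoc, ← inclH0_genT0]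
    exact add_mem (hmem _ _ (inclH0_mul_mem_spanHY _ hx)) (hmem _ _ hx)
  · rw [← mul_assoc, unitPi_mul_opX, mul_assoc]
    exact hmem _ _ (unitPi_mul_mem_spanHY hx)
  · rw [← mul_assoc, unitPi_inv_mul_opX, mul_assoc]
    exact hmem _ _ (unitPi_inv_mul_mem_spanHY hx)
  · rw [← mul_assoc, ← opXHom_apply, ← opXHom_apply, ← map_mul]
    exact hmem _ _ hx

theorem span_pbw : ⊤ ≤ Submodule.span ℂ (Set.range (pbw n k q)) := by
  rw [← span_opX_mul_inclH0_mul_opYHom, Submodule.span_le]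
  rintro _ ⟨f, h, g, rfl⟩
  rw [SetLike.mem_coe, ← opXHom_apply]
  induction f using Laurent.induction with
  | hx u =>
    induction g using Laurent.induction with
    | hx v =>
      rw [← (Module.finBasis ℂ (H0 n k q)).sum_repr h, map_sum, Finset.mul_sum, Finset.sum_mul]
      refine sum_mem fun i _ => ?_
      rw [map_smul, mul_smul_comm, smul_mul_assoc, opYHom_xpow]
      exact Submodule.smul_mem _ _ (Submodule.subset_span ⟨(u.toAdd, i, v.toAdd), rfl⟩)
    | hadd f g hf hg => rw [map_add, mul_add]; exact add_mem hf hg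
    | hsmul c f hf => rw [map_smul, mul_smul_comm]; exact Submodule.smul_mem _ _ hf
  | hadd f g hf hg => rw [map_add, add_mul, add_mul]; exact add_mem hf hg
  | hsmul c f hf =>
    rw [map_smul, smul_mul_assoc, smul_mul_assoc]; exact Submodule.smul_mem _ _ hf

/-- The basis `X^u h_i Y^v` of `ℍ`. -/
def pbwBasis (n : ℕ) (k q : ℂˣ) : Module.Basis
    ((Fin (n + 2) → ℤ) × Fin (Module.finrank ℂ (H0 n k q)) × (Fin (n + 2) → ℤ)) ℂ (DAHA n k q) :=
  Module.Basis.mk linearIndependent_pbw span_pbw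

theorem pbwBasis_apply (p : (Fin (n + 2) → ℤ) × Fin (Module.finrank ℂ (H0 n k q)) ×
    (Fin (n + 2) → ℤ)) : pbwBasis n k q p =
      Xpow p.1 * inclH0 (Module.finBasis ℂ (H0 n k q) p.2.1) * Ypow p.2.2 :=
  Module.Basis.mk_apply _ _ _

/-! ### The anti-involution of the finite Hecke algebra -/

/-- The anti-homomorphism `w ↦ d⁻¹ ρ(w⁻¹) d`. -/
def conjAnti {G R : Type*} [Group G] [Monoid R] (d : Rˣ) (ρ : G →* R) : G →* Rᵐᵒᵖ where
  toFun w := MulOpposite.op (((d⁻¹ : Rˣ) : R) * ρ w⁻¹ * (d : R))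
  map_one' := by simp
  map_mul' v w := by
    rw [← MulOpposite.op_mul, mul_inv_rev, map_mul]
    simp only [mul_assoc, Units.mul_inv_cancel_left]

theorem units_conj_mul {R : Type*} [Monoid R] {d : Rˣ} {r a b : R} (ha : (d : R) * a = a * d)
    (hb : (d : R) * b = b * d) (h : r * a = b * r) :
    ((d⁻¹ : Rˣ) : R) * r * (d : R) * a = b * (((d⁻¹ : Rˣ) : R) * r * (d : R)) := by
  have hb' : b * ((d⁻¹ : Rˣ) : R) = ((d⁻¹ : Rˣ) : R) * b := by
    rw [Units.mul_inv_eq_iff_eq_mul, mul_assoc, ← hb, Units.inv_mul_cancel_left]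
  rw [mul_assoc, ha, ← mul_assoc, mul_assoc _ r a, h, ← mul_assoc, ← hb', mul_assoc, mul_assoc,
    mul_assoc]

/-- The invertible element `δ(X)` of `ℂ(T) # W`. -/
def unitRat {N : ℕ} {q : ℂˣ} (δ : RatFun N q) (hδ : δ ≠ 0) : (Smash N q)ˣ :=
  Units.map (ratX : RatFun N q →+* Smash N q).toMonoidHom (Units.mk0 δ hδ)

theorem commute_ratX {N : ℕ} {q : ℂˣ} (f g : RatFun N q) :
    Commute (ratX f : Smash N q) (ratX g) := by
  rw [Commute, SemiconjBy, ← map_mul, mul_comm, map_mul]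

theorem grp_inv_mul_ratX_smul {N : ℕ} {q : ℂˣ} (w : W N) (f : RatFun N q) :
    (grp w⁻¹ * ratX (w • f) : Smash N q) = ratX f * grp w⁻¹ := by
  rw [grp_mul_ratX, inv_smul_smul]

/-- The anti-homomorphism `f w ↦ δ⁻¹ w⁻¹ δ f` of `ℂ(T) # W`. -/
def smashAnti {N : ℕ} {q : ℂˣ} (δ : RatFun N q) (hδ : δ ≠ 0) : Smash N q →+* (Smash N q)ᵐᵒᵖ :=
  SkewMonoidAlgebra.liftNCRingHom (ratX.toOpposite commute_ratX) (conjAnti (unitRat δ hδ) grp)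
    (fun {x y} => congrArg MulOpposite.op (units_conj_mul (d := unitRat δ hδ)
      (commute_ratX _ _).eq (commute_ratX _ _).eq (grp_inv_mul_ratX_smul y x)))

theorem smashAnti_single {N : ℕ} {q : ℂˣ} (δ : RatFun N q) (hδ : δ ≠ 0) (w : W N)
    (f : RatFun N q) : smashAnti δ hδ (SkewMonoidAlgebra.single w f) =
      MulOpposite.op (ratX δ⁻¹ * grp w⁻¹ * ratX δ * ratX f) :=
  (SkewMonoidAlgebra.liftNC_single _ _ _ _).trans (MulOpposite.op_mul _ _).symm

theorem smashAnti_ratX {N : ℕ} {q : ℂˣ} (δ : RatFun N q) (hδ : δ ≠ 0) (f : RatFun N q) :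
    smashAnti δ hδ (ratX f) = MulOpposite.op (ratX f) := by
  rw [ratX_eq_single, smashAnti_single, inv_one, map_one, mul_one, ← map_mul, inv_mul_cancel₀ hδ,
    map_one, one_mul, ratX_eq_single]

/-- With `s = s_i` and `c = c_k(x_i / x_{i+1})`, the term `c s` goes to `δ⁻¹ s δ c = δ⁻¹ (s δ)(s c)
s`. The hypothesis `(s δ)(s c) = δ c` says exactly that this is `c s` again. -/
theorem smashAnti_heckeT {δ : RatFun (n + 2) q} (hδ : δ ≠ 0) (i : Fin (n + 1))
    (h : (simpleRefl i • δ) * ck k (toRat (xratio i.succ i.castSucc)) =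
      δ * ck k (toRat (xratio i.castSucc i.succ))) :
    smashAnti δ hδ (heckeT k q i) = MulOpposite.op (heckeT k q i) := by
  have hs : (simpleRefl i : W (n + 2))⁻¹ = simpleRefl i :=
    inv_eq_of_mul_eq_one_left (simpleRefl_sq i)
  have h1 : (ratX δ⁻¹ * grp (simpleRefl i)⁻¹ * ratX δ *
      ratX (ck k (toRat (xratio i.castSucc i.succ))) : Smash (n + 2) q) =
      SkewMonoidAlgebra.single (simpleRefl i) (ck k (toRat (xratio i.castSucc i.succ))) := by
    rw [mul_assoc, ← map_mul, mul_assoc, grp_mul_ratX, hs, smul_mul', smul_ck, ← toRat_xratio_inv,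
      h, ← mul_assoc, ← map_mul, inv_mul_cancel_left₀ hδ, ratX_mul_grp]
  rw [heckeT_eq_heckeElt, heckeElt_eq, map_add, ← ratX_eq_single, smashAnti_ratX, smashAnti_single,
    h1, MulOpposite.op_add]

/-- The function `∏_{a < b} c_k(x_a / x_b)⁻¹`. -/
def starWeight (n : ℕ) (k q : ℂˣ) : RatFun (n + 2) q :=
  ∏ p : Fin (n + 2) × Fin (n + 2) with p.1 < p.2, (ck k (toRat (xratio p.1 p.2)))⁻¹

theorem starWeight_ne_zero : starWeight n k q ≠ 0 :=
  Finset.prod_ne_zero_iff.mpr fun _ hp => inv_ne_zero (ck_ne_zero (Finset.mem_filter.mp hp).2.ne)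

/-- The standard fact that `s_i` permutes the positive roots other than its own simple root. -/
theorem swap_lt_swap {i : Fin (n + 1)} {a b : Fin (n + 2)} (hab : a < b)
    (h : (a, b) ≠ (i.castSucc, i.succ)) :
    Equiv.swap i.castSucc i.succ a < Equiv.swap i.castSucc i.succ b ∧
      (Equiv.swap i.castSucc i.succ a, Equiv.swap i.castSucc i.succ b) ≠ (i.castSucc, i.succ) := by
  have hv : ∀ c : Fin (n + 2), (Equiv.swap i.castSucc i.succ c).val =
      if c.val = i.val then i.val + 1 else if c.val = i.val + 1 then i.val else c.val := by
    intro c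
    simp only [Equiv.swap_apply_def, Fin.ext_iff, Fin.val_castSucc, Fin.val_succ]
    split_ifs <;> rfl
  simp only [Ne, Prod.mk.injEq, Fin.ext_iff, Fin.lt_def, hv, Fin.val_castSucc, Fin.val_succ]
    at h hab ⊢
  split_ifs <;> omega

/-- All factors except that of the simple root are permuted; the exceptional one, `c_k(x_i /
x_{i+1})⁻¹`, becomes `c_k(x_{i+1} / x_i)⁻¹`, and each is cancelled by the extra factor on its side.
-/
theorem simpleRefl_smul_starWeight (i : Fin (n + 1)) :
    (simpleRefl i • starWeight n k q) * ck k (toRat (xratio i.succ i.castSucc)) =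
      starWeight n k q * ck k (toRat (xratio i.castSucc i.succ)) := by
  have hs : ∀ a b : Fin (n + 2), simpleRefl i • (ck k (toRat (xratio a b)))⁻¹ =
      (ck k (toRat (xratio (Equiv.swap i.castSucc i.succ a) (Equiv.swap i.castSucc i.succ b)) :
        RatFun (n + 2) q))⁻¹ := by
    intro a b
    rw [smul_inv'', smul_ck', simpleRefl, perm_smul_toRat_xratio]
  have hmem : (i.castSucc, i.succ) ∈ Finset.univ.filter
      fun p : Fin (n + 2) × Fin (n + 2) => p.1 < p.2 := by
    simp
  rw [starWeight, ← Finset.mul_prod_erase _ _ hmem, smul_mul', hs, Equiv.swap_apply_left,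
    Equiv.swap_apply_right, Finset.smul_prod', mul_right_comm, inv_mul_cancel₀ (ck_ne_zero
      Fin.castSucc_lt_succ.ne'), mul_right_comm, inv_mul_cancel₀ (ck_ne_zero
      Fin.castSucc_lt_succ.ne), one_mul, one_mul]
  refine Finset.prod_equiv
    ((Equiv.swap i.castSucc i.succ).prodCongr (Equiv.swap i.castSucc i.succ)) ?_ fun p _ => hs _ _
  rintro ⟨a, b⟩
  simp only [Finset.mem_erase, Finset.mem_filter, Finset.mem_univ, true_and, Equiv.prodCongr_apply,
    Prod.map_apply]
  refine ⟨fun h => (swap_lt_swap h.2 h.1).symm, fun h => ?_⟩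
  have := swap_lt_swap h.2 h.1
  rw [Equiv.swap_apply_self, Equiv.swap_apply_self] at this
  exact this.symm

theorem unop_smashAnti_mem_H0 {a : Smash (n + 2) q} (ha : a ∈ H0 n k q) :
    (smashAnti (starWeight n k q) starWeight_ne_zero a).unop ∈ H0 n k q := by
  induction ha using Algebra.adjoin_induction with
  | mem a ha =>
    obtain ⟨i, rfl⟩ := ha
    rw [smashAnti_heckeT _ _ (simpleRefl_smul_starWeight i)]
    exact heckeT_mem_H0 i
  | algebraMap c =>
    rw [algebraMap_smash, smashAnti_ratX]
    exact algebraMap_mem (H0 n k q) c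
  | add a b _ _ ha hb =>
    rw [map_add, MulOpposite.unop_add]
    exact add_mem ha hb
  | mul a b _ _ ha hb =>
    rw [map_mul, MulOpposite.unop_mul]
    exact mul_mem hb ha

/-- The anti-involution of `H_0` fixing the generators `T_i`. -/
def starH0 : H0 n k q →ₗ[ℂ] H0 n k q where
  toFun a := ⟨(smashAnti (starWeight n k q) starWeight_ne_zero a).unop, unop_smashAnti_mem_H0 a.2⟩
  map_add' a b := Subtype.ext (by
    simp only [Subalgebra.coe_add, map_add, MulOpposite.unop_add])
  map_smul' c a := Subtype.ext (by
    change (smashAnti (starWeight n k q) starWeight_ne_zero (c • (a : Smash (n + 2) q))).unop =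
      c • (smashAnti (starWeight n k q) starWeight_ne_zero (a : Smash (n + 2) q)).unop
    rw [Algebra.smul_def, map_mul, algebraMap_smash, smashAnti_ratX, MulOpposite.unop_mul,
      MulOpposite.unop_op, ← algebraMap_smash, ← Algebra.commutes, Algebra.smul_def])

theorem starH0_mul (a b : H0 n k q) : starH0 (a * b) = starH0 b * starH0 a :=
  Subtype.ext (by
    change (smashAnti (starWeight n k q) starWeight_ne_zero
      ((a : Smash (n + 2) q) * (b : Smash (n + 2) q))).unop = _
    rw [map_mul, MulOpposite.unop_mul]
    rfl)

theorem starH0_one : starH0 (1 : H0 n k q) = 1 :=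
  Subtype.ext (by
    change (smashAnti (starWeight n k q) starWeight_ne_zero 1).unop = 1
    rw [map_one, MulOpposite.unop_one])

theorem starH0_genT0 (i : Fin (n + 1)) : starH0 (genT0 i : H0 n k q) = genT0 i :=
  Subtype.ext (congrArg MulOpposite.unop
    (smashAnti_heckeT starWeight_ne_zero i (simpleRefl_smul_starWeight i)))

theorem starH0_starH0 (a : H0 n k q) : starH0 (starH0 a) = a := by
  induction a using H0_induction with
  | hT i => rw [starH0_genT0, starH0_genT0]
  | hc c => rw [Algebra.algebraMap_eq_smul_one, map_smul, map_smul, starH0_one, starH0_one]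
  | hadd a b ha hb => rw [map_add, map_add, ha, hb]
  | hmul a b ha hb => rw [starH0_mul, starH0_mul, ha, hb]

/-! ### The duality anti-involution -/

theorem linearMap_ext_pbw {M : Type*} [AddCommMonoid M] [Module ℂ M] {F G : DAHA n k q →ₗ[ℂ] M}
    (h : ∀ (f : Laurent (n + 2) q) (h : H0 n k q) (g : Laurent (n + 2) q),
      F (opXHom f * inclH0 h * opYHom g) = G (opXHom f * inclH0 h * opYHom g)) : F = G := by
  refine LinearMap.ext_on span_opX_mul_inclH0_mul_opYHom ?_
  rintro _ ⟨f, a, g, rfl⟩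
  exact h f a g

theorem Xpow_eq (v : Fin (n + 2) → ℤ) :
    (Xpow v : DAHA n k q) = opXHom (xpow (Multiplicative.ofAdd v)) := rfl

theorem Ypow_eq_opYHom (v : Fin (n + 2) → ℤ) :
    (Ypow v : DAHA n k q) = opYHom (xpow (Multiplicative.ofAdd v)) := (opYHom_xpow _).symm

/-- The map `f(X) h g(Y) ↦ g^◇(X) h^* f^◇(Y)`. -/
def dualMap (n : ℕ) (k q : ℂˣ) : DAHA n k q →ₗ[ℂ] DAHA n k q :=
  (pbwBasis n k q).constr ℂ fun p =>
    Xpow (-p.2.2) * inclH0 (starH0 (Module.finBasis ℂ (H0 n k q) p.2.1)) * Ypow (-p.1)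

theorem dualMap_apply (f : Laurent (n + 2) q) (h : H0 n k q) (g : Laurent (n + 2) q) :
    dualMap n k q (opXHom f * inclH0 h * opYHom g) =
      opXHom (diamondFun g) * inclH0 (starH0 h) * opYHom (diamondFun f) := by
  induction f using Laurent.induction with
  | hx u =>
    induction g using Laurent.induction with
    | hx v =>
      have hb : ∀ i, dualMap n k q (opXHom (xpow u) *
          inclH0 (Module.finBasis ℂ (H0 n k q) i) * opYHom (xpow v)) =
          opXHom (xpow v⁻¹) * inclH0 (starH0 (Module.finBasis ℂ (H0 n k q) i)) *
            opYHom (xpow u⁻¹) := by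
        intro i
        have := (pbwBasis n k q).constr_basis ℂ (fun p => (Xpow (-p.2.2) *
          inclH0 (starH0 (Module.finBasis ℂ (H0 n k q) p.2.1)) * Ypow (-p.1) : DAHA n k q))
          (u.toAdd, i, v.toAdd)
        rw [pbwBasis_apply, Ypow_eq_opYHom, Ypow_eq_opYHom, Xpow_eq, Xpow_eq] at this
        exact this
      rw [← (Module.finBasis ℂ (H0 n k q)).sum_repr h]
      simp only [map_sum, map_smul starH0, map_smul inclH0, Finset.mul_sum, Finset.sum_mul,
        mul_smul_comm, smul_mul_assoc, map_smul (dualMap n k q), hb, diamondFun_xpow]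
    | hadd f g hf hg =>
      rw [map_add, map_add, mul_add, map_add, hf, hg, map_add, add_mul, add_mul]
    | hsmul c f hf =>
      rw [map_smul, map_smul, mul_smul_comm, map_smul, hf, map_smul, smul_mul_assoc,
        smul_mul_assoc]
  | hadd f g hf hg =>
    rw [map_add, map_add, add_mul, add_mul, map_add, hf, hg, map_add, mul_add]
  | hsmul c f hf =>
    rw [map_smul, map_smul, smul_mul_assoc, smul_mul_assoc, map_smul, hf, map_smul, mul_smul_comm]

theorem dualMap_opXHom (f : Laurent (n + 2) q) :
    dualMap n k q (opXHom f) = opYHom (diamondFun f) := by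
  have := dualMap_apply (k := k) f 1 1
  simpa only [map_one, mul_one, one_mul, starH0_one] using this

theorem dualMap_opYHom (f : Laurent (n + 2) q) :
    dualMap n k q (opYHom f) = opXHom (diamondFun f) := by
  have := dualMap_apply (k := k) 1 1 f
  simpa only [map_one, mul_one, one_mul, starH0_one] using this

theorem dualMap_inclH0 (h : H0 n k q) : dualMap n k q (inclH0 h) = inclH0 (starH0 h) := by
  have := dualMap_apply 1 h 1
  simpa only [map_one, mul_one, one_mul] using this

theorem dualMap_one : dualMap n k q 1 = 1 := by
  have := dualMap_opXHom (n := n) (k := k) (q := q) 1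
  simpa only [map_one] using this

theorem dualMap_dualMap (x : DAHA n k q) : dualMap n k q (dualMap n k q x) = x := by
  suffices (dualMap n k q).comp (dualMap n k q) = LinearMap.id from LinearMap.congr_fun this x
  refine linearMap_ext_pbw fun f h g => ?_
  rw [LinearMap.comp_apply, dualMap_apply, dualMap_apply, diamondFun_diamondFun,
    diamondFun_diamondFun, starH0_starH0, LinearMap.id_apply]

/-! ### The duality reverses products -/

theorem dualMap_mul_of_pbw {a : DAHA n k q}
    (h : ∀ (f : Laurent (n + 2) q) (h : H0 n k q) (g : Laurent (n + 2) q),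
      dualMap n k q (a * (opXHom f * inclH0 h * opYHom g)) =
        dualMap n k q (opXHom f * inclH0 h * opYHom g) * dualMap n k q a) (b : DAHA n k q) :
    dualMap n k q (a * b) = dualMap n k q b * dualMap n k q a := by
  suffices (dualMap n k q).comp (LinearMap.mulLeft ℂ a) =
      (LinearMap.mulRight ℂ (dualMap n k q a)).comp (dualMap n k q) from
    LinearMap.congr_fun this b
  exact linearMap_ext_pbw h

theorem dualMap_mul_of_pbw' {b : DAHA n k q}
    (h : ∀ (f : Laurent (n + 2) q) (h : H0 n k q) (g : Laurent (n + 2) q),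
      dualMap n k q (opXHom f * inclH0 h * opYHom g * b) =
        dualMap n k q b * dualMap n k q (opXHom f * inclH0 h * opYHom g)) (a : DAHA n k q) :
    dualMap n k q (a * b) = dualMap n k q b * dualMap n k q a := by
  suffices (dualMap n k q).comp (LinearMap.mulRight ℂ b) =
      (LinearMap.mulLeft ℂ (dualMap n k q b)).comp (dualMap n k q) from
    LinearMap.congr_fun this a
  exact linearMap_ext_pbw h

theorem dualMap_opXHom_mul (f : Laurent (n + 2) q) (b : DAHA n k q) :
    dualMap n k q (opXHom f * b) = dualMap n k q b * opYHom (diamondFun f) := by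
  rw [← dualMap_opXHom]
  refine dualMap_mul_of_pbw (fun f' h g => ?_) b
  rw [← mul_assoc, ← mul_assoc, ← map_mul, dualMap_apply, dualMap_apply, dualMap_opXHom,
    mul_comm f f', map_mul diamondFun, map_mul opYHom, ← mul_assoc]

theorem dualMap_mul_opYHom (g : Laurent (n + 2) q) (a : DAHA n k q) :
    dualMap n k q (a * opYHom g) = opXHom (diamondFun g) * dualMap n k q a := by
  rw [← dualMap_opYHom]
  refine dualMap_mul_of_pbw' (fun f h g' => ?_) a
  rw [mul_assoc, ← map_mul, dualMap_apply, dualMap_apply, dualMap_opYHom, ← mul_assoc, ← mul_assoc,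
    ← map_mul, ← map_mul, mul_comm g g']

/-- On a product `f(X) h g(Y)`, the Bernstein relation in `X` used before dualising and the one in
`Y` used after it give the same result, because their error terms coincide. -/
theorem dualMap_genT_mul (i : Fin (n + 1)) (b : DAHA n k q) :
    dualMap n k q (genT i * b) = dualMap n k q b * genT i := by
  have hT : dualMap n k q (genT i) = genT i := by
    rw [← inclH0_genT0, dualMap_inclH0, starH0_genT0]
  have key := dualMap_mul_of_pbw (a := genT i) (fun f h g => ?_) b
  · rw [key, hT]
  · obtain ⟨e, he⟩ := exists_bernsteinRel k i f
    have h1 : genT i * (opXHom f * inclH0 h * opYHom g) =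
        opXHom (simpleRefl i • f) * inclH0 (genT0 i * h) * opYHom g +
          opXHom e * inclH0 h * opYHom g := by
      rw [map_mul, inclH0_genT0, ← mul_assoc, ← mul_assoc, he.1, add_mul, add_mul]
      simp only [mul_assoc]
    rw [h1, map_add, dualMap_apply, dualMap_apply, dualMap_apply, hT, starH0_mul, starH0_genT0,
      map_mul, inclH0_genT0, mul_assoc _ (opYHom (diamondFun f)), he.2, mul_add]
    simp only [mul_assoc]

theorem dualMap_mul_genT (i : Fin (n + 1)) (a : DAHA n k q) :
    dualMap n k q (a * genT i) = genT i * dualMap n k q a := by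
  have hT : dualMap n k q (genT i) = genT i := by
    rw [← inclH0_genT0, dualMap_inclH0, starH0_genT0]
  have key := dualMap_mul_of_pbw' (b := genT i) (fun f h g => ?_) a
  · rw [key, hT]
  · obtain ⟨e, he⟩ := exists_bernsteinRel k i (diamondFun g)
    have h2 := he.2
    rw [diamondFun_diamondFun] at h2
    have h1 : opXHom f * inclH0 h * opYHom g * genT i =
        opXHom f * inclH0 (h * genT0 i) * opYHom (diamondFun (simpleRefl i • diamondFun g)) +
          opXHom f * inclH0 h * opYHom (diamondFun e) := by
      rw [map_mul, inclH0_genT0, mul_assoc, h2, mul_add]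
      simp only [mul_assoc]
    rw [h1, map_add, dualMap_apply, dualMap_apply, dualMap_apply, hT, starH0_mul, starH0_genT0,
      map_mul, inclH0_genT0, ← mul_assoc (genT i), ← mul_assoc (genT i), he.1, add_mul, add_mul,
      diamondFun_diamondFun, diamondFun_diamondFun]
    simp only [mul_assoc]

theorem dualMap_mul_inclH0 (h : H0 n k q) (a : DAHA n k q) :
    dualMap n k q (a * inclH0 h) = inclH0 (starH0 h) * dualMap n k q a := by
  induction h using H0_induction generalizing a with
  | hT i => rw [inclH0_genT0, dualMap_mul_genT, starH0_genT0, inclH0_genT0]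
  | hc c =>
    rw [Algebra.algebraMap_eq_smul_one, map_smul, map_smul, map_smul, starH0_one, map_one,
      mul_smul_comm, mul_one, map_smul, smul_mul_assoc, one_mul]
  | hadd b c hb hc => rw [map_add, mul_add, map_add, hb, hc, map_add, map_add, add_mul]
  | hmul b c hb hc => rw [map_mul inclH0, ← mul_assoc, hc, hb, starH0_mul, map_mul inclH0, mul_assoc]

theorem inclH0_starH0_descProd {h : H0 n k q} {l : ℕ} (hl : l ≤ n + 1)
    (hh : inclH0 h = ((descProd (natExt unitT) l : (DAHA n k q)ˣ) : DAHA n k q)) :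
    inclH0 (starH0 h) = ((ascProd (natExt unitT) l : (DAHA n k q)ˣ) : DAHA n k q) := by
  rw [← dualMap_inclH0, hh]
  clear hh
  induction l with
  | zero => rw [descProd, ascProd, Units.val_one, dualMap_one]
  | succ l ih =>
    rw [descProd, ascProd, Units.val_mul, Units.val_mul, natExt_of_lt _ hl, ← ih (by omega)]
    exact dualMap_genT_mul _ _

/-- `π = Y_1 (T_{N-1} ⋯ T_1)⁻¹`; on `H_0` the order is reversed, and `Y_1` goes to `X_1⁻¹`. -/
theorem dualMap_unitPi : dualMap n k q ((unitPi : (DAHA n k q)ˣ) : DAHA n k q) =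
    ((unitDualPi : (DAHA n k q)ˣ) : DAHA n k q) := by
  obtain ⟨h, hh⟩ := exists_inclH0_eq_descProd (k := k) (q := q) (le_refl (n + 1))
  obtain ⟨h', hh'⟩ := exists_inclH0_eq_inv_descProd (k := k) (q := q) (le_refl (n + 1))
  have hstar := inclH0_starH0_descProd le_rfl hh
  have hmul : h * h' = 1 := by
    refine Subalgebra.inclusion_injective (H0_le_DAHA n k q) ?_
    change inclH0 (h * h') = inclH0 1
    rw [map_mul, hh, hh', Units.mul_inv, map_one]
  have hinv : inclH0 (starH0 h') =
      (((ascProd (natExt unitT) (n + 1))⁻¹ : (DAHA n k q)ˣ) : DAHA n k q) := by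
    refine (Units.eq_inv_of_mul_eq_one_right ?_)
    rw [← hstar, ← map_mul, ← starH0_mul, hmul, starH0_one, map_one]
  have hx : (opXHom (diamondFun (xcoord 0)) : DAHA n k q) =
      (((unitX 0)⁻¹ : (DAHA n k q)ˣ) : DAHA n k q) := by
    refine (Units.eq_inv_of_mul_eq_one_right ?_)
    rw [val_unitX, ← opXHom_apply, ← map_mul, xcoord, diamondFun_xpow, ← map_mul, inv_mul_cancel,
      map_one, map_one]
  rw [unitPi_eq, Units.val_mul, ← hh', dualMap_mul_inclH0, hinv, ← opYHom_xcoord, dualMap_opYHom,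
    hx, unitDualPi_eq, Units.val_mul]

/-- After moving `π` past `f(X)`, the claim becomes `f^◇(Y) π^* = π^* (π f)^◇(Y)`, the outcome of
the braid group computation. -/
theorem dualMap_unitPi_mul (b : DAHA n k q) :
    dualMap n k q (((unitPi : (DAHA n k q)ˣ) : DAHA n k q) * b) =
      dualMap n k q b * ((unitDualPi : (DAHA n k q)ˣ) : DAHA n k q) := by
  rw [← dualMap_unitPi]
  refine dualMap_mul_of_pbw (fun f h g => ?_) b
  have hpi : ((unitPi : (DAHA n k q)ˣ) : DAHA n k q) * opXHom f =
      opXHom (piElt n • f) * ((unitPi : (DAHA n k q)ˣ) : DAHA n k q) := unitPi_mul_opX f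
  rw [← mul_assoc, ← mul_assoc, dualMap_mul_opYHom, dualMap_mul_inclH0, hpi, dualMap_opXHom_mul,
    dualMap_unitPi, ← opYHom_diamondFun_mul_unitDualPi, dualMap_apply]
  simp only [mul_assoc]

theorem dualMap_unitPi_inv_mul (b : DAHA n k q) :
    dualMap n k q (((unitPi⁻¹ : (DAHA n k q)ˣ) : DAHA n k q) * b) =
      dualMap n k q b * ((unitDualPi⁻¹ : (DAHA n k q)ˣ) : DAHA n k q) := by
  rw [Units.eq_mul_inv_iff_mul_eq, ← dualMap_unitPi_mul, Units.mul_inv_cancel_left]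

theorem dualMap_mul (a b : DAHA n k q) :
    dualMap n k q (a * b) = dualMap n k q b * dualMap n k q a := by
  let U : Submodule ℂ (DAHA n k q) :=
    { carrier := {a | ∀ b, dualMap n k q (a * b) = dualMap n k q b * dualMap n k q a}
      add_mem' := fun {x y} hx hy b => by
        rw [add_mul, map_add, hx b, hy b, map_add, mul_add]
      zero_mem' := fun b => by rw [zero_mul, map_zero, mul_zero]
      smul_mem' := fun c x hx b => by
        rw [smul_mul_assoc, map_smul, hx b, map_smul, mul_smul_comm] }
  -- If left multiplication by `x` dualises to right multiplication by some `y`, then `U` is stable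
  -- under `x`; that `y` is the dual of `x` follows by applying this to `1`-multiples and is not
  -- assumed.
  have hmul : ∀ x y : DAHA n k q, (∀ b, dualMap n k q (x * b) = dualMap n k q b * y) →
      ∀ a ∈ U, x * a ∈ U := by
    intro x y hx a ha b
    rw [mul_assoc, hx, ha b, hx, mul_assoc]
  have hU : U = ⊤ := eq_top_of_closed (fun b => by rw [one_mul, dualMap_one, mul_one])
    (fun i => hmul _ _ (dualMap_genT_mul i)) (hmul _ _ dualMap_unitPi_mul)
    (hmul _ _ dualMap_unitPi_inv_mul) (fun f => hmul _ _ (dualMap_opXHom_mul f))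
  exact (hU ▸ Submodule.mem_top : a ∈ U) b

theorem isDuality_dualMap : IsDuality (dualMap n k q) where
  map_one := dualMap_one
  map_mul := dualMap_mul
  involutive := dualMap_dualMap
  map_T i := by rw [← inclH0_genT0, dualMap_inclH0, starH0_genT0]
  map_Y v := by rw [Ypow_eq_opYHom, dualMap_opYHom, diamondFun_xpow, Xpow_eq, ofAdd_neg]
  map_X v := by rw [Xpow_eq, dualMap_opXHom, diamondFun_xpow, Ypow_eq_opYHom, ofAdd_neg]

theorem IsDuality.eq_dualMap {s : DAHA n k q →ₗ[ℂ] DAHA n k q} (hs : IsDuality s) :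
    s = dualMap n k q := by
  have hX : ∀ f, s (opXHom f) = dualMap n k q (opXHom f) := by
    intro f
    induction f using Laurent.induction with
    | hx v =>
      have h1 := hs.map_X v.toAdd
      rw [← isDuality_dualMap.map_X v.toAdd] at h1
      exact h1
    | hadd f g hf hg => rw [map_add, map_add, hf, hg, map_add]
    | hsmul c f hf => rw [map_smul, map_smul, hf, map_smul]
  have hY : ∀ f, s (opYHom f) = dualMap n k q (opYHom f) := by
    intro f
    induction f using Laurent.induction with
    | hx v =>
      have h1 := hs.map_Y v.toAdd
      rw [← isDuality_dualMap.map_Y v.toAdd] at h1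
      rw [opYHom_xpow]
      exact h1
    | hadd f g hf hg => rw [map_add, map_add, hf, hg, map_add]
    | hsmul c f hf => rw [map_smul, map_smul, hf, map_smul]
  have hT : ∀ h, s (inclH0 h) = dualMap n k q (inclH0 h) := by
    intro h
    induction h using H0_induction with
    | hT i => rw [inclH0_genT0, hs.map_T, isDuality_dualMap.map_T]
    | hc c => rw [Algebra.algebraMap_eq_smul_one, map_smul, map_smul, _root_.map_one, hs.map_one, map_smul,
        isDuality_dualMap.map_one]
    | hadd f g hf hg => rw [map_add, map_add, hf, hg, map_add]
    | hmul f g hf hg => rw [_root_.map_mul, hs.map_mul, hf, hg, isDuality_dualMap.map_mul]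
  refine linearMap_ext_pbw fun f h g => ?_
  rw [hs.map_mul, hs.map_mul, hX, hY, hT, dualMap_mul, dualMap_mul]

theorem existsUnique_isDuality (n : ℕ) (k q : ℂˣ) :
    ∃! s : DAHA n k q →ₗ[ℂ] DAHA n k q, IsDuality s :=
  ⟨dualMap n k q, isDuality_dualMap, fun _ hs => hs.eq_dualMap⟩

/-! ### The canonical map -/

theorem Hol.ext {N : ℕ} {q : ℂˣ} {f g : Hol N q} (h : ∀ p, f.toFun p = g.toFun p) : f = g :=
  Hol.toFun_injective (funext h)

/-- `f(x)` as an analytic function on `T × T`. -/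
def holX {N : ℕ} {q : ℂˣ} : Laurent N q →ₐ[ℂ] Hol N q where
  toFun f := ⟨fun p => f.eval p.1, evalFst_mem f⟩
  map_one' := Hol.ext fun p => map_one (Laurent.eval (q := q) p.1)
  map_mul' f g := Hol.ext fun p => map_mul (Laurent.eval p.1) f g
  map_zero' := Hol.ext fun p => map_zero (Laurent.eval (q := q) p.1)
  map_add' f g := Hol.ext fun p => map_add (Laurent.eval p.1) f g
  commutes' c := Hol.ext fun p => (Laurent.eval (q := q) p.1).commutes c

/-- `f(y)` as an analytic function on `T × T`. -/
def holY {N : ℕ} {q : ℂˣ} : Laurent N q →ₐ[ℂ] Hol N q where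
  toFun f := ⟨fun p => f.eval p.2, evalSnd_mem f⟩
  map_one' := Hol.ext fun p => map_one (Laurent.eval (q := q) p.2)
  map_mul' f g := Hol.ext fun p => map_mul (Laurent.eval p.2) f g
  map_zero' := Hol.ext fun p => map_zero (Laurent.eval (q := q) p.2)
  map_add' f g := Hol.ext fun p => map_add (Laurent.eval p.2) f g
  commutes' c := Hol.ext fun p => (Laurent.eval (q := q) p.2).commutes c

/-- `f ↦ f(x)` as an algebra homomorphism. -/
def inXHom {N : ℕ} {q : ℂˣ} : Laurent N q →ₐ[ℂ] Mer N q :=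
  (IsScalarTower.toAlgHom ℂ (Hol N q) (Mer N q)).comp holX

/-- `f ↦ f(y)` as an algebra homomorphism. -/
def inYHom {N : ℕ} {q : ℂˣ} : Laurent N q →ₐ[ℂ] Mer N q :=
  (IsScalarTower.toAlgHom ℂ (Hol N q) (Mer N q)).comp holY

theorem bw_inv {N : ℕ} (w w' : W N) : (bw w w')⁻¹ = bw w⁻¹ w'⁻¹ := (map_inv _ _).symm

theorem bw_mul {N : ℕ} (w w' v v' : W N) : bw (w * v) (w' * v') = bw w w' * bw v v' :=
  map_mul SemidirectProduct.inl (w, w') (v, v')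

theorem bw_one {N : ℕ} : (bw 1 1 : BW N) = 1 := map_one SemidirectProduct.inl

theorem bwIota_mul_bwIota {N : ℕ} : (bwIota * bwIota : BW N) = 1 :=
  (map_mul SemidirectProduct.inr _ _).symm.trans (map_one SemidirectProduct.inr)

theorem bw_smul_inXHom {N : ℕ} {q : ℂˣ} (w w' : W N) (f : Laurent N q) :
    bw w w' • inXHom f = inXHom (w • f) := by
  refine (smul_algebraMap_mer _ _).trans (congrArg _ (Hol.ext fun p => ?_))
  rw [Hol.smul_toFun, bw_inv, pairAct_bw]
  exact (laurentAct_eval q w f p.1).symm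

theorem bw_smul_inYHom {N : ℕ} {q : ℂˣ} (w w' : W N) (f : Laurent N q) :
    bw w w' • inYHom f = inYHom (diamondFun (w' • diamondFun f)) := by
  refine (smul_algebraMap_mer _ _).trans (congrArg _ (Hol.ext fun p => ?_))
  rw [Hol.smul_toFun, bw_inv, pairAct_bw]
  change f.eval (torusAct q (diamond N w'⁻¹) p.2) = (diamondFun (w' • diamondFun f)).eval p.2
  rw [diamondFun_eval]
  refine Eq.trans ?_ (laurentAct_eval q w' (diamondFun f) p.2⁻¹).symm
  rw [diamondFun_eval, torusAct_inv_diamond, inv_inv]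

theorem bwIota_smul_inXHom {N : ℕ} {q : ℂˣ} (f : Laurent N q) :
    (bwIota : BW N) • inXHom f = inYHom (diamondFun f) := by
  refine (smul_algebraMap_mer _ _).trans (congrArg _ (Hol.ext fun p => ?_))
  rw [Hol.smul_toFun, inv_eq_of_mul_eq_one_left bwIota_mul_bwIota, pairAct_iota]
  exact (diamondFun_eval f p.2).symm

theorem bwIota_smul_inYHom {N : ℕ} {q : ℂˣ} (f : Laurent N q) :
    (bwIota : BW N) • inYHom f = inXHom (diamondFun f) := by
  refine (smul_algebraMap_mer _ _).trans (congrArg _ (Hol.ext fun p => ?_))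
  rw [Hol.smul_toFun, inv_eq_of_mul_eq_one_left bwIota_mul_bwIota, pairAct_iota]
  exact (diamondFun_eval f p.1).symm

theorem eval_eq_zero_of_inXHom_eq_zero {N : ℕ} {q : ℂˣ} {f : Laurent N q} (h : inXHom f = 0)
    (t : Torus N) : f.eval t = 0 := by
  have h1 : holX f = 0 := IsFractionRing.injective (Hol N q) (Mer N q) (h.trans (map_zero _).symm)
  have h2 := congrFun (congrArg Hol.toFun h1) (t, t)
  rw [map_zero] at h2
  exact h2

theorem inXHom_sub_smul_xratio_ne_zero {N : ℕ} {q : ℂˣ} (a : ℂ) (c : ℂˣ) {i j : Fin N}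
    (hij : i ≠ j) : inXHom (algebraMap ℂ (Laurent N q) a - (c : ℂ) • xratio i j) ≠ 0 := by
  intro h
  -- A nonzero coefficient of the ratio makes the function nonconstant; the points where the ratio
  -- is `1` and `2` already separate it from zero.
  have key : ∀ b : ℂˣ, a - c * b = 0 := by
    intro b
    have h2 := eval_eq_zero_of_inXHom_eq_zero h (Function.update 1 i b)
    rw [map_sub, map_smul, xratio, Laurent.eval_xpow, Finset.prod_eq_single i,
      AlgHom.commutes] at h2
    · simpa [hij] using h2
    · intro l _ hl
      simp [Function.update_of_ne hl]
    · simp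
  have h3 := key 1
  have h4 := key (Units.mk0 (2 : ℂ) two_ne_zero)
  simp only [Units.val_one, mul_one, Units.val_mk0] at h3 h4
  exact c.ne_zero (by linear_combination h3 - h4)

/-- The map `f(X) h g(Y) ↦ f(x) g(y) ⊗ h`. -/
def canonicalMap (n : ℕ) (k q : ℂˣ) : DAHA n k q →ₗ[ℂ] H0K n k q :=
  (pbwBasis n k q).constr ℂ fun p =>
    (inXHom (xpow (Multiplicative.ofAdd p.1)) * inYHom (xpow (Multiplicative.ofAdd p.2.2))) ⊗ₜ[ℂ]
      Module.finBasis ℂ (H0 n k q) p.2.1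

theorem canonicalMap_apply (f : Laurent (n + 2) q) (h : H0 n k q) (g : Laurent (n + 2) q) :
    canonicalMap n k q (opXHom f * inclH0 h * opYHom g) = (inXHom f * inYHom g) ⊗ₜ[ℂ] h := by
  induction f using Laurent.induction with
  | hx u =>
    induction g using Laurent.induction with
    | hx v =>
      have hb : ∀ i, canonicalMap n k q (opXHom (xpow u) *
          inclH0 (Module.finBasis ℂ (H0 n k q) i) * opYHom (xpow v)) =
          (inXHom (xpow u) * inYHom (xpow v)) ⊗ₜ[ℂ] Module.finBasis ℂ (H0 n k q) i := by
        intro i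
        have := (pbwBasis n k q).constr_basis ℂ (fun p =>
          ((inXHom (xpow (Multiplicative.ofAdd p.1)) *
            inYHom (xpow (Multiplicative.ofAdd p.2.2))) ⊗ₜ[ℂ]
              Module.finBasis ℂ (H0 n k q) p.2.1 : H0K n k q)) (u.toAdd, i, v.toAdd)
        rw [pbwBasis_apply, Ypow_eq_opYHom, Xpow_eq] at this
        exact this
      rw [← (Module.finBasis ℂ (H0 n k q)).sum_repr h]
      simp only [map_sum, map_smul inclH0, Finset.mul_sum, Finset.sum_mul, mul_smul_comm,
        smul_mul_assoc, map_smul (canonicalMap n k q), hb, TensorProduct.tmul_sum,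
        TensorProduct.tmul_smul]
    | hadd f g hf hg =>
      rw [map_add, map_add, mul_add, map_add, hf, hg, mul_add, TensorProduct.add_tmul]
    | hsmul c f hf =>
      rw [map_smul, map_smul, mul_smul_comm, map_smul, hf, mul_smul_comm, TensorProduct.smul_tmul']
  | hadd f g hf hg =>
    rw [map_add, map_add, add_mul, add_mul, map_add, hf, hg, add_mul, TensorProduct.add_tmul]
  | hsmul c f hf =>
    rw [map_smul, map_smul, smul_mul_assoc, smul_mul_assoc, map_smul, hf, smul_mul_assoc,
      TensorProduct.smul_tmul']

theorem isCanonicalMap_canonicalMap : IsCanonicalMap (canonicalMap n k q) := fun f g h => by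
  rw [← opYHom_apply]
  exact canonicalMap_apply f h g

theorem IsCanonicalMap.eq_canonicalMap {j : DAHA n k q →ₗ[ℂ] H0K n k q} (hj : IsCanonicalMap j) :
    j = canonicalMap n k q := by
  refine linearMap_ext_pbw fun f h g => ?_
  have := hj f g h
  rw [← opYHom_apply] at this
  rw [canonicalMap_apply]
  exact this

theorem canonicalMap_inclH0 (h : H0 n k q) : canonicalMap n k q (inclH0 h) = 1 ⊗ₜ[ℂ] h := by
  have := canonicalMap_apply 1 h 1
  simpa only [map_one, mul_one, one_mul] using this

theorem canonicalMap_opXHom_mul (f : Laurent (n + 2) q) (x : DAHA n k q) :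
    canonicalMap n k q (opXHom f * x) = inXHom f • canonicalMap n k q x := by
  suffices (canonicalMap n k q).comp (LinearMap.mulLeft ℂ (opXHom f)) =
      (Algebra.lsmul ℂ ℂ (H0K n k q) (inXHom f)).comp (canonicalMap n k q) from
    LinearMap.congr_fun this x
  refine linearMap_ext_pbw fun f' h g => ?_
  rw [LinearMap.comp_apply, LinearMap.comp_apply, LinearMap.mulLeft_apply, Algebra.lsmul_coe,
    ← mul_assoc, ← mul_assoc, ← map_mul opXHom, canonicalMap_apply, canonicalMap_apply]
  beta_reduce
  rw [TensorProduct.smul_tmul', smul_eq_mul, map_mul inXHom, mul_assoc]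

theorem canonicalMap_mul_opYHom (g : Laurent (n + 2) q) (x : DAHA n k q) :
    canonicalMap n k q (x * opYHom g) = inYHom g • canonicalMap n k q x := by
  suffices (canonicalMap n k q).comp (LinearMap.mulRight ℂ (opYHom g)) =
      (Algebra.lsmul ℂ ℂ (H0K n k q) (inYHom g)).comp (canonicalMap n k q) from
    LinearMap.congr_fun this x
  refine linearMap_ext_pbw fun f h g' => ?_
  rw [LinearMap.comp_apply, LinearMap.comp_apply, LinearMap.mulRight_apply, Algebra.lsmul_coe,
    mul_assoc, ← map_mul opYHom, canonicalMap_apply, canonicalMap_apply]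
  beta_reduce
  rw [TensorProduct.smul_tmul', smul_eq_mul, mul_comm g' g, map_mul inYHom, mul_left_comm]

/-! ### Semilinear extensions -/

/-- A map of `H0K` that is semilinear for the action of `g` on the coefficients. -/
def IsSemilinear (g : BW (n + 2)) (E : H0K n k q →ₗ[ℂ] H0K n k q) : Prop :=
  ∀ (a : Mer (n + 2) q) (u : H0K n k q), E (a • u) = (g • a) • E u

/-- The image of `j` contains all `1 ⊗ h`, which span `H_0^𝕂` over `𝕂`. This gives every uniqueness
claim for the extensions and reduces identities between them to `ℍ`. -/
theorem IsSemilinear.ext {g : BW (n + 2)} {E F : H0K n k q →ₗ[ℂ] H0K n k q}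
    (hE : IsSemilinear g E) (hF : IsSemilinear g F)
    (h : ∀ a, E (canonicalMap n k q a) = F (canonicalMap n k q a)) : E = F := by
  refine TensorProduct.ext' fun a b => ?_
  have : a ⊗ₜ[ℂ] b = a • canonicalMap n k q (inclH0 b) := by
    rw [canonicalMap_inclH0, TensorProduct.smul_tmul', smul_eq_mul, mul_one]
  rw [this, hE, hF, h]

/-- The semilinear extension of a linear map on `H_0`. -/
def semilinearExt (g : BW (n + 2)) (φ : H0 n k q →ₗ[ℂ] H0K n k q) : H0K n k q →ₗ[ℂ] H0K n k q :=
  ((φ.liftBaseChange (Mer (n + 2) q)).restrictScalars ℂ).comp (coeffAct g).toLinearMap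

theorem isSemilinear_semilinearExt (g : BW (n + 2)) (φ : H0 n k q →ₗ[ℂ] H0K n k q) :
    IsSemilinear g (semilinearExt g φ) := fun a u => by
  change φ.liftBaseChange (Mer (n + 2) q) (coeffAct g (a • u)) = _
  rw [coeffAct_smul, map_smul]
  rfl

theorem semilinearExt_tmul (g : BW (n + 2)) (φ : H0 n k q →ₗ[ℂ] H0K n k q)
    (a : Mer (n + 2) q) (h : H0 n k q) : semilinearExt g φ (a ⊗ₜ[ℂ] h) = (g • a) • φ h := by
  change φ.liftBaseChange (Mer (n + 2) q) (coeffAct g (a ⊗ₜ[ℂ] h)) = _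
  rw [coeffAct_tmul, LinearMap.liftBaseChange_tmul]

/-- The extension is built from the values of `F` on `H_0` alone; the hypothesis guarantees that it
agrees with `F` on all PBW products. -/
theorem exists_semilinear {g : BW (n + 2)} {F : DAHA n k q →ₗ[ℂ] H0K n k q}
    (hF : ∀ (f : Laurent (n + 2) q) (h : H0 n k q) (e : Laurent (n + 2) q),
      F (opXHom f * inclH0 h * opYHom e) = (g • (inXHom f * inYHom e)) • F (inclH0 h)) :
    ∃ E : H0K n k q →ₗ[ℂ] H0K n k q,
      (∀ a, E (canonicalMap n k q a) = F a) ∧ IsSemilinear g E := by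
  refine ⟨semilinearExt g (F.comp inclH0.toLinearMap), fun a => ?_, isSemilinear_semilinearExt _ _⟩
  suffices (semilinearExt g (F.comp inclH0.toLinearMap)).comp (canonicalMap n k q) = F from
    LinearMap.congr_fun this a
  refine linearMap_ext_pbw fun f h e => ?_
  rw [LinearMap.comp_apply, canonicalMap_apply, semilinearExt_tmul, hF]
  rfl

/-! ### The intertwiners -/

theorem opXHom_eq (f : Laurent (n + 2) q) :
    ((opXHom f : DAHA n k q) : Smash (n + 2) q) = ratX (toRat f) := rfl

theorem intertwiner_mul_opXHom (w : W (n + 2)) (f : Laurent (n + 2) q) :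
    intertwiner k q w * opXHom f = opXHom (w • f) * intertwiner k q w := by
  refine Subtype.ext ?_
  rw [Subalgebra.coe_mul, Subalgebra.coe_mul, intertwiner_eq, opXHom_eq, opXHom_eq, mul_assoc,
    grp_mul_ratX, smul_toRat, ← mul_assoc, ← mul_assoc, (commute_ratX _ _).eq]

/-- The image under `*` of the commutation of `S̃_w` with functions of `X`. -/
theorem opYHom_mul_dualMap_intertwiner (w : W (n + 2)) (f : Laurent (n + 2) q) :
    opYHom f * dualMap n k q (intertwiner k q w) =
      dualMap n k q (intertwiner k q w) * opYHom (diamondFun (w • diamondFun f)) := by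
  have h := congrArg (dualMap n k q) (intertwiner_mul_opXHom (k := k) w (diamondFun f))
  rwa [dualMap_mul, dualMap_mul, dualMap_opXHom, dualMap_opXHom, diamondFun_diamondFun] at h

/-- By `S̃_w = d_w(X) w`, both sides equal `(d_{wv} d_w (w d_v))(X) w v`. Denominators are cleared
so that the identity lives in `ℍ`; lengths and changes of reduced word play no role. -/
theorem opXHom_dElt_mul_intertwiner (w v : W (n + 2)) :
    opXHom (dElt k q (w * v)) * (intertwiner k q w * intertwiner k q v) =
      opXHom (dElt k q w * w • dElt k q v) * intertwiner k q (w * v) := by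
  refine Subtype.ext ?_
  have h1 : ∀ f g : Laurent (n + 2) q, toRat (f * g) = toRat f * toRat g := fun f g => map_mul _ _ _
  simp only [Subalgebra.coe_mul, intertwiner_eq, opXHom_eq]
  rw [mul_assoc (ratX (toRat (dElt k q w))), ← mul_assoc (grp w), grp_mul_ratX, smul_toRat,
    mul_assoc (ratX (toRat (w • _))), ← map_mul grp]
  simp only [← mul_assoc, ← map_mul ratX, ← h1]
  congr 3
  ring

/-- The factor `d_1` need not be evaluated, as the normalisation of `τ` cancels it. -/
theorem intertwiner_one : intertwiner k q (1 : W (n + 2)) = opXHom (dElt k q 1) := by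
  refine Subtype.ext ?_
  rw [intertwiner_eq, opXHom_eq, map_one, mul_one]

theorem inXHom_dElt_ne_zero (w : W (n + 2)) : inXHom (dElt k q w) ≠ 0 := by
  have hgen : ∀ j : Fin (n + 2), inXHom (dGen k q j) ≠ 0 := by
    intro j
    refine Fin.cases ?_ (fun i => ?_) j
    · exact inXHom_sub_smul_xratio_ne_zero _ _ Fin.last_pos.ne
    · exact inXHom_sub_smul_xratio_ne_zero _ _ Fin.castSucc_lt_succ.ne'
  have : ∀ l, inXHom (dWord k q (n := n) l) ≠ 0 := by
    intro l
    induction l with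
    | nil =>
      rw [dWord, map_one]
      exact one_ne_zero
    | cons j l ih =>
      -- The translate by `s_j` is realised by the field automorphism `(s_j, 1)` of `𝕂`, which
      -- preserves nonvanishing.
      rw [dWord, map_mul, ← bw_smul_inXHom _ 1]
      exact mul_ne_zero (hgen j) ((smul_ne_zero_iff_ne _).mpr ih)
  exact this _

theorem inYHom_diamondFun_dElt_ne_zero (w : W (n + 2)) :
    inYHom (diamondFun (dElt k q w)) ≠ 0 := by
  rw [← bwIota_smul_inXHom]
  exact (smul_ne_zero_iff_ne _).mpr (inXHom_dElt_ne_zero w)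

/-! ### The maps `σ̃` -/

/-- `S̃_w` lets `f(X)` out to the left as `(w f)(X)`, and `S̃_{w'}^*` lets `e(Y)` out to the right.
The twists are precisely the action of `(w, w')` on `f(x)` and `e(y)`. -/
theorem exists_isSigma (w w' : W (n + 2)) :
    ∃ E : H0K n k q →ₗ[ℂ] H0K n k q, IsSigma (dualMap n k q) (canonicalMap n k q) w w' E := by
  let F : DAHA n k q →ₗ[ℂ] H0K n k q := (canonicalMap n k q).comp
    ((LinearMap.mulRight ℂ (dualMap n k q (intertwiner k q w'))).comp
      (LinearMap.mulLeft ℂ (intertwiner k q w)))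
  have hF : ∀ a, F a = canonicalMap n k q
    (intertwiner k q w * a * dualMap n k q (intertwiner k q w')) := fun _ => rfl
  refine (exists_semilinear (g := bw w w') (F := F) fun f h e => ?_).imp fun E hE => hE
  have h1 : intertwiner k q w * (opXHom f * inclH0 h * opYHom e) *
      dualMap n k q (intertwiner k q w') = opXHom (w • f) * (intertwiner k q w * inclH0 h *
        dualMap n k q (intertwiner k q w')) * opYHom (diamondFun (w' • diamondFun e)) := by
    rw [mul_assoc, mul_assoc, opYHom_mul_dualMap_intertwiner, ← mul_assoc, ← mul_assoc,
      ← mul_assoc, intertwiner_mul_opXHom]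
    simp only [mul_assoc]
  rw [hF, hF, h1, canonicalMap_mul_opYHom, canonicalMap_opXHom_mul, smul_smul, smul_mul',
    bw_smul_inXHom, bw_smul_inYHom, mul_comm]

theorem existsUnique_isSigma (w w' : W (n + 2)) :
    ∃! E : H0K n k q →ₗ[ℂ] H0K n k q, IsSigma (dualMap n k q) (canonicalMap n k q) w w' E := by
  obtain ⟨E, hE⟩ := exists_isSigma (k := k) (q := q) w w'
  exact ⟨E, hE, fun F hF => IsSemilinear.ext hF.2 hE.2 fun a => (hF.1 a).trans (hE.1 a).symm⟩

theorem existsUnique_isSigmaIota (n : ℕ) (k q : ℂˣ) :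
    ∃! E : H0K n k q →ₗ[ℂ] H0K n k q, IsSigmaIota (dualMap n k q) (canonicalMap n k q) E := by
  have h := exists_semilinear (g := (bwIota : BW (n + 2)))
    (F := (canonicalMap n k q).comp (dualMap n k q)) fun f h e => by
      rw [LinearMap.comp_apply, LinearMap.comp_apply, dualMap_apply, smul_mul', bwIota_smul_inXHom,
        bwIota_smul_inYHom, canonicalMap_mul_opYHom, canonicalMap_opXHom_mul, smul_smul,
        dualMap_inclH0]
  obtain ⟨E, hE⟩ := h
  exact ⟨E, hE, fun F hF => IsSemilinear.ext hF.2 hE.2 fun a => (hF.1 a).trans (hE.1 a).symm⟩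

/-! ### The action `τ` -/

theorem IsSemilinear.comp {g g' : BW (n + 2)} {E F : H0K n k q →ₗ[ℂ] H0K n k q}
    (hE : IsSemilinear g E) (hF : IsSemilinear g' F) : IsSemilinear (g * g') (E * F) := fun a u => by
  rw [Module.End.mul_apply, Module.End.mul_apply, hF, hE, mul_smul]

theorem isSemilinear_one : IsSemilinear (1 : BW (n + 2)) (1 : H0K n k q →ₗ[ℂ] H0K n k q) :=
  fun a u => by rw [one_smul]; rfl

/-- The normalising factor `d_w(x) d_{w'}^◇(y)`. -/
def normFactor (k q : ℂˣ) (w w' : W (n + 2)) : Mer (n + 2) q :=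
  inXHom (dElt k q w) * inYHom (diamondFun (dElt k q w'))

theorem normFactor_ne_zero (w w' : W (n + 2)) : normFactor k q w w' ≠ 0 :=
  mul_ne_zero (inXHom_dElt_ne_zero w) (inYHom_diamondFun_dElt_ne_zero w')

/-- The map `d_w(x)⁻¹ d_{w'}^◇(y)⁻¹ E`. -/
def normalized (w w' : W (n + 2)) (E : H0K n k q →ₗ[ℂ] H0K n k q) : H0K n k q →ₗ[ℂ] H0K n k q :=
  (Algebra.lsmul ℂ ℂ (H0K n k q) (normFactor k q w w')⁻¹).comp E

theorem normalized_apply (w w' : W (n + 2)) (E : H0K n k q →ₗ[ℂ] H0K n k q) (u : H0K n k q) :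
    normalized w w' E u = (normFactor k q w w')⁻¹ • E u := rfl

theorem IsSemilinear.normalized {w w' : W (n + 2)} {g : BW (n + 2)}
    {E : H0K n k q →ₗ[ℂ] H0K n k q} (hE : IsSemilinear g E) :
    IsSemilinear g (normalized w w' E) := fun a u => by
  rw [normalized_apply, normalized_apply, hE, smul_comm]

/-- The product formula for intertwiners is used on the left of `a`, and its dual on the right; `j`
turns the functions of `X` and `Y` into scalars of `𝕂`. -/
theorem normFactor_smul_canonicalMap (w w' v v' : W (n + 2)) (a : DAHA n k q) :
    normFactor k q (w * v) (w' * v') • canonicalMap n k q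
        (intertwiner k q w * (intertwiner k q v * a * dualMap n k q (intertwiner k q v')) *
          dualMap n k q (intertwiner k q w')) =
      (normFactor k q w w' * bw w w' • normFactor k q v v') • canonicalMap n k q
        (intertwiner k q (w * v) * a * dualMap n k q (intertwiner k q (w' * v'))) := by
  have h1 := opXHom_dElt_mul_intertwiner (k := k) (q := q) w v
  have h2 := congrArg (dualMap n k q) (opXHom_dElt_mul_intertwiner (k := k) (q := q) w' v')
  rw [dualMap_mul, dualMap_mul, dualMap_mul, dualMap_opXHom, dualMap_opXHom] at h2
  have h3 : opXHom (dElt k q (w * v)) * (intertwiner k q w *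
      (intertwiner k q v * a * dualMap n k q (intertwiner k q v')) *
        dualMap n k q (intertwiner k q w')) * opYHom (diamondFun (dElt k q (w' * v'))) =
      opXHom (dElt k q w * w • dElt k q v) *
        (intertwiner k q (w * v) * a * dualMap n k q (intertwiner k q (w' * v'))) *
        opYHom (diamondFun (dElt k q w' * w' • dElt k q v')) := by
    calc _ = opXHom (dElt k q (w * v)) * (intertwiner k q w * intertwiner k q v) * a *
          (dualMap n k q (intertwiner k q v') * dualMap n k q (intertwiner k q w') *
            opYHom (diamondFun (dElt k q (w' * v')))) := by simp only [mul_assoc]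
      _ = _ := by rw [h1, h2]; simp only [mul_assoc]
  have h4 := congrArg (canonicalMap n k q) h3
  rw [canonicalMap_mul_opYHom, canonicalMap_opXHom_mul, canonicalMap_mul_opYHom,
    canonicalMap_opXHom_mul, smul_smul, smul_smul] at h4
  have h5 : normFactor k q w w' * bw w w' • normFactor k q v v' =
      inYHom (diamondFun (dElt k q w' * w' • dElt k q v')) *
        inXHom (dElt k q w * w • dElt k q v) := by
    rw [normFactor, normFactor, smul_mul', bw_smul_inXHom, bw_smul_inYHom, diamondFun_diamondFun,
      map_mul inXHom, map_mul diamondFun, map_mul inYHom]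
    ring
  rw [h5, ← h4, normFactor, mul_comm]

theorem inv_smul_eq_inv_smul {K V : Type*} [Field K] [AddCommGroup V] [Module K V] {c e : K}
    {x y : V} (hc : c ≠ 0) (he : e ≠ 0) (h : c • x = e • y) : e⁻¹ • x = c⁻¹ • y := by
  rw [inv_smul_eq_iff₀ he, smul_comm, ← h, inv_smul_smul₀ hc]

section

variable {σ : W (n + 2) → W (n + 2) → H0K n k q →ₗ[ℂ] H0K n k q}
  {σι : H0K n k q →ₗ[ℂ] H0K n k q}

/-- Both sides are semilinear for the same group element, so it is enough to compare them on the
image of `j`. There the previous identity is the claim multiplied by nonzero normalising factors. -/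
theorem normalized_mul (hσ : ∀ w w', IsSigma (dualMap n k q) (canonicalMap n k q) w w' (σ w w'))
    (w w' v v' : W (n + 2)) : normalized (w * v) (w' * v') (σ (w * v) (w' * v')) =
      normalized w w' (σ w w') * normalized v v' (σ v v') := by
  have hS : ∀ w w', IsSemilinear (bw w w') (normalized w w' (σ w w')) := fun w w' =>
    IsSemilinear.normalized (hσ w w').2
  refine IsSemilinear.ext (hS _ _) (bw_mul w w' v v' ▸ (hS _ _).comp (hS _ _)) fun a => ?_
  rw [Module.End.mul_apply, normalized_apply v v', hS, normalized_apply, normalized_apply,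
    (hσ _ _).1, (hσ _ _).1, (hσ _ _).1, smul_smul, smul_inv'', ← mul_inv_rev]
  have h := normFactor_smul_canonicalMap (k := k) (q := q) w w' v v' a
  have hne : normFactor k q w w' * bw w w' • normFactor k q v v' ≠ 0 :=
    mul_ne_zero (normFactor_ne_zero _ _) ((smul_ne_zero_iff_ne _).mpr (normFactor_ne_zero _ _))
  exact (inv_smul_eq_inv_smul (K := Mer (n + 2) q) (V := H0K n k q) (normFactor_ne_zero _ _)
    hne h).symm

theorem normalized_one (hσ : ∀ w w', IsSigma (dualMap n k q) (canonicalMap n k q) w w' (σ w w')) :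
    normalized 1 1 (σ 1 1) = 1 := by
  have h1 : IsSemilinear (1 : BW (n + 2)) (normalized 1 1 (σ 1 1)) :=
    bw_one ▸ IsSemilinear.normalized (hσ 1 1).2
  refine IsSemilinear.ext h1 isSemilinear_one fun a => ?_
  rw [normalized_apply, (hσ _ _).1, intertwiner_one, dualMap_opXHom, canonicalMap_mul_opYHom,
    canonicalMap_opXHom_mul, smul_smul (inYHom _), mul_comm (inYHom _)]
  exact inv_smul_smul₀ (normFactor_ne_zero _ _) _

theorem isSigmaIota_mul_self (hι : IsSigmaIota (dualMap n k q) (canonicalMap n k q) σι) :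
    σι * σι = 1 := by
  have hS : IsSemilinear (bwIota : BW (n + 2)) σι := hι.2
  refine IsSemilinear.ext (bwIota_mul_bwIota ▸ hS.comp hS) isSemilinear_one fun a => ?_
  rw [Module.End.mul_apply, hι.1, hι.1, dualMap_dualMap]
  rfl

theorem bwIota_mul_bw {N : ℕ} (w w' : W N) : bwIota * bw w w' = bw w' w * bwIota := by
  rw [← mul_inv_eq_iff_eq_mul]
  exact (SemidirectProduct.inl_aut (Multiplicative.ofAdd 1) (w, w')).symm

/-- On the image of `j` this is `(S̃_w a S̃_{w'}^*)^* = S̃_{w'} a^* S̃_w^*`, and `ι` exchanges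
`d_w(x)` with `d_w^◇(y)`. -/
theorem isSigmaIota_mul_normalized
    (hσ : ∀ w w', IsSigma (dualMap n k q) (canonicalMap n k q) w w' (σ w w'))
    (hι : IsSigmaIota (dualMap n k q) (canonicalMap n k q) σι) (w w' : W (n + 2)) :
    σι * normalized w w' (σ w w') = normalized w' w (σ w' w) * σι := by
  have hS : ∀ w w', IsSemilinear (bw w w') (normalized w w' (σ w w')) := fun w w' =>
    IsSemilinear.normalized (hσ w w').2
  have hS' : IsSemilinear (bwIota : BW (n + 2)) σι := hι.2
  refine IsSemilinear.ext (hS'.comp (hS _ _)) (bwIota_mul_bw w w' ▸ (hS _ _).comp hS') fun a => ?_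
  rw [Module.End.mul_apply, Module.End.mul_apply, normalized_apply, normalized_apply, hS',
    (hσ _ _).1, hι.1, hι.1, (hσ _ _).1, dualMap_mul, dualMap_mul, dualMap_dualMap, mul_assoc]
  congr 1
  rw [smul_inv'', normFactor, normFactor, smul_mul', bwIota_smul_inXHom, bwIota_smul_inYHom,
    diamondFun_diamondFun, mul_comm]

/-- The action of `W × W` on `H0K`. -/
def tauPair (hσ : ∀ w w', IsSigma (dualMap n k q) (canonicalMap n k q) w w' (σ w w')) :
    W (n + 2) × W (n + 2) →* Module.End ℂ (H0K n k q) where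
  toFun p := normalized p.1 p.2 (σ p.1 p.2)
  map_one' := normalized_one hσ
  map_mul' p p' := normalized_mul hσ p.1 p.2 p'.1 p'.2

/-- An involution as an action of `ℤ_2`. -/
def involutionHom {G : Type*} [Group G] (g : G) (hg : g * g = 1) :
    Multiplicative (ZMod 2) →* G where
  toFun z := if z = 1 then 1 else g
  map_one' := by simp
  map_mul' := by
    have h : ∀ z : Multiplicative (ZMod 2), z = 1 ∨ z = Multiplicative.ofAdd 1 := by decide
    have h1 : (Multiplicative.ofAdd 1 : Multiplicative (ZMod 2)) ≠ 1 := by decide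
    have h2 : (Multiplicative.ofAdd 1 : Multiplicative (ZMod 2)) * Multiplicative.ofAdd 1 = 1 := by
      decide
    intro a b
    rcases h a with rfl | rfl <;> rcases h b with rfl | rfl <;> simp [h1, h2, hg]

theorem switchHom_ofAdd_one {N : ℕ} (p : W N × W N) :
    switchHom N (Multiplicative.ofAdd 1) p = (p.2, p.1) := by
  have h1 : (Multiplicative.ofAdd 1 : Multiplicative (ZMod 2)) ≠ 1 := by decide
  simp only [switchHom, MonoidHom.coe_mk, OneHom.coe_mk, if_neg h1]
  rfl

/-- The universal property of `(W × W) ⋊ ℤ_2`: multiplicativity on `W × W`, an involution, and the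
intertwining of the two. -/
theorem exists_isTau (hσ : ∀ w w', IsSigma (dualMap n k q) (canonicalMap n k q) w w' (σ w w'))
    (hι : IsSigmaIota (dualMap n k q) (canonicalMap n k q) σι) :
    ∃ τ : BW (n + 2) →* (H0K n k q ≃ₗ[ℂ] H0K n k q), IsTau σ σι τ := by
  let Φ := LinearMap.GeneralLinearGroup.generalLinearEquiv ℂ (H0K n k q)
  let u : (Module.End ℂ (H0K n k q))ˣ :=
    ⟨σι, σι, isSigmaIota_mul_self hι, isSigmaIota_mul_self hι⟩
  have hu : u * u = 1 := Units.ext (isSigmaIota_mul_self hι)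
  have h : ∀ z : Multiplicative (ZMod 2), z = 1 ∨ z = Multiplicative.ofAdd 1 := by decide
  have h1 : (Multiplicative.ofAdd 1 : Multiplicative (ZMod 2)) ≠ 1 := by decide
  let τ' : BW (n + 2) →* (Module.End ℂ (H0K n k q))ˣ :=
    SemidirectProduct.lift (tauPair hσ).toHomUnits (involutionHom u hu) fun z => by
      refine MonoidHom.ext fun p => ?_
      rcases h z with rfl | rfl
      · simp
      · have h2 : involutionHom u hu (Multiplicative.ofAdd 1) = u := if_neg (t := 1) h1
        rw [MonoidHom.comp_apply, MonoidHom.comp_apply, h2]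
        change (tauPair hσ).toHomUnits (switchHom _ _ p) = u * (tauPair hσ).toHomUnits p * u⁻¹
        rw [eq_mul_inv_iff_mul_eq, switchHom_ofAdd_one]
        exact Units.ext (isSigmaIota_mul_normalized hσ hι p.1 p.2).symm
  refine ⟨Φ.toMonoidHom.comp τ', fun w w' f => ?_, fun f => ?_⟩
  · have h2 : τ' (bw w w') = (tauPair hσ).toHomUnits (w, w') := SemidirectProduct.lift_inl ..
    change ((τ' (bw w w') : (Module.End ℂ (H0K n k q))ˣ) : Module.End ℂ (H0K n k q)) f = _
    rw [h2]
    change (normFactor k q w w')⁻¹ • σ w w' f = _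
    rw [normFactor, mul_inv]
    rfl
  · have h2 : τ' bwIota = u := (SemidirectProduct.lift_inr ..).trans (if_neg (t := 1) h1)
    change ((τ' bwIota : (Module.End ℂ (H0K n k q))ˣ) : Module.End ℂ (H0K n k q)) f = _
    rw [h2]

theorem IsTau.unique {τ τ' : BW (n + 2) →* (H0K n k q ≃ₗ[ℂ] H0K n k q)}
    (hτ : IsTau σ σι τ) (hτ' : IsTau σ σι τ') : τ = τ' := by
  have h : ∀ z : Multiplicative (ZMod 2), z = 1 ∨ z = Multiplicative.ofAdd 1 := by decide
  refine SemidirectProduct.hom_ext (MonoidHom.ext fun p => ?_) (MonoidHom.ext fun z => ?_)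
  · exact LinearEquiv.ext fun f => (hτ.1 p.1 p.2 f).trans (hτ'.1 p.1 p.2 f).symm
  · rcases h z with rfl | rfl
    · rw [map_one, map_one]
    · exact LinearEquiv.ext fun f => (hτ.2 f).trans (hτ'.2 f).symm

theorem IsTau.semilinear {τ : BW (n + 2) →* (H0K n k q ≃ₗ[ℂ] H0K n k q)} (hτ : IsTau σ σι τ)
    (hσ : ∀ w w', IsSigma (dualMap n k q) (canonicalMap n k q) w w' (σ w w'))
    (hι : IsSigmaIota (dualMap n k q) (canonicalMap n k q) σι) (g : BW (n + 2))
    (a : Mer (n + 2) q) (f : H0K n k q) : τ g (a • f) = (g • a) • τ g f := by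
  have h : ∀ z : Multiplicative (ZMod 2), z = 1 ∨ z = Multiplicative.ofAdd 1 := by decide
  have h1 : ∀ z : Multiplicative (ZMod 2), ∀ (a : Mer (n + 2) q) (f : H0K n k q),
      τ (SemidirectProduct.inr z) (a • f) =
        ((SemidirectProduct.inr z : BW (n + 2)) • a) • τ (SemidirectProduct.inr z) f := by
    intro z a f
    rcases h z with rfl | rfl
    · rw [map_one, map_one, one_smul]
      rfl
    · exact (hτ.2 _).trans ((hι.2 a f).trans (congrArg _ (hτ.2 f).symm))
  have h2 : ∀ w w' : W (n + 2), ∀ (a : Mer (n + 2) q) (f : H0K n k q),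
      τ (bw w w') (a • f) = (bw w w' • a) • τ (bw w w') f := by
    intro w w' a f
    rw [hτ.1, hτ.1, (hσ w w').2, smul_comm]
  rw [← SemidirectProduct.inl_left_mul_inr_right g]
  change τ (bw g.left.1 g.left.2 * _) _ = ((bw g.left.1 g.left.2 * _ : BW (n + 2)) • a) •
    τ (bw g.left.1 g.left.2 * _) f
  rw [map_mul, LinearEquiv.mul_apply, LinearEquiv.mul_apply, h1, h2, mul_smul]

end

/-! ### The cocycle and the solutions of the BqKZ equations -/

section

variable {τ : BW (n + 2) →* (H0K n k q ≃ₗ[ℂ] H0K n k q)}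

/-- The value `C_g = τ(g) g⁻¹` of the cocycle. -/
def cocycle (hτ : ∀ (g : BW (n + 2)) (a : Mer (n + 2) q) (f : H0K n k q),
    τ g (a • f) = (g • a) • τ g f) (g : BW (n + 2)) :
    H0K n k q ≃ₗ[Mer (n + 2) q] H0K n k q where
  toFun u := τ g (coeffAct g⁻¹ u)
  invFun u := coeffAct g (τ g⁻¹ u)
  map_add' u v := by rw [map_add, map_add]
  map_smul' a u := by rw [coeffAct_smul, hτ, smul_inv_smul, RingHom.id_apply]
  left_inv u := by
    beta_reduce
    rw [← LinearEquiv.mul_apply (τ g⁻¹), ← map_mul, inv_mul_cancel, map_one, LinearEquiv.coe_one, id,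
      ← coeffAct_mul, mul_inv_cancel, coeffAct_one]
  right_inv u := by
    beta_reduce
    rw [← coeffAct_mul, inv_mul_cancel, coeffAct_one, ← LinearEquiv.mul_apply, ← map_mul,
      mul_inv_cancel, map_one, LinearEquiv.coe_one, id]

variable (hτ : ∀ (g : BW (n + 2)) (a : Mer (n + 2) q) (f : H0K n k q),
    τ g (a • f) = (g • a) • τ g f)

theorem cocycle_apply (g : BW (n + 2)) (u : H0K n k q) :
    cocycle hτ g u = τ g (coeffAct g⁻¹ u) := rfl

theorem cocycle_mul (g g' : BW (n + 2)) :
    cocycle hτ (g * g') = cocycle hτ g * g • cocycle hτ g' := by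
  refine LinearEquiv.ext fun u => ?_
  rw [LinearEquiv.mul_apply, smul_apply_H0K, cocycle_apply, cocycle_apply, cocycle_apply,
    ← coeffAct_mul g⁻¹ g, inv_mul_cancel, coeffAct_one, map_mul, LinearEquiv.mul_apply,
    mul_inv_rev, coeffAct_mul]

theorem cocycle_coeffAct (g : BW (n + 2)) (u : H0K n k q) :
    cocycle hτ g (coeffAct g u) = τ g u := by
  rw [cocycle_apply, ← coeffAct_mul, inv_mul_cancel, coeffAct_one]

/-- Since `C_g g = τ(g)`, solving BqKZ means being invariant under `τ` of the lattice. -/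
theorem mem_SOL_cocycle {f : H0K n k q} :
    f ∈ SOL (cocycle hτ) ↔ ∀ u v, τ (bwTransl u v) f = f :=
  forall₂_congr fun u v => by rw [cocycle_coeffAct]

theorem bwTransl_add {N : ℕ} (u v u' v' : Fin N → ℤ) :
    bwTransl (u + u') (v + v') = bwTransl u v * bwTransl u' v' := by
  rw [bwTransl, transl_add, transl_add, bw_mul]
  rfl

/-- By the cocycle property each side is the value of `C` at a product of two translations, and
translations commute. -/
theorem cocycle_holonomy (u v u' v' : Fin (n + 2) → ℤ) :
    cocycle hτ (bwTransl u v) * bwTransl u v • cocycle hτ (bwTransl u' v') =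
      cocycle hτ (bwTransl u' v') * bwTransl u' v' • cocycle hτ (bwTransl u v) := by
  rw [← cocycle_mul, ← cocycle_mul, ← bwTransl_add, ← bwTransl_add, add_comm u, add_comm v]

/-- The space of solutions of the BqKZ equations, over the field of quasi-constants. -/
def solutionSpace : Submodule (invField (n + 2) q) (H0K n k q) where
  carrier := SOL (cocycle hτ)
  add_mem' {f g} hf hg := by
    rw [mem_SOL_cocycle] at hf hg ⊢
    intro u v
    rw [map_add, hf, hg]
  zero_mem' := by
    rw [mem_SOL_cocycle]
    exact fun u v => map_zero _
  smul_mem' a f hf := by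
    rw [mem_SOL_cocycle] at hf ⊢
    intro u v
    change τ _ ((a : Mer (n + 2) q) • f) = (a : Mer (n + 2) q) • f
    rw [hτ, hf, a.2]

/-- `𝕊_N` normalises the lattice: permutations permute coordinates, and `ι` switches the two copies
of `ℤ^N`. -/
theorem exists_mul_eq_mul_bwTransl {N : ℕ} {g : BW N} (hg : g ∈ finiteSubgroup N)
    (u v : Fin N → ℤ) : ∃ u' v', bwTransl u v * g = g * bwTransl u' v' := by
  have h : ∀ z : Multiplicative (ZMod 2), z = 1 ∨ z = Multiplicative.ofAdd 1 := by decide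
  have hz : ∀ z : Multiplicative (ZMod 2), ∀ u v : Fin N → ℤ, ∃ u' v',
      bwTransl u v * SemidirectProduct.inr z = SemidirectProduct.inr z * bwTransl u' v' := by
    intro z u v
    rcases h z with rfl | rfl
    · exact ⟨u, v, by rw [map_one, mul_one, one_mul]⟩
    · exact ⟨v, u, (bwIota_mul_bw _ _).symm⟩
  have hp : ∀ (σ : Equiv.Perm (Fin N)) (u : Fin N → ℤ), ∃ u',
      transl u * perm σ = perm σ * transl u' := by
    intro σ u
    refine ⟨fun i => u (σ i), ?_⟩
    rw [mul_inv_eq_iff_eq_mul.mp (perm_conj_transl σ fun i => u (σ i))]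
    congr 2
    funext i
    exact congrArg u (σ.apply_symm_apply i).symm
  obtain ⟨σ, ρ, hgl⟩ := hg
  obtain ⟨u', hu⟩ := hp σ u
  obtain ⟨v', hv⟩ := hp ρ v
  obtain ⟨u'', v'', huv⟩ := hz g.right u' v'
  refine ⟨u'', v'', ?_⟩
  have hgg : g = bw (perm σ) (perm ρ) * SemidirectProduct.inr g.right := by
    rw [bw, ← hgl, SemidirectProduct.inl_left_mul_inr_right]
  have h1 : bwTransl u v * bw (perm σ) (perm ρ) = bw (perm σ) (perm ρ) * bwTransl u' v' := by
    rw [bwTransl, bwTransl, ← bw_mul, ← bw_mul, hu, hv]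
  generalize g.right = z at huv hgg
  rw [hgg, ← mul_assoc, h1, mul_assoc, huv, mul_assoc]

theorem map_mem_SOL_cocycle {g : BW (n + 2)} (hg : g ∈ finiteSubgroup (n + 2)) {f : H0K n k q}
    (hf : f ∈ SOL (cocycle hτ)) : τ g f ∈ SOL (cocycle hτ) := by
  rw [mem_SOL_cocycle] at hf ⊢
  intro u v
  obtain ⟨u', v', h⟩ := exists_mul_eq_mul_bwTransl hg u v
  rw [← LinearEquiv.mul_apply, ← map_mul, h, map_mul, LinearEquiv.mul_apply, hf]

end

end
end BqKZ

/-! ### The theorem -/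

theorem mainTheorem1 (n : ℕ) (k q : ℂˣ) (hq : ∃ r : ℝ, 0 < r ∧ r < 1 ∧ (q : ℂ) = (r : ℂ)) :
    (∃! s : DAHA n k q →ₗ[ℂ] DAHA n k q, IsDuality s) ∧
    (∃! j : DAHA n k q →ₗ[ℂ] H0K n k q, IsCanonicalMap j) ∧
    ∀ (s : DAHA n k q →ₗ[ℂ] DAHA n k q) (j : DAHA n k q →ₗ[ℂ] H0K n k q),
      IsDuality s → IsCanonicalMap j →
      (∀ w w' : W (n + 2), ∃! E : H0K n k q →ₗ[ℂ] H0K n k q, IsSigma s j w w' E) ∧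
      (∃! E : H0K n k q →ₗ[ℂ] H0K n k q, IsSigmaIota s j E) ∧
      ∀ (σ : W (n + 2) → W (n + 2) → H0K n k q →ₗ[ℂ] H0K n k q)
        (σι : H0K n k q →ₗ[ℂ] H0K n k q),
        (∀ w w', IsSigma s j w w' (σ w w')) → IsSigmaIota s j σι →
        -- the group action `τ`
        (∃! τ : BW (n + 2) →* (H0K n k q ≃ₗ[ℂ] H0K n k q), IsTau σ σι τ) ∧
        ∀ τ : BW (n + 2) →* (H0K n k q ≃ₗ[ℂ] H0K n k q), IsTau σ σι τ →
          (∀ (g : BW (n + 2)) (a : Mer (n + 2) q) (f : H0K n k q),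
            τ g (a • f) = (g • a) • τ g f) ∧
          -- the cocycle `C_g = τ(g) g⁻¹`
          ∃ C : BW (n + 2) → (H0K n k q ≃ₗ[Mer (n + 2) q] H0K n k q),
            (∀ g f, C g f = τ g (coeffAct g⁻¹ f)) ∧
            (∀ g g', C (g * g') = C g * g • C g') ∧
            -- holonomy of the BqKZ equations
            (∀ u v u' v' : Fin (n + 2) → ℤ,
              C (bwTransl u v) * bwTransl u v • C (bwTransl u' v') =
                C (bwTransl u' v') * bwTransl u' v' • C (bwTransl u v)) ∧
            -- the solution space
            (∃ V : Submodule (invField (n + 2) q) (H0K n k q), (V : Set (H0K n k q)) = SOL C) ∧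
            (∀ g ∈ finiteSubgroup (n + 2), ∀ f ∈ SOL C, τ g f ∈ SOL C) := by
  refine ⟨existsUnique_isDuality n k q, ⟨canonicalMap n k q, isCanonicalMap_canonicalMap,
    fun _ hj => hj.eq_canonicalMap⟩, ?_⟩
  intro s j hs hj
  -- By uniqueness, an arbitrary duality and canonical map are the ones constructed above.
  obtain rfl := hs.eq_dualMap
  obtain rfl := hj.eq_canonicalMap
  refine ⟨existsUnique_isSigma, existsUnique_isSigmaIota n k q, fun σ σι hσ hι => ?_⟩
  obtain ⟨τ, hτ⟩ := exists_isTau hσ hι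
  refine ⟨⟨τ, hτ, fun _ h => h.unique hτ⟩, fun τ hτ => ?_⟩
  have hsemi := hτ.semilinear hσ hι
  exact ⟨hsemi, cocycle hsemi, cocycle_apply hsemi, cocycle_mul hsemi, cocycle_holonomy hsemi,
    ⟨solutionSpace hsemi, rfl⟩, fun g hg f hf => map_mem_SOL_cocycle hsemi hg hf⟩
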